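/- Let $P$ be a smooth finite-dimensional manifold with a Dirac structure $L$: a smooth subbundle $L\subset TP\oplus T^*P$ that is maximal isotropic for $\langle X_1\oplus\xi_1,X_2\oplus\xi_2\rangle_+=\tfrac12(\xi_1(X_2)+\xi_2(X_1))$ and whose sections are closed under the Courant bracket $$[X_1\oplus\xi_1,X_2\oplus\xi_2]=[X_1,X_2]\oplus\big(\mathcal L_{X_1}\xi_2-\mathcal L_{X_2}\xi_1+\tfrac12 d(\xi_1(X_2)-\xi_2(X_1))\big).$$ A function $g\in C^\infty(P)$ is admissible if $X\oplus dg\in\Gamma(L)$ for some smooth vector field $X$. Let $\pi:Q\to P$ be a smooth principal $U(1)$-bundle, $E$ the generator of the action of $U(1)=\mathbb R/\mathbb Z$, $\sigma$ a connection form ($\sigma(E)=1$) with curvature $\Omega$, i.e. $d\sigma=\pi^*\Omega$, and let $\beta$ be a smooth section of $L^*$ such that, for all local sections $e_i=X_i\oplus\xi_i$ of $L$, $$\Omega(X_1,X_2)=\tfrac12(\xi_1(X_2)-\xi_2(X_1))+X_1\cdot\beta(e_2)-X_2\cdot\beta(e_1)-\beta([e_1,e_2]).$$ Let $A\oplus\alpha$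 be a smooth section of $TP\oplus T^*P$ with $\langle A\oplus\alpha,A\oplus\alpha\rangle_+=0$ and $\beta=2\langle A\oplus\alpha,\cdot\rangle_+|_L$. With $X^H$ denoting the $\sigma$-horizontal lift, let $\bar L\subset(TQ\times\mathbb R)\oplus(T^*Q\times\mathbb R)$ be the sum of $$\{(X^H+\beta(X\oplus\xi)E,0)\oplus(\pi^*\xi,0):X\oplus\xi\in L\}$$ and of the lines spanned by $(-E,0)\oplus(0,1)$ and $(-A^H,1)\oplus(\sigma-\pi^*\alpha,0)$. A real function $f$, smooth on an open set $V\subset Q$, is admissible on $V$ if there are a smooth vector field $X$ (called a hamiltonian vector field of $f$) and a smooth function $\varphi$ on $V$ such that $(X,\varphi)\oplus(df,f)$ is a section of $\bar L$ over $V$; a smooth complex function is admissible if its real and imaginary parts are. A smooth complex function $\phi$ on $V$ is basic if $Y\cdot\phi+c\,\phi=0$ for all $(Y,c)\in\bar L\cap(TQ\times\mathbb R)$ over $V$. For $n\in\mathbb Z$ let $H^n_{adm}$ (resp. $H^n_{bas}$) be the sheaf on $P$ whose sections over an open set $U$ are the admissible (resp. basic) complex functions $\phi$ on $\pi^{-1}(U)$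 with $E\cdot\phi=2\pi i n\,\phi$. Consider the hamiltonian vector fields $X_{\pi^*g}$ on $Q$ of the functions $\pi^*g$, where $g$ runs over the admissible functions on $P$, modulo sections of $\bar L\cap TQ$. To the class of $X_{\pi^*g}$ corresponds the operator $\phi\mapsto-X_{\pi^*g}\cdot\phi$ on the sections $\phi$ of $H^n_{adm}$, respectively $H^n_{bas}$, over all open subsets of $P$; it depends only on the class. Then, for every integer $n\neq0$, the map sending the class of $X_{\pi^*g}$ to its operator on $H^n_{adm}$ is injective, and so is the map sending it to its operator on $H^n_{bas}$. -/

import Mathlib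

open Set Bundle TopologicalSpace
open scoped Manifold ContDiff

noncomputable section

namespace DiracPrequant

/-! ### Vector fields, one-forms and sections of `TM ⊕ T*M` -/

section Calculus

variable (E : Type*) [NormedAddCommGroup E] [NormedSpace ℝ E]
  {M : Type*} [TopologicalSpace M] [ChartedSpace E M]

/-- The cotangent space of `M` at `x`. -/
abbrev Cotangent (x : M) : Type _ := TangentSpace 𝓘(ℝ, E) x →L[ℝ] ℝ

/-- The fibre `T_x M ⊕ T_x* M` of the generalized tangent bundle. -/
abbrev GenTangent (x : M) : Type _ := TangentSpace 𝓘(ℝ, E) x × Cotangent E x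

variable {E}

/-- The vector field `X` is smooth on `U`. -/
def SmoothVectorOn [IsManifold 𝓘(ℝ, E) ∞ M] (X : (x : M) → TangentSpace 𝓘(ℝ, E) x) (U : Set M) :
    Prop :=
  ContMDiffOn 𝓘(ℝ, E) 𝓘(ℝ, E).tangent ∞ (fun x => (⟨x, X x⟩ : TangentBundle 𝓘(ℝ, E) M)) U

/-- The one-form `ξ` is smooth on `U`, as a section of the cotangent bundle. -/
def SmoothFormOn [IsManifold 𝓘(ℝ, E) ∞ M] (ξ : (x : M) → Cotangent E x) (U : Set M) : Prop :=
  ContMDiffOn 𝓘(ℝ, E) (𝓘(ℝ, E).prod 𝓘(ℝ, E →L[ℝ] ℝ)) ∞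
    (fun x => TotalSpace.mk' (E →L[ℝ] ℝ)
      (E := fun x : M => TangentSpace 𝓘(ℝ, E) x →L[ℝ] Bundle.Trivial M ℝ x) x (ξ x)) U

/-- The section `e = X ⊕ ξ` of `TM ⊕ T*M` is smooth on `U`. -/
def SmoothGenOn [IsManifold 𝓘(ℝ, E) ∞ M] (e : (x : M) → GenTangent E x) (U : Set M) : Prop :=
  SmoothVectorOn (fun x => (e x).1) U ∧ SmoothFormOn (fun x => (e x).2) U

/-- The differential of a real function, as a one-form. -/
def differential (f : M → ℝ) (x : M) : Cotangent E x :=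
  mfderiv 𝓘(ℝ, E) 𝓘(ℝ, ℝ) f x

/-- The derivative `Y·φ` of a complex function along a tangent vector. -/
def derivAlong (φ : M → ℂ) (x : M) (Y : TangentSpace 𝓘(ℝ, E) x) : ℂ :=
  (mfderiv 𝓘(ℝ, E) 𝓘(ℝ, ℂ) φ x : TangentSpace 𝓘(ℝ, E) x →L[ℝ] ℂ) Y

theorem derivAlong_sub (φ : M → ℂ) (x : M) (Y Y' : TangentSpace 𝓘(ℝ, E) x) :
    derivAlong φ x (Y - Y') = derivAlong φ x Y - derivAlong φ x Y' :=
  map_sub (mfderiv 𝓘(ℝ, E) 𝓘(ℝ, ℂ) φ x : TangentSpace 𝓘(ℝ, E) x →L[ℝ] ℂ) Y Y'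

/-- The one-form `ξ` written in the preferred chart at `x`. -/
def formInChart (ξ : (x : M) → Cotangent E x) (x : M) : E → (E →L[ℝ] ℝ) := fun y =>
  (ξ ((extChartAt 𝓘(ℝ, E) x).symm y)).comp
    (mfderiv 𝓘(ℝ, E) 𝓘(ℝ, E) (extChartAt 𝓘(ℝ, E) x).symm y)

/-- The exterior derivative of a one-form, computed in the preferred chart at `x`:
`dξ(v, w) = (D_v ξ)(w) - (D_w ξ)(v)`. -/
def extDerivForm (ξ : (x : M) → Cotangent E x) (x : M) (v w : TangentSpace 𝓘(ℝ, E) x) : ℝ :=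
  let D : E →L[ℝ] E →L[ℝ] ℝ := fderiv ℝ (formInChart ξ x) (extChartAt 𝓘(ℝ, E) x x)
  let c : TangentSpace 𝓘(ℝ, E) x →L[ℝ] E := mfderiv 𝓘(ℝ, E) 𝓘(ℝ, E) (extChartAt 𝓘(ℝ, E) x) x
  D (c v) (c w) - D (c w) (c v)

/-- The contraction `i_v dξ` of the exterior derivative of the one-form `ξ`. -/
def contractExtDeriv (ξ : (x : M) → Cotangent E x) (x : M) (v : TangentSpace 𝓘(ℝ, E) x) :
    Cotangent E x :=
  let D : E →L[ℝ] E →L[ℝ] ℝ := fderiv ℝ (formInChart ξ x) (extChartAt 𝓘(ℝ, E) x x)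
  let c : TangentSpace 𝓘(ℝ, E) x →L[ℝ] E := mfderiv 𝓘(ℝ, E) 𝓘(ℝ, E) (extChartAt 𝓘(ℝ, E) x) x
  (D (c v) - D.flip (c v)).comp c

theorem contractExtDeriv_apply (ξ : (x : M) → Cotangent E x) (x : M)
    (v w : TangentSpace 𝓘(ℝ, E) x) : contractExtDeriv ξ x v w = extDerivForm ξ x v w := rfl

/-- The Lie derivative of a one-form, `𝓛_X ξ = i_X dξ + d (i_X ξ)`. -/
def lieDerivForm (X : (x : M) → TangentSpace 𝓘(ℝ, E) x) (ξ : (x : M) → Cotangent E x) (x : M) :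
    Cotangent E x :=
  contractExtDeriv ξ x (X x) + differential (fun y => ξ y (X y)) x

/-- The symmetric pairing `⟨X₁ ⊕ ξ₁, X₂ ⊕ ξ₂⟩₊ = (ξ₁(X₂) + ξ₂(X₁)) / 2`. -/
def pairPlus {x : M} (e₁ e₂ : GenTangent E x) : ℝ := (1 / 2) * (e₁.2 e₂.1 + e₂.2 e₁.1)

/-- The antisymmetric pairing `⟨X₁ ⊕ ξ₁, X₂ ⊕ ξ₂⟩₋ = (ξ₁(X₂) - ξ₂(X₁)) / 2`. -/
def pairMinus {x : M} (e₁ e₂ : GenTangent E x) : ℝ := (1 / 2) * (e₁.2 e₂.1 - e₂.2 e₁.1)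

/-- A subspace of `T_x M ⊕ T_x* M` is isotropic if the symmetric pairing vanishes on it. -/
def IsIsotropic {x : M} (W : Submodule ℝ (GenTangent E x)) : Prop :=
  ∀ e₁ ∈ W, ∀ e₂ ∈ W, pairPlus e₁ e₂ = 0

/-- The Courant bracket of two sections of `TM ⊕ T*M`. -/
def courantBracket (e₁ e₂ : (x : M) → GenTangent E x) (x : M) : GenTangent E x :=
  (VectorField.mlieBracket 𝓘(ℝ, E) (fun y => (e₁ y).1) (fun y => (e₂ y).1) x,
    lieDerivForm (fun y => (e₁ y).1) (fun y => (e₂ y).2) x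
      - lieDerivForm (fun y => (e₂ y).1) (fun y => (e₁ y).2) x
      + (1 / 2 : ℝ) • differential (fun y => (e₁ y).2 (e₂ y).1 - (e₂ y).2 (e₁ y).1) x)

end Calculus

/-! ### Dirac structures -/

/-- A Dirac structure on `M`: a smooth subbundle `L` of `TM ⊕ T*M` which is maximal isotropic for
the symmetric pairing and whose (local) smooth sections are closed under the Courant bracket.
A section over an open set `U` is represented by a choice of an element in every fibre, of which
only the values over `U` matter. -/
structure DiracStructure (E : Type*) [NormedAddCommGroup E] [NormedSpace ℝ E]
    (M : Type*) [TopologicalSpace M] [ChartedSpace E M] [IsManifold 𝓘(ℝ, E) ∞ M] where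
  fiber : (x : M) → Submodule ℝ (GenTangent E x)
  smooth_frame : ∀ x₀ : M, ∃ U : Set M, IsOpen U ∧ x₀ ∈ U ∧
    ∃ e : Fin (Module.finrank ℝ E) → (x : M) → GenTangent E x,
      (∀ i, SmoothGenOn (e i) U) ∧
      ∀ x ∈ U, LinearIndependent ℝ (fun i => e i x) ∧
        Submodule.span ℝ (range fun i => e i x) = fiber x
  maximal_isotropic : ∀ x, Maximal IsIsotropic (fiber x)
  courant_mem : ∀ U : Set M, IsOpen U → ∀ s₁ s₂ : (x : M) → fiber x,
    SmoothGenOn (fun x => (s₁ x : GenTangent E x)) U →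
    SmoothGenOn (fun x => (s₂ x : GenTangent E x)) U →
    ∀ x ∈ U, courantBracket (fun y => (s₁ y : GenTangent E y)) (fun y => (s₂ y : GenTangent E y)) x
      ∈ fiber x

namespace DiracStructure

variable {E : Type*} [NormedAddCommGroup E] [NormedSpace ℝ E]
  {M : Type*} [TopologicalSpace M] [ChartedSpace E M] [IsManifold 𝓘(ℝ, E) ∞ M]

/-- `s` is a smooth section of `L` over `U`. -/
def SmoothSectionOn (L : DiracStructure E M) (s : (x : M) → L.fiber x) (U : Set M) : Prop :=
  SmoothGenOn (fun x => (s x : GenTangent E x)) U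

/-- The value at `x` of the Courant bracket of two smooth sections of `L`, as an element of `L`. -/
def bracket (L : DiracStructure E M) {U : Set M} (hU : IsOpen U) {s₁ s₂ : (x : M) → L.fiber x}
    (h₁ : L.SmoothSectionOn s₁ U) (h₂ : L.SmoothSectionOn s₂ U) {x : M} (hx : x ∈ U) :
    L.fiber x :=
  ⟨courantBracket (fun y => (s₁ y : GenTangent E y)) (fun y => (s₂ y : GenTangent E y)) x,
    L.courant_mem U hU s₁ s₂ h₁ h₂ x hx⟩

/-- `β` is a smooth section of the dual bundle `L*`: it takes smooth sections of `L` to smooth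
functions. -/
def SmoothDual (L : DiracStructure E M) (β : (x : M) → L.fiber x →ₗ[ℝ] ℝ) : Prop :=
  ∀ U : Set M, IsOpen U → ∀ s : (x : M) → L.fiber x, L.SmoothSectionOn s U →
    ContMDiffOn 𝓘(ℝ, E) 𝓘(ℝ, ℝ) ∞ (fun x => β x (s x)) U

/-- The Lie algebroid differential of a section `β` of `L*`, evaluated on two sections of `L`:
`(d_L β)(s₁, s₂) = ρ(s₁)·β(s₂) - ρ(s₂)·β(s₁) - β([s₁, s₂])`, with anchor `ρ(X ⊕ ξ) = X`. -/
def dL (L : DiracStructure E M) (β : (x : M) → L.fiber x →ₗ[ℝ] ℝ) {U : Set M} (hU : IsOpen U)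
    {s₁ s₂ : (x : M) → L.fiber x}
    (h₁ : L.SmoothSectionOn s₁ U) (h₂ : L.SmoothSectionOn s₂ U) {x : M} (hx : x ∈ U) : ℝ :=
  differential (fun y => β y (s₂ y)) x (s₁ x : GenTangent E x).1
    - differential (fun y => β y (s₁ y)) x (s₂ x : GenTangent E x).1
    - β x (L.bracket hU h₁ h₂ hx)

/-- A function `g` is admissible if it is smooth and has a hamiltonian vector field, i.e. a smooth
vector field `X` such that `X ⊕ dg` is a section of `L`. -/
def IsAdmissible (L : DiracStructure E M) (g : M → ℝ) : Prop :=
  ContMDiff 𝓘(ℝ, E) 𝓘(ℝ, ℝ) ∞ g ∧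
    ∃ X : (x : M) → TangentSpace 𝓘(ℝ, E) x, SmoothVectorOn X univ ∧
      ∀ x, (X x, differential g x) ∈ L.fiber x

end DiracStructure

/-! ### Principal circle bundles and connections

The group is abelian, so that right actions are the same as left actions. -/

section CircleBundle

variable (E F : Type*) [NormedAddCommGroup E] [NormedSpace ℝ E]
  [NormedAddCommGroup F] [NormedSpace ℝ F]
  {P : Type*} [TopologicalSpace P] [ChartedSpace E P]
  {Q : Type*} [TopologicalSpace Q] [ChartedSpace F Q] [MulAction Circle Q]

/-- `proj : Q → P` is a smooth principal `U(1)`-bundle: it is invariant under the action and has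
smooth equivariant local trivializations around every point of `P`. -/
structure IsPrincipalCircleBundle (proj : Q → P) : Prop where
  smooth_action : ContMDiffSMul (𝓡 1) 𝓘(ℝ, F) ∞ Circle Q
  smooth_proj : ContMDiff 𝓘(ℝ, F) 𝓘(ℝ, E) ∞ proj
  proj_smul : ∀ (z : Circle) (q : Q), proj (z • q) = proj q
  locally_trivial : ∀ p : P, ∃ e : Trivialization Circle proj, p ∈ e.baseSet ∧
    ContMDiffOn 𝓘(ℝ, F) (𝓘(ℝ, E).prod (𝓡 1)) ∞ e e.source ∧
    ContMDiffOn (𝓘(ℝ, E).prod (𝓡 1)) 𝓘(ℝ, F) ∞ e.toOpenPartialHomeomorph.symm e.target ∧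
    ∀ q ∈ e.source, ∀ z : Circle, (e (z • q)).2 = z * (e q).2

variable {F}

/-- The infinitesimal generator of the action of `U(1) = ℝ/ℤ`: the derivative at `t = 0` of
`t ↦ exp(2πit)·q`. -/
def generator (q : Q) : TangentSpace 𝓘(ℝ, F) q :=
  (mfderiv 𝓘(ℝ, ℝ) 𝓘(ℝ, F) (fun t : ℝ => Circle.exp (2 * Real.pi * t) • q) 0 :
    ℝ →L[ℝ] F) (1 : ℝ)

/-- A connection form on a principal `U(1)`-bundle: a smooth invariant one-form taking the value
one on the infinitesimal generator of the action. -/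
structure IsConnectionForm [IsManifold 𝓘(ℝ, F) ∞ Q] (σ : (q : Q) → Cotangent F q) : Prop where
  smooth : SmoothFormOn σ univ
  apply_generator : ∀ q, σ q (generator q) = 1
  invariant : ∀ (z : Circle) (q : Q) (v : TangentSpace 𝓘(ℝ, F) q),
    σ (z • q) (mfderiv 𝓘(ℝ, F) 𝓘(ℝ, F) (fun q' : Q => z • q') q v) = σ q v

end CircleBundle

/-! ### Prequantization of a Dirac manifold -/

/-- The fibre `(T_q Q × ℝ) ⊕ (T_q* Q × ℝ)` of the bundle `ℰ¹(Q)`. -/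
abbrev ExtTangent (F : Type*) [NormedAddCommGroup F] [NormedSpace ℝ F]
    {Q : Type*} [TopologicalSpace Q] [ChartedSpace F Q] (q : Q) : Type _ :=
  (TangentSpace 𝓘(ℝ, F) q × ℝ) × (Cotangent F q × ℝ)

/-- The data defining a prequantization of the Dirac manifold `(P, L)`:
a principal `U(1)`-bundle `π : Q → P`, a connection form `σ` with curvature `Ω` (`dσ = π^*Ω`),
a section `β` of `L*` with `ρ^*Ω = Υ + d_L β` where `Υ` is the restriction to `L` of the
antisymmetric pairing, and an isotropic section `A ⊕ α` of `TP ⊕ T*P` representing `β`, that is,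
`β = 2⟨A ⊕ α, ·⟩₊` on `L`. Smoothness, closedness and integrality of `Ω` follow from
`dσ = π^*Ω`. -/
structure Prequantization {E : Type*} [NormedAddCommGroup E] [NormedSpace ℝ E]
    {P : Type*} [TopologicalSpace P] [ChartedSpace E P] [IsManifold 𝓘(ℝ, E) ∞ P]
    (L : DiracStructure E P)
    (F : Type*) [NormedAddCommGroup F] [NormedSpace ℝ F]
    (Q : Type*) [TopologicalSpace Q] [ChartedSpace F Q] [IsManifold 𝓘(ℝ, F) ∞ Q]
    [MulAction Circle Q] where
  proj : Q → P
  principal : IsPrincipalCircleBundle E F proj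
  σ : (q : Q) → Cotangent F q
  connection : IsConnectionForm σ
  Ω : (p : P) → TangentSpace 𝓘(ℝ, E) p →L[ℝ] TangentSpace 𝓘(ℝ, E) p →L[ℝ] ℝ
  curvature : ∀ (q : Q) (v w : TangentSpace 𝓘(ℝ, F) q), extDerivForm σ q v w =
    Ω (proj q) (mfderiv 𝓘(ℝ, F) 𝓘(ℝ, E) proj q v) (mfderiv 𝓘(ℝ, F) 𝓘(ℝ, E) proj q w)
  β : (p : P) → L.fiber p →ₗ[ℝ] ℝ
  smooth_β : L.SmoothDual β
  prequantization_condition : ∀ (U : Set P) (hU : IsOpen U) (s₁ s₂ : (p : P) → L.fiber p)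
    (h₁ : L.SmoothSectionOn s₁ U) (h₂ : L.SmoothSectionOn s₂ U) (p : P) (hp : p ∈ U),
    Ω p (s₁ p : GenTangent E p).1 (s₂ p : GenTangent E p).1 =
      pairMinus (s₁ p : GenTangent E p) (s₂ p : GenTangent E p) + L.dL β hU h₁ h₂ hp
  A : (p : P) → TangentSpace 𝓘(ℝ, E) p
  α : (p : P) → Cotangent E p
  smooth_A : SmoothVectorOn A univ
  smooth_α : SmoothFormOn α univ
  isotropic : ∀ p, pairPlus (A p, α p) (A p, α p) = 0
  β_eq : ∀ (p : P) (e : L.fiber p), β p e = 2 * pairPlus (A p, α p) (e : GenTangent E p)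

namespace Prequantization

variable {E : Type*} [NormedAddCommGroup E] [NormedSpace ℝ E]
  {P : Type*} [TopologicalSpace P] [ChartedSpace E P] [IsManifold 𝓘(ℝ, E) ∞ P]
  {L : DiracStructure E P}
  {F : Type*} [NormedAddCommGroup F] [NormedSpace ℝ F]
  {Q : Type*} [TopologicalSpace Q] [ChartedSpace F Q] [IsManifold 𝓘(ℝ, F) ∞ Q]
  [MulAction Circle Q] (B : Prequantization L F Q)

/-- The derivative of the projection `π : Q → P`. -/
def dproj (q : Q) : TangentSpace 𝓘(ℝ, F) q →L[ℝ] TangentSpace 𝓘(ℝ, E) (B.proj q) :=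
  mfderiv 𝓘(ℝ, F) 𝓘(ℝ, E) B.proj q

/-- `Y` is the horizontal lift `X^H` to `q` of the tangent vector `X` at `π(q)`. -/
def IsHorizontalLift (q : Q) (X : TangentSpace 𝓘(ℝ, E) (B.proj q)) (Y : TangentSpace 𝓘(ℝ, F) q) :
    Prop :=
  B.σ q Y = 0 ∧ B.dproj q Y = X

/-- The Dirac-Jacobi structure `L̄` on `Q`: the sum of
`{(X^H + ⟨X ⊕ ξ, β⟩ E, 0) ⊕ (π^*ξ, 0) : X ⊕ ξ ∈ L}` and of the lines generated by
`(-E, 0) ⊕ (0, 1)` and `(-A^H, 1) ⊕ (σ - π^*α, 0)`. -/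
def Lbar (q : Q) : Submodule ℝ (ExtTangent F q) :=
  Submodule.span ℝ
      {e | ∃ (x : L.fiber (B.proj q)) (XH : TangentSpace 𝓘(ℝ, F) q),
        B.IsHorizontalLift q (x : GenTangent E (B.proj q)).1 XH ∧
        e = ((XH + B.β (B.proj q) x • generator q, 0),
          ((x : GenTangent E (B.proj q)).2.comp (B.dproj q), 0))} ⊔
    Submodule.span ℝ {((-generator q, 0), (0, 1))} ⊔
    Submodule.span ℝ
      {e | ∃ AH : TangentSpace 𝓘(ℝ, F) q, B.IsHorizontalLift q (B.A (B.proj q)) AH ∧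
        e = ((-AH, 1), (B.σ q - (B.α (B.proj q)).comp (B.dproj q), 0))}

/-- `X` is a hamiltonian vector field over `V` of the function `f`: it is smooth and there is a
smooth function `φ` such that `(X, φ) ⊕ (df, f)` is a section of `L̄`. -/
def IsHamiltonianOn (V : Set Q) (f : Q → ℝ) (X : (q : Q) → TangentSpace 𝓘(ℝ, F) q) : Prop :=
  SmoothVectorOn X V ∧ ∃ φ : Q → ℝ, ContMDiffOn 𝓘(ℝ, F) 𝓘(ℝ, ℝ) ∞ φ V ∧
    ∀ q ∈ V, ((X q, φ q), (differential f q, f q)) ∈ B.Lbar q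

/-- The real function `f` is admissible over the open set `V ⊆ Q`. -/
def IsAdmissibleOn (V : Set Q) (f : Q → ℝ) : Prop :=
  ContMDiffOn 𝓘(ℝ, F) 𝓘(ℝ, ℝ) ∞ f V ∧ ∃ X, B.IsHamiltonianOn V f X

/-- The complex function `φ` is basic over the open set `V ⊆ Q`: it is smooth and
`Y·φ + φ c = 0` for all `(Y, c)` in `L̄ ∩ (TQ × ℝ)`. -/
def IsBasicOn (V : Set Q) (φ : Q → ℂ) : Prop :=
  ContMDiffOn 𝓘(ℝ, F) 𝓘(ℝ, ℂ) ∞ φ V ∧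
    ∀ q ∈ V, ∀ (Y : TangentSpace 𝓘(ℝ, F) q) (c : ℝ), ((Y, c), (0, 0)) ∈ B.Lbar q →
      derivAlong φ q Y + φ q * c = 0

/-- The function `φ` lies, over `V`, in the eigenspace of `E` for the eigenvalue `2πin`. -/
def IsEigenOn (n : ℤ) (V : Set Q) (φ : Q → ℂ) : Prop :=
  ∀ q ∈ V, derivAlong (E := F) φ q (generator q) = 2 * Real.pi * Complex.I * n * φ q

/-- Sections over `U ⊆ P` of the sheaf `H^n_adm`: the complex functions on `π⁻¹(U)` which are
admissible (smooth, with admissible real and imaginary parts) and eigenvectors of `E` for the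
eigenvalue `2πin`. A function on `π⁻¹(U)` is represented by any of its extensions to `Q`. -/
def Hadm (n : ℤ) (U : Opens P) : Set (Q → ℂ) :=
  {φ | ContMDiffOn 𝓘(ℝ, F) 𝓘(ℝ, ℂ) ∞ φ (B.proj ⁻¹' U) ∧
    B.IsAdmissibleOn (B.proj ⁻¹' U) (fun q => (φ q).re) ∧
    B.IsAdmissibleOn (B.proj ⁻¹' U) (fun q => (φ q).im) ∧
    IsEigenOn (F := F) n (B.proj ⁻¹' U) φ}

/-- Sections over `U ⊆ P` of the sheaf `H^n_bas`: the complex functions on `π⁻¹(U)` which are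
basic and eigenvectors of `E` for the eigenvalue `2πin`. A function on `π⁻¹(U)` is represented by
any of its extensions to `Q`. -/
def Hbas (n : ℤ) (U : Opens P) : Set (Q → ℂ) :=
  {φ | B.IsBasicOn (B.proj ⁻¹' U) φ ∧ IsEigenOn (F := F) n (B.proj ⁻¹' U) φ}

/-- The hamiltonian vector fields `X_{π^*g}` on `Q`, for `g` an admissible function on `P`. -/
abbrev HamiltonianField : Type _ :=
  {X : (q : Q) → TangentSpace 𝓘(ℝ, F) q //
    ∃ g : P → ℝ, L.IsAdmissible g ∧ B.IsHamiltonianOn univ (fun q => g (B.proj q)) X}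

/-- Two hamiltonian vector fields are equivalent if they differ by a section of `L̄ ∩ TQ`. -/
def hamiltonianSetoid : Setoid B.HamiltonianField where
  r X X' := ∀ q, ((X.1 q - X'.1 q, 0), (0, 0)) ∈ B.Lbar q
  iseqv :=
    { refl := fun X q => by
        rw [sub_self]
        exact (B.Lbar q).zero_mem
      symm := fun {X X'} h q => by
        have := (B.Lbar q).neg_mem (h q)
        simpa using this
      trans := fun {X X' X''} h h' q => by
        have := (B.Lbar q).add_mem (h q) (h' q)
        simpa using this }

/-- Equivalence classes of hamiltonian vector fields `X_{π^*g}` modulo sections of `L̄ ∩ TQ`. -/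
def HamiltonianClass : Type _ := Quotient B.hamiltonianSetoid

/-- The projection is constant along the orbits, so that the generator is vertical. -/
theorem dproj_generator (q : Q) : B.dproj q (generator q) = 0 := by
  by_cases hγ : MDifferentiableAt 𝓘(ℝ, ℝ) 𝓘(ℝ, F)
      (fun t : ℝ => Circle.exp (2 * Real.pi * t) • q) 0
  · have h0 : Circle.exp (2 * Real.pi * 0) • q = q := by simp
    have hπ : MDifferentiableAt 𝓘(ℝ, F) 𝓘(ℝ, E) B.proj
        ((fun t : ℝ => Circle.exp (2 * Real.pi * t) • q) 0) :=
      (B.principal.smooth_proj.mdifferentiable (by simp)) _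
    have hc := mfderiv_comp (0 : ℝ) hπ hγ
    have hconst : B.proj ∘ (fun t : ℝ => Circle.exp (2 * Real.pi * t) • q)
        = fun _ => B.proj q := funext fun t => B.principal.proj_smul _ _
    rw [hconst, mfderiv_const] at hc
    have h1 := congrArg (fun T : ℝ →L[ℝ] E => T 1) hc
    have h2 : (mfderiv 𝓘(ℝ, F) 𝓘(ℝ, E) B.proj (Circle.exp (2 * Real.pi * 0) • q) : F →L[ℝ] E)
        = (mfderiv 𝓘(ℝ, F) 𝓘(ℝ, E) B.proj q : F →L[ℝ] E) := by rw [h0]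
    have h3 := congrArg (fun T : F →L[ℝ] E => T (generator (F := F) q)) h2
    exact h3.symm.trans h1.symm
  · have : generator (F := F) q = 0 := by
      unfold generator
      rw [mfderiv_zero_of_not_mdifferentiableAt hγ]
      rfl
    rw [this, map_zero]

/-- The components of an element of `L̄`. -/
theorem exists_of_mem_lbar {q : Q} {e : ExtTangent F q} (he : e ∈ B.Lbar q) :
    ∃ (x : L.fiber (B.proj q)) (b : ℝ),
      B.dproj q e.1.1 = (x : GenTangent E (B.proj q)).1 - e.1.2 • B.A (B.proj q) ∧
      B.σ q e.1.1 = B.β (B.proj q) x - b ∧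
      (∀ v, e.2.1 v = (x : GenTangent E (B.proj q)).2 (B.dproj q v)
        + e.1.2 * (B.σ q v - B.α (B.proj q) (B.dproj q v))) ∧
      e.2.2 = b := by
  let W : Submodule ℝ (ExtTangent F q) :=
    { carrier := {e | ∃ (x : L.fiber (B.proj q)) (b : ℝ),
        B.dproj q e.1.1 = (x : GenTangent E (B.proj q)).1 - e.1.2 • B.A (B.proj q) ∧
        B.σ q e.1.1 = B.β (B.proj q) x - b ∧
        (∀ v, e.2.1 v = (x : GenTangent E (B.proj q)).2 (B.dproj q v)
          + e.1.2 * (B.σ q v - B.α (B.proj q) (B.dproj q v))) ∧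
        e.2.2 = b}
      zero_mem' := ⟨0, 0, by simp⟩
      add_mem' := by
        rintro e e' ⟨x, b, h1, h2, h3, h4⟩ ⟨x', b', h1', h2', h3', h4'⟩
        refine ⟨x + x', b + b', ?_, ?_, fun v => ?_, ?_⟩
        · simp [h1, h1', add_smul]; abel
        · simp [h2, h2']; ring
        · simp [h3 v, h3' v]; ring
        · simp [h4, h4']
      smul_mem' := by
        rintro c e ⟨x, b, h1, h2, h3, h4⟩
        refine ⟨c • x, c * b, ?_, ?_, fun v => ?_, ?_⟩
        · simp [h1, smul_sub, mul_smul]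
        · simp [h2]; ring
        · simp [h3 v]; ring
        · simp [h4] }
  have hle : B.Lbar q ≤ W := by
    refine sup_le (sup_le ?_ ?_) ?_ <;> refine Submodule.span_le.2 ?_
    · rintro _ ⟨x, XH, ⟨h1, h2⟩, rfl⟩
      refine ⟨x, 0, ?_, ?_, fun v => ?_, rfl⟩
      · simp [h2, B.dproj_generator]
      · simp [h1, B.connection.apply_generator]
      · simp
    · rintro _ rfl
      refine ⟨0, 1, ?_, ?_, fun v => ?_, rfl⟩
      · simp [B.dproj_generator]
      · simp [B.connection.apply_generator]
      · simp
    · rintro _ ⟨AH, ⟨h1, h2⟩, rfl⟩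
      refine ⟨0, 0, ?_, ?_, fun v => ?_, rfl⟩
      · simp [h2]
      · simp [h1]
      · simp
  exact hle he

/-- The cotangent component of an element of `L̄` annihilates `L̄ ∩ (TQ × ℝ)`, whose elements have
vanishing second component. -/
theorem lbar_pairing {q : Q} {Y : TangentSpace 𝓘(ℝ, F) q} {c : ℝ}
    (hY : ((Y, c), (0, 0)) ∈ B.Lbar q) :
    c = 0 ∧ ∀ e ∈ B.Lbar q, e.2.1 Y = 0 := by
  obtain ⟨x, b, h1, h2, h3, h4⟩ := B.exists_of_mem_lbar hY
  have hc : c = 0 := by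
    have := h3 (generator q)
    simpa [B.dproj_generator, B.connection.apply_generator] using this.symm
  subst hc
  refine ⟨rfl, fun e he => ?_⟩
  obtain ⟨x', b', h1', h2', h3', h4'⟩ := B.exists_of_mem_lbar he
  have hb : b = 0 := by simpa using h4.symm
  subst hb
  have hiso := (L.maximal_isotropic (B.proj q)).1 x x.2 x' x'.2
  have hA := B.β_eq (B.proj q) x
  have h3Y := h3 e.1.1
  simp only [zero_smul, sub_zero, zero_mul, add_zero] at h1 h2 h3Y
  simp only [pairPlus] at hiso hA
  have e1 : (x' : GenTangent E (B.proj q)).1 = B.dproj q e.1.1 + e.1.2 • B.A (B.proj q) := by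
    rw [h1']; abel
  rw [e1, map_add, map_smul, smul_eq_mul, ← h3Y] at hiso
  rw [h3', h1, h2, hA]
  simp only [zero_apply] at hiso ⊢
  linarith

/-- Admissible functions are annihilated by `L̄ ∩ TQ`. -/
theorem derivAlong_eq_zero_of_mem_Hadm {n : ℤ} {U : Opens P} {φ : Q → ℂ} (hφ : φ ∈ B.Hadm n U)
    {q : Q} (hq : q ∈ B.proj ⁻¹' U) {Y : TangentSpace 𝓘(ℝ, F) q}
    (hY : ((Y, 0), (0, 0)) ∈ B.Lbar q) : derivAlong φ q Y = 0 := by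
  obtain ⟨hs, ⟨_, X, _, c, _, hX⟩, ⟨_, X', _, c', _, hX'⟩, _⟩ := hφ
  have hU : IsOpen (B.proj ⁻¹' U) := U.isOpen.preimage B.principal.smooth_proj.continuous
  have hd : MDifferentiableAt 𝓘(ℝ, F) 𝓘(ℝ, ℂ) φ q :=
    (hs.contMDiffAt (hU.mem_nhds hq)).mdifferentiableAt (by simp)
  have hcomp : ∀ T : ℂ →L[ℝ] ℝ, (mfderiv 𝓘(ℝ, F) 𝓘(ℝ, ℝ) (fun q => T (φ q)) q :
      TangentSpace 𝓘(ℝ, F) q →L[ℝ] ℝ) Y = T (derivAlong φ q Y) := by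
    intro T
    have hT : MDifferentiableAt 𝓘(ℝ, ℂ) 𝓘(ℝ, ℝ) T (φ q) := T.mdifferentiableAt
    have := mfderiv_comp q hT hd
    rw [T.mfderiv_eq] at this
    exact congrArg (fun S : F →L[ℝ] ℝ => S Y) this
  have hre := (B.lbar_pairing hY).2 _ (hX q hq)
  have him := (B.lbar_pairing hY).2 _ (hX' q hq)
  apply Complex.ext
  · exact (hcomp Complex.reCLM).symm.trans hre
  · exact (hcomp Complex.imCLM).symm.trans him

/-- Basic functions are annihilated by `L̄ ∩ TQ`. -/
theorem derivAlong_eq_zero_of_mem_Hbas {n : ℤ} {U : Opens P} {φ : Q → ℂ} (hφ : φ ∈ B.Hbas n U)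
    {q : Q} (hq : q ∈ B.proj ⁻¹' U) {Y : TangentSpace 𝓘(ℝ, F) q}
    (hY : ((Y, 0), (0, 0)) ∈ B.Lbar q) : derivAlong φ q Y = 0 := by
  simpa using hφ.1.2 q hq Y 0 hY

/-- The operator on `H^n_adm` corresponding to a class of hamiltonian vector fields: over every
open subset `U` of `P` it sends `φ` to the function `-X·φ` on `π⁻¹(U)`, where `X` is any
representative of the class. If `X` is a hamiltonian vector field of `π^*g`, this is the
bracket `{π^*g, φ}`. -/
def admOperator (n : ℤ) (c : B.HamiltonianClass) (U : Opens P) (φ : B.Hadm n U) :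
    B.proj ⁻¹' U → ℂ :=
  Quotient.lift (s := B.hamiltonianSetoid)
    (fun (X : B.HamiltonianField) (q : B.proj ⁻¹' U) => -derivAlong φ.1 q.1 (X.1 q.1))
    (fun X X' h => funext fun q => by
      have := B.derivAlong_eq_zero_of_mem_Hadm φ.2 q.2 (h q.1)
      exact congrArg Neg.neg (sub_eq_zero.1 ((derivAlong_sub _ _ _ _).symm.trans this))) c

/-- The operator on `H^n_bas` corresponding to a class of hamiltonian vector fields, given by the
same formula as on `H^n_adm`. -/
def basOperator (n : ℤ) (c : B.HamiltonianClass) (U : Opens P) (φ : B.Hbas n U) :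
    B.proj ⁻¹' U → ℂ :=
  Quotient.lift (s := B.hamiltonianSetoid)
    (fun (X : B.HamiltonianField) (q : B.proj ⁻¹' U) => -derivAlong φ.1 q.1 (X.1 q.1))
    (fun X X' h => funext fun q => by
      have := B.derivAlong_eq_zero_of_mem_Hbas φ.2 q.2 (h q.1)
      exact congrArg Neg.neg (sub_eq_zero.1 ((derivAlong_sub _ _ _ _).symm.trans this))) c

end Prequantization

end DiracPrequant

end

/-! Let `X`, `X'` be hamiltonian fields of `π^*g`, `π^*g'` with the same operator, and let `W = X -
X'`. Then `W` kills every section of the sheaf, and the aim is that `W` lies in `L̄ ∩ TQ`. Only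
sections that are both basic and admissible are tested, so one argument settles both sheaves.

Regular points. The points near which the covector parts of `L` have constant rank, so that `L ∩ TP`
is a subbundle, are dense in `P` (`exists_constant_rank`). Near such a point `L ∩ TP` has a frame
whose vectors, seen through a fixed projection, are constant (`exists_kernel_frame`). Closure under
the Courant bracket then makes the frame commute (`LocalFrame.bracket_eq_zero`). Choose a local
section of `Q` with potential `τ` (the pullback of `σ`) and angular coordinate `ζ`. A function `ζ^n
f` is killed by `L̄ ∩ TQ` as soon as `df(Bv) = 2πin γ(v) f` for all frame vectors `Bv`, where `γ(v)
= τ(Bv) - β(Bv ⊕ 0)`. The prequantization condition says exactly that `γ` is closed along the leaves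
(`LocalFrame.weight_closed`). Hence there are a leafwise primitive `S` of `γ` and first integrals
`h` cutting out the leaves (`exists_first_integrals`), and both `exp(2πinS)` and its products with
functions of `h` solve the equation. Since `n ≠ 0`, their derivatives detect both the direction
transverse to the leaves and the vertical component (`exists_separating_solutions`). Constant rank
also lets hamiltonian fields be chosen smoothly, so these functions are admissible
(`LocalFrame.isAdmissibleOn`). Thus `W` lies in `L̄ ∩ TQ` over regular points.

All points. Put `D = dg - dg'`. Everywhere `π_*W ⊕ D` belongs to `L`; at regular points so does
`π_*W ⊕ 0`, whence `0 ⊕ D ∈ L` and `D(A) = g - g'`. By maximal isotropy the first relation means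
that `D` annihilates the vector parts of a frame of `L`, so both relations are closed conditions on
`P` and extend by density. Subtracting `0 ⊕ D` from `π_*W ⊕ D` then puts `W` in `L̄ ∩ TQ` at every
point (`Prequantization.sub_mem_lbar_of_forall_derivAlong`). -/

noncomputable section

namespace DiracPrequant

open Filter Topology

/-! ### Superposition operators on spaces of continuous functions -/

section Superposition

variable {K : Type*} [TopologicalSpace K] [CompactSpace K]

set_option synthInstance.maxHeartbeats 200000 in
/-- The pointwise application `C(K, G →L H) → C(K, G) → C(K, H)`, as a bounded bilinear map. -/
def pointwiseApply (K : Type*) [TopologicalSpace K] [CompactSpace K]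
    (G H : Type*) [NormedAddCommGroup G] [NormedSpace ℝ G]
    [NormedAddCommGroup H] [NormedSpace ℝ H] : C(K, G →L[ℝ] H) →L[ℝ] C(K, G) →L[ℝ] C(K, H) :=
  LinearMap.mkContinuous₂
    (LinearMap.mk₂ ℝ (fun (T : C(K, G →L[ℝ] H)) (u : C(K, G)) =>
        (⟨fun t => T t (u t), by fun_prop⟩ : C(K, H)))
      (fun _ _ _ => by ext; simp) (fun _ _ _ => by ext; simp)
      (fun _ _ _ => by ext; simp) (fun _ _ _ => by ext; simp)) 1
    (fun T u => by
      rw [one_mul]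
      refine (ContinuousMap.norm_le _ (by positivity)).2 fun t => ?_
      exact (T t).le_of_opNorm_le_of_le (T.norm_coe_le_norm t) (u.norm_coe_le_norm t))

@[simp] theorem pointwiseApply_apply {G H : Type*} [NormedAddCommGroup G] [NormedSpace ℝ G]
    [NormedAddCommGroup H] [NormedSpace ℝ H] (T : C(K, G →L[ℝ] H)) (u : C(K, G)) (t : K) :
    pointwiseApply K G H T u t = T t (u t) := rfl

/-- A function with a continuous slope is differentiable. -/
theorem hasFDerivAt_of_slope {X Y : Type*} [NormedAddCommGroup X] [NormedSpace ℝ X]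
    [NormedAddCommGroup Y] [NormedSpace ℝ Y] {N : X → Y} {x : X} {S : X → X →L[ℝ] Y}
    (hS : ContinuousAt S 0) (hN : ∀ h, N (x + h) - N x = S h h) : HasFDerivAt N (S 0) x := by
  rw [hasFDerivAt_iff_isLittleO_nhds_zero, Asymptotics.isLittleO_iff]
  intro c hc
  filter_upwards [Metric.continuousAt_iff'.1 hS c hc] with h hh
  rw [hN, ← sub_apply]
  exact (S h - S 0).le_of_opNorm_le (by rw [← dist_eq_norm]; exact hh.le) h

variable {G H : Type*} [NormedAddCommGroup G] [NormedSpace ℝ G]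
    [NormedAddCommGroup H] [NormedSpace ℝ H]

/-- The averaged derivative of a function along a segment. -/
def averagedDeriv (f : G → H) (p : G × G) : G →L[ℝ] H :=
  ∫ s in (0 : ℝ)..1, fderiv ℝ f (p.1 + s • p.2)

theorem continuous_averagedDeriv {f : G → H} (hf : ContDiff ℝ 1 f) :
    Continuous (averagedDeriv f) := by
  have h1 : Continuous (fderiv ℝ f) := hf.continuous_fderiv (by simp)
  unfold averagedDeriv
  apply intervalIntegral.continuous_parametric_intervalIntegral_of_continuous'
  exact h1.comp (by fun_prop)

theorem averagedDeriv_zero [CompleteSpace H] (f : G → H) (y : G) :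
    averagedDeriv f (y, 0) = fderiv ℝ f y := by
  simp [averagedDeriv]

theorem averagedDeriv_apply [CompleteSpace H] {f : G → H} (hf : ContDiff ℝ 1 f) (y h : G) :
    averagedDeriv f (y, h) h = f (y + h) - f y := by
  have h1 : Continuous (fderiv ℝ f) := hf.continuous_fderiv (by simp)
  have h2 : Continuous fun s : ℝ => fderiv ℝ f (y + s • h) := h1.comp (by fun_prop)
  have h3 : ∀ s : ℝ, HasDerivAt (fun s : ℝ => f (y + s • h)) (fderiv ℝ f (y + s • h) h) s := by
    intro s
    have h4 : HasDerivAt (fun s : ℝ => y + s • h) h s := by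
      simpa using ((hasDerivAt_id s).smul_const h).const_add y
    exact ((hf.differentiable (by simp)).differentiableAt.hasFDerivAt).comp_hasDerivAt s h4
  have h5 := intervalIntegral.integral_eq_sub_of_hasDerivAt (a := 0) (b := 1)
    (fun s _ => h3 s) ((h2.clm_apply continuous_const).intervalIntegrable _ _)
  rw [averagedDeriv, ContinuousLinearMap.intervalIntegral_apply (h2.intervalIntegrable _ _), h5]
  simp

/-- The superposition operator `u ↦ f ∘ u` of a differentiable function. -/
theorem hasFDerivAt_comp_continuousMap [CompleteSpace H] {f : G → H} (hf : ContDiff ℝ 1 f)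
    (u : C(K, G)) :
    HasFDerivAt (fun u : C(K, G) => (⟨f, hf.continuous⟩ : C(G, H)).comp u)
      (pointwiseApply K G H
        ((⟨fderiv ℝ f, hf.continuous_fderiv (by simp)⟩ : C(G, G →L[ℝ] H)).comp u)) u := by
  -- The averaged derivative is a slope: `f (y + h) - f y = M (y, h) h`. Postcomposition with a
  -- continuous map is continuous for the uniform topology, so the slope of the superposition
  -- operator is continuous in `h`, which is all that `hasFDerivAt_of_slope` needs.
  let M : C(G × G, G →L[ℝ] H) := ⟨averagedDeriv f, continuous_averagedDeriv hf⟩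
  have hM : Continuous fun h : C(K, G) => M.comp (u.prodMk h) := by
    refine (ContinuousMap.continuous_postcomp M).comp ?_
    have h1 : Continuous fun h : C(K, G) =>
        (ContinuousLinearMap.inl ℝ G G).compLeftContinuous ℝ K u
          + (ContinuousLinearMap.inr ℝ G G).compLeftContinuous ℝ K h := by fun_prop
    refine h1.congr fun h => ?_
    ext t <;> simp
  have key := hasFDerivAt_of_slope (N := fun u : C(K, G) => (⟨f, hf.continuous⟩ : C(G, H)).comp u)
    (x := u) (S := fun h => pointwiseApply K G H (M.comp (u.prodMk h)))
    (((pointwiseApply K G H).continuous.comp hM).continuousAt) (fun h => by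
      ext t
      exact (averagedDeriv_apply hf (u t) (h t)).symm)
  have h0 : (⟨fderiv ℝ f, hf.continuous_fderiv (by simp)⟩ : C(G, G →L[ℝ] H)).comp u
      = M.comp (u.prodMk 0) := ContinuousMap.ext fun t => (averagedDeriv_zero f (u t)).symm
  rw [h0]
  exact key

end Superposition

section SuperpositionSmooth

universe w

-- The derivative of `u ↦ f ∘ u` is the superposition operator of `fderiv ℝ f` followed by a bounded
-- linear map, so each order of smoothness follows from the previous one. The target changes to `G
-- →L[ℝ] H` in the induction; keeping `G` and `H` in one universe keeps the new target there.
set_option synthInstance.maxHeartbeats 200000 in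
theorem contDiff_comp_continuousMap_nat {K : Type*} [TopologicalSpace K] [CompactSpace K]
    {G : Type w} [NormedAddCommGroup G] [NormedSpace ℝ G] (n : ℕ) :
    ∀ {H : Type w} [NormedAddCommGroup H] [NormedSpace ℝ H] [CompleteSpace H] {f : G → H}
      (hc : Continuous f), ContDiff ℝ n f →
      ContDiff ℝ n (fun u : C(K, G) => (⟨f, hc⟩ : C(G, H)).comp u) := by
  induction n with
  | zero =>
    intro H _ _ _ f hc hf
    exact contDiff_zero.2 (ContinuousMap.continuous_postcomp _)
  | succ n ih =>
    intro H _ _ _ f hc hf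
    have hf1 : ContDiff ℝ 1 f := hf.of_le (by exact_mod_cast Nat.le_add_left 1 n)
    have hf' : ContDiff ℝ n (fderiv ℝ f) := hf.fderiv_right (by simp)
    have : ((n + 1 : ℕ) : WithTop ℕ∞) = (n : WithTop ℕ∞) + 1 := by simp
    rw [this, contDiff_succ_iff_hasFDerivAt]
    exact ⟨_, (pointwiseApply K G H).contDiff.comp (ih (hf1.continuous_fderiv (by simp)) hf'),
      hasFDerivAt_comp_continuousMap hf1⟩

/-- The superposition operator of a smooth function is smooth. -/
theorem contDiff_comp_continuousMap {K : Type*} [TopologicalSpace K] [CompactSpace K]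
    {G H : Type w} [NormedAddCommGroup G] [NormedSpace ℝ G] [NormedAddCommGroup H]
    [NormedSpace ℝ H] [CompleteSpace H] {f : G → H} (hf : ContDiff ℝ ∞ f) :
    ContDiff ℝ ∞ (fun u : C(K, G) => (⟨f, hf.continuous⟩ : C(G, H)).comp u) :=
  contDiff_infty.2 fun n => contDiff_comp_continuousMap_nat n hf.continuous (contDiff_infty.1 hf n)

end SuperpositionSmooth

/-! ### The smooth inverse function theorem -/

/-- Invertibility of the derivative is an open condition. Restricting the source to the points where
it holds makes the inverse smooth on its whole target, not just at the image of `a`. -/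
theorem exists_smooth_localInverse {E F : Type*} [NormedAddCommGroup E] [NormedSpace ℝ E]
    [CompleteSpace E] [NormedAddCommGroup F] [NormedSpace ℝ F] {f : E → F} {U : Set E}
    (hU : IsOpen U) {a : E} (ha : a ∈ U) (hf : ContDiffOn ℝ ∞ f U) {f' : E ≃L[ℝ] F}
    (hf' : HasFDerivAt f (f' : E →L[ℝ] F) a) :
    ∃ e : OpenPartialHomeomorph E F, a ∈ e.source ∧ e.source ⊆ U ∧ (∀ x, e x = f x) ∧
      ContDiffOn ℝ ∞ e.symm e.target := by
  have hfa : ContDiffAt ℝ ∞ f a := hf.contDiffAt (hU.mem_nhds ha)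
  let e₀ := hfa.toOpenPartialHomeomorph f hf' (by simp)
  have hc : ContinuousOn (fderiv ℝ f) U := hf.continuousOn_fderiv_of_isOpen hU (by simp)
  have hV : IsOpen (U ∩ fderiv ℝ f ⁻¹' range ((↑) : (E ≃L[ℝ] F) → E →L[ℝ] F)) :=
    hc.isOpen_inter_preimage hU (ContinuousLinearEquiv.isOpen)
  refine ⟨e₀.restrOpen _ hV, ⟨hfa.mem_toOpenPartialHomeomorph_source hf' (by simp), ha, f', ?_⟩,
    fun x hx => hx.2.1, fun x => rfl, ?_⟩
  · exact hf'.fderiv.symm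
  · intro y hy
    have hx := (e₀.restrOpen _ hV).map_target hy
    obtain ⟨_, hxU, T, hT⟩ := hx
    refine ((e₀.restrOpen _ hV).contDiffAt_symm (f₀' := T) hy ?_ ?_).contDiffWithinAt
    · rw [hT]
      exact ((hf.contDiffAt (hU.mem_nhds hxU)).differentiableAt (by simp)).hasFDerivAt
    · exact hf.contDiffAt (hU.mem_nhds hxU)

/-! ### Flows of commuting vector fields -/

section Flow

universe w

open unitInterval

/-- The integration operator `u ↦ (t ↦ ∫₀ᵗ u)` on `C([0,1], H)`. -/
def integrate (H : Type*) [NormedAddCommGroup H] [NormedSpace ℝ H] : C(I, H) →L[ℝ] C(I, H) :=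
  LinearMap.mkContinuous
    { toFun := fun u => ⟨fun t => ∫ s in (0 : ℝ)..t, IccExtend zero_le_one u s, by
        have : Continuous (IccExtend zero_le_one u : ℝ → H) := u.continuous.Icc_extend'
        exact (intervalIntegral.continuous_primitive (fun a b => this.intervalIntegrable a b)
          0).comp continuous_subtype_val⟩
      map_add' := fun u v => by
        ext t
        have hu : Continuous (IccExtend zero_le_one u : ℝ → H) := u.continuous.Icc_extend'
        have hv : Continuous (IccExtend zero_le_one v : ℝ → H) := v.continuous.Icc_extend'
        exact intervalIntegral.integral_add (hu.intervalIntegrable _ _) (hv.intervalIntegrable _ _)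
      map_smul' := fun c u => by
        ext t
        exact intervalIntegral.integral_smul c _ } 1
    (fun u => by
      rw [one_mul]
      refine (ContinuousMap.norm_le _ (by positivity)).2 fun t => ?_
      have := intervalIntegral.norm_integral_le_of_norm_le_const (a := 0) (b := (t : ℝ))
        (f := IccExtend zero_le_one u) (C := ‖u‖) (fun s _ => u.norm_coe_le_norm _)
      refine this.trans ?_
      rw [sub_zero, abs_of_nonneg t.2.1]
      exact mul_le_of_le_one_right (norm_nonneg _) t.2.2)

variable {H : Type*} [NormedAddCommGroup H] [NormedSpace ℝ H]

theorem integrate_apply (u : C(I, H)) (t : I) :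
    integrate H u t = ∫ s in (0 : ℝ)..t, IccExtend zero_le_one u s := rfl

/-- The primitive of the extension by constants of a continuous function on `[0,1]`. -/
theorem hasDerivAt_primitive [CompleteSpace H] (u : C(I, H)) (t : ℝ) :
    HasDerivAt (fun t => ∫ s in (0 : ℝ)..t, IccExtend zero_le_one u s)
      (IccExtend zero_le_one u t) t := by
  have hu : Continuous (IccExtend zero_le_one u : ℝ → H) := u.continuous.Icc_extend'
  exact intervalIntegral.integral_hasDerivAt_right (hu.intervalIntegrable _ _)
    (hu.stronglyMeasurableAtFilter _ _) hu.continuousAt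

/-- A homogeneous linear Volterra equation has only the zero solution. -/
theorem eq_zero_of_eq_integrate [CompleteSpace H] (T : C(I, H →L[ℝ] H)) (r : C(I, H))
    (hr : r = integrate H (pointwiseApply I H H T r)) : r = 0 := by
  set k := pointwiseApply I H H T r with hk
  let R : ℝ → H := fun t => ∫ s in (0 : ℝ)..t, IccExtend zero_le_one k s
  have hR : ∀ t : I, R t = r t := fun t => by
    conv_rhs => rw [hr]
    rfl
  -- Grönwall: `R` extends `r` to the line, vanishes at `0`, and its derivative is bounded by `‖T‖`
  -- times its norm.
  have h0 := eq_zero_of_abs_deriv_le_mul_abs_self_of_eq_zero_right (f := R)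
    (f' := fun t => IccExtend zero_le_one k t) (K := ‖T‖) (a := 0) (b := 1)
    (fun t _ => (hasDerivAt_primitive k t).continuousAt.continuousWithinAt)
    (fun t _ => (hasDerivAt_primitive k t).hasDerivWithinAt) (by simp [R])
    (fun t ht => by
      have ht' : t ∈ I := ⟨ht.1, ht.2.le⟩
      rw [IccExtend_of_mem _ _ ht', show R t = r ⟨t, ht'⟩ from hR ⟨t, ht'⟩]
      exact (T ⟨t, ht'⟩).le_of_opNorm_le (T.norm_coe_le_norm _) _)
  ext t
  rw [← hR t, h0 t t.2]
  rfl

/-- Integration by parts against the identity function. -/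
theorem smul_eq_integral_add [CompleteSpace H] {R R' : ℝ → H} (hR : ∀ s, HasDerivAt R (R' s) s)
    (hR' : Continuous R') (t : ℝ) : t • R t = ∫ s in (0 : ℝ)..t, (R s + s • R' s) := by
  have hd : ∀ s : ℝ, HasDerivAt (fun s => s • R s) (R s + s • R' s) s := fun s => by
    have := (hasDerivAt_id s).smul (hR s)
    simp only [id, one_smul, add_comm (s • R' s)] at this
    exact this
  have hc : Continuous fun s : ℝ => R s + s • R' s := by
    have h2 : Continuous R := continuous_iff_continuousAt.2 fun s => (hR s).continuousAt
    fun_prop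
  have h1 := intervalIntegral.integral_eq_sub_of_hasDerivAt (a := 0) (b := t)
    (fun s _ => hd s) (hc.intervalIntegrable _ _)
  rw [h1, zero_smul, sub_zero]

variable {V : Type} [NormedAddCommGroup V] [NormedSpace ℝ V]
  {H : Type w} [NormedAddCommGroup H] [NormedSpace ℝ H]

/-- The pairing of a constant curve in `V` with a curve in `H`, depending on a further parameter. -/
def constPair (V H : Type*) [NormedAddCommGroup V] [NormedSpace ℝ V] [NormedAddCommGroup H]
    [NormedSpace ℝ H] : (V × H) × C(I, H) →L[ℝ] C(I, V × H) :=
  ((ContinuousLinearMap.inl ℝ V H).compLeftContinuous ℝ I).comp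
      ((ContinuousLinearMap.const ℝ I).comp
        ((ContinuousLinearMap.fst ℝ V H).comp (ContinuousLinearMap.fst ℝ (V × H) C(I, H))))
    + ((ContinuousLinearMap.inr ℝ V H).compLeftContinuous ℝ I).comp
      (ContinuousLinearMap.snd ℝ (V × H) C(I, H))

theorem constPair_apply (p : (V × H) × C(I, H)) (t : I) : constPair V H p t = (p.1.1, p.2 t) := by
  simp [constPair]

theorem contDiff_uncurry_apply {B : H → V →L[ℝ] H} (hB : ContDiff ℝ ∞ B) :
    ContDiff ℝ ∞ (fun q : V × H => B q.2 q.1) :=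
  (hB.comp contDiff_snd).clm_apply contDiff_fst

theorem fderiv_uncurry_apply {B : H → V →L[ℝ] H} (hB : ContDiff ℝ ∞ B) (v v' : V) (y y' : H) :
    fderiv ℝ (fun q : V × H => B q.2 q.1) (v, y) (v', y') = B y v' + fderiv ℝ B y y' v := by
  have h1 : HasFDerivAt (fun q : V × H => B q.2) ((fderiv ℝ B y).comp (.snd ℝ V H)) (v, y) :=
    ((hB.differentiable (by simp) y).hasFDerivAt).comp (v, y) hasFDerivAt_snd
  rw [(h1.clm_apply hasFDerivAt_fst).fderiv]
  simp

/-- The constant curve at the initial value, as a linear function of the parameters. -/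
def constStart (V H : Type*) [NormedAddCommGroup V] [NormedSpace ℝ V] [NormedAddCommGroup H]
    [NormedSpace ℝ H] : (V × H) × C(I, H) →L[ℝ] C(I, H) :=
  (ContinuousLinearMap.const ℝ I).comp
    ((ContinuousLinearMap.snd ℝ V H).comp (ContinuousLinearMap.fst ℝ (V × H) C(I, H)))

theorem constStart_apply (p : (V × H) × C(I, H)) : constStart V H p = ContinuousMap.const I p.1.2 :=
  rfl

/-- The velocity `t ↦ B(u(t))v` of a curve `u`, as a function of `((v, y), u)`. -/
def velocity {B : H → V →L[ℝ] H} (hB : ContDiff ℝ ∞ B) (p : (V × H) × C(I, H)) : C(I, H) :=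
  (⟨fun q : V × H => B q.2 q.1, (contDiff_uncurry_apply hB).continuous⟩ :
      C(V × H, H)).comp (constPair V H p)

theorem velocity_apply {B : H → V →L[ℝ] H} (hB : ContDiff ℝ ∞ B) (p : (V × H) × C(I, H)) (t : I) :
    velocity hB p t = B (p.2 t) p.1.1 := by
  simp [velocity, constPair_apply]

/-- The derivative of the superposition operator `velocity`. -/
def velocityDeriv {B : H → V →L[ℝ] H} (hB : ContDiff ℝ ∞ B) (p : (V × H) × C(I, H)) :
    (V × H) × C(I, H) →L[ℝ] C(I, H) :=
  (pointwiseApply I (V × H) H ((⟨fderiv ℝ (fun q : V × H => B q.2 q.1),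
    (contDiff_uncurry_apply hB).continuous_fderiv (by simp)⟩ :
      C(V × H, V × H →L[ℝ] H)).comp (constPair V H p))).comp (constPair V H)

theorem velocityDeriv_apply {B : H → V →L[ℝ] H} (hB : ContDiff ℝ ∞ B) (p p' : (V × H) × C(I, H))
    (t : I) : velocityDeriv hB p p' t
      = B (p.2 t) p'.1.1 + fderiv ℝ B (p.2 t) (p'.2 t) p.1.1 := by
  rw [← fderiv_uncurry_apply hB]
  simp only [velocityDeriv, ContinuousLinearMap.comp_apply, pointwiseApply_apply,
    ContinuousMap.comp_apply, constPair_apply]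
  rfl

variable [CompleteSpace H]

theorem contDiff_velocity {B : H → V →L[ℝ] H} (hB : ContDiff ℝ ∞ B) :
    ContDiff ℝ ∞ (velocity hB) :=
  (contDiff_comp_continuousMap (contDiff_uncurry_apply hB)).comp (constPair V H).contDiff

theorem hasFDerivAt_velocity {B : H → V →L[ℝ] H} (hB : ContDiff ℝ ∞ B)
    (p : (V × H) × C(I, H)) : HasFDerivAt (velocity hB) (velocityDeriv hB p) p :=
  (hasFDerivAt_comp_continuousMap ((contDiff_uncurry_apply hB).of_le (by simp)) _).comp p
    (constPair V H).hasFDerivAt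

/-- The map whose zeros `((v, y), u)` are the integral curves `u` of `B(·)v` starting at `y`. -/
def integralCurveDefect {B : H → V →L[ℝ] H} (hB : ContDiff ℝ ∞ B) (p : (V × H) × C(I, H)) :
    C(I, H) :=
  p.2 - constStart V H p - integrate H (velocity hB p)

theorem contDiff_integralCurveDefect {B : H → V →L[ℝ] H} (hB : ContDiff ℝ ∞ B) :
    ContDiff ℝ ∞ (integralCurveDefect hB) :=
  (contDiff_snd.sub (constStart V H).contDiff).sub
    ((integrate H).contDiff.comp (contDiff_velocity hB))

theorem hasFDerivAt_integralCurveDefect {B : H → V →L[ℝ] H} (hB : ContDiff ℝ ∞ B)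
    (p : (V × H) × C(I, H)) :
    HasFDerivAt (integralCurveDefect hB)
      (ContinuousLinearMap.snd ℝ (V × H) C(I, H) - constStart V H
        - (integrate H).comp (velocityDeriv hB p)) p :=
  (hasFDerivAt_snd.sub (constStart V H).hasFDerivAt).sub
    ((integrate H).hasFDerivAt.comp p (hasFDerivAt_velocity hB p))

/-- Vector fields `B(·)v`, depending linearly on `v` and commuting on an open set, have locally a
smooth joint flow `G`. -/
theorem exists_commuting_flow {B : H → V →L[ℝ] H} (hB : ContDiff ℝ ∞ B) [CompleteSpace V]
    {O : Set H} (hO : IsOpen O) {y₀ : H} (hy₀ : y₀ ∈ O)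
    (hint : ∀ y ∈ O, ∀ v w, fderiv ℝ B y (B y v) w = fderiv ℝ B y (B y w) v) :
    ∃ (G : V × H → H) (U : Set (V × H)), IsOpen U ∧ ((0 : V), y₀) ∈ U ∧ ContDiffOn ℝ ∞ G U ∧
      (∀ z ∈ U, G z ∈ O) ∧ (∀ z ∈ U, ∀ w, fderiv ℝ G z (w, 0) = B (G z) w) ∧
      ∀ y, ((0 : V), y) ∈ U → G (0, y) = y := by
  let D := integralCurveDefect hB
  let z₀ : V × H := (0, y₀)
  let u₀ : C(I, H) := ContinuousMap.const I y₀
  -- Smooth dependence on parameters comes from the inverse function theorem in a Banach space of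
  -- curves. At `v = 0` the velocity does not depend on the curve to first order, so the derivative
  -- of `Ξ` at the constant curve is unipotent triangular, hence invertible.
  let Ξ : (V × H) × C(I, H) → (V × H) × C(I, H) := fun p => (p.1, D p)
  have hΞ : ContDiff ℝ ∞ Ξ := contDiff_fst.prodMk (contDiff_integralCurveDefect hB)
  let ℓ : V × H →L[ℝ] C(I, H) :=
    (ContinuousLinearMap.const ℝ I).comp (ContinuousLinearMap.snd ℝ V H)
    + (integrate H).comp ((ContinuousLinearMap.const ℝ I).comp
      ((B y₀).comp (ContinuousLinearMap.fst ℝ V H)))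
  let Ξ' : ((V × H) × C(I, H)) ≃L[ℝ] ((V × H) × C(I, H)) :=
    ContinuousLinearEquiv.skewProd (.refl ℝ _) (.refl ℝ _) (-ℓ)
  have hΞ' : HasFDerivAt Ξ (Ξ' : ((V × H) × C(I, H)) →L[ℝ] ((V × H) × C(I, H))) (z₀, u₀) := by
    have := hasFDerivAt_fst.prodMk (hasFDerivAt_integralCurveDefect hB (z₀, u₀))
    refine this.congr_fderiv (ContinuousLinearMap.ext fun p => Prod.ext (by simp [Ξ']) ?_)
    have h1 : velocityDeriv hB (z₀, u₀) p = ContinuousMap.const I (B y₀ p.1.1) := by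
      ext t
      rw [velocityDeriv_apply]
      simp [z₀, u₀]
    change p.2 - constStart V H p - integrate H (velocityDeriv hB (z₀, u₀) p)
      = p.2 + -(ContinuousMap.const I p.1.2 + integrate H (ContinuousMap.const I (B y₀ p.1.1)))
    rw [h1, constStart_apply]
    abel
  obtain ⟨e, he0, -, he, hes⟩ := exists_smooth_localInverse isOpen_univ (mem_univ (z₀, u₀))
    hΞ.contDiffOn hΞ'
  have hDt : ∀ p, D p = 0 → p.2 = ContinuousMap.const I p.1.2 + integrate H (velocity hB p) := by
    intro p hp
    simpa [D, integralCurveDefect, constStart_apply, sub_sub, sub_eq_zero] using hp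
  have hvel0 : ∀ y u, velocity hB ((0, y), u) = 0 := by
    intro y u
    ext t
    simp [velocity_apply]
  have hD0 : ∀ y, D ((0, y), ContinuousMap.const I y) = 0 := by
    intro y
    simp only [D, integralCurveDefect, hvel0, constStart_apply, map_zero, sub_self]
  let u : V × H → C(I, H) := fun z => (e.symm (z, 0)).2
  let U₁ : Set (V × H) := (fun z => (z, (0 : C(I, H)))) ⁻¹' e.target
  have hU₁ : IsOpen U₁ := e.open_target.preimage (by fun_prop)
  have hu : ContDiffOn ℝ ∞ u U₁ :=
    contDiff_snd.comp_contDiffOn (hes.comp (by fun_prop) fun z hz => hz)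
  have hDu : ∀ z ∈ U₁, D (z, u z) = 0 := by
    intro z hz
    have h1 : Ξ (e.symm (z, 0)) = (z, 0) := by rw [← he]; exact e.right_inv hz
    have h2 : (e.symm (z, 0)).1 = z := congrArg Prod.fst h1
    have h3 : e.symm (z, 0) = (z, u z) := Prod.ext h2 rfl
    rw [h3] at h1
    exact congrArg Prod.snd h1
  -- The commutation identity is available only on `O` and is needed along the whole curve. Staying
  -- in `O` is an open condition on the curve because `[0,1]` is compact.
  let U : Set (V × H) := U₁ ∩ u ⁻¹' {f : C(I, H) | MapsTo f univ O}
  have hU : IsOpen U := hu.continuousOn.isOpen_inter_preimage hU₁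
    (ContinuousMap.isOpen_setOfPred_mapsTo isCompact_univ hO)
  have hez₀ : e (z₀, u₀) = (z₀, 0) := by
    rw [he]
    exact Prod.ext rfl (hD0 y₀)
  have hz₀ : z₀ ∈ U := by
    have h1 : (z₀, (0 : C(I, H))) ∈ e.target := hez₀ ▸ e.map_source he0
    refine ⟨h1, fun t _ => ?_⟩
    have : u z₀ = u₀ := by
      change (e.symm (z₀, 0)).2 = u₀
      rw [← hez₀, e.left_inv he0]
    rw [this]
    exact hy₀
  refine ⟨fun z => u z 1, U, hU, hz₀, ?_, fun z hz => hz.2 (mem_univ _), ?_, ?_⟩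
  · exact (ContinuousMap.evalCLM ℝ (1 : I)).contDiff.comp_contDiffOn (hu.mono inter_subset_left)
  · rintro ⟨v, y⟩ hz w
    have hud : HasFDerivAt u (fderiv ℝ u (v, y)) (v, y) :=
      ((hu.contDiffAt (hU₁.mem_nhds hz.1)).differentiableAt (by simp)).hasFDerivAt
    set c := u (v, y) with hc
    set c' := fderiv ℝ u (v, y) (w, 0) with hc'
    have hcurve : c = ContinuousMap.const I y + integrate H (velocity hB ((v, y), c)) :=
      hDt _ (hDu _ hz.1)
    have hc'eq : c' = integrate H (velocityDeriv hB ((v, y), c) ((w, 0), c')) := by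
      have h1 := HasFDerivAt.comp (g := D) (f := fun z => (z, u z)) (v, y)
        (hasFDerivAt_integralCurveDefect hB ((v, y), c)) ((hasFDerivAt_id (v, y)).prodMk hud)
      have h2 : HasFDerivAt (fun z => D (z, u z)) (0 : V × H →L[ℝ] C(I, H)) (v, y) :=
        (hasFDerivAt_const (0 : C(I, H)) (v, y)).congr_of_eventuallyEq
          (Filter.eventually_of_mem (hU₁.mem_nhds hz.1) hDu)
      have h3 := congrArg (fun T : V × H →L[ℝ] C(I, H) => T (w, 0)) (h1.unique h2)
      have h4 : c' - constStart V H ((w, 0), c')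
        - integrate H (velocityDeriv hB ((v, y), c) ((w, 0), c')) = 0 := h3
      have h5 : constStart V H ((w, (0 : H)), c') = 0 := by
        rw [constStart_apply]; rfl
      rwa [h5, sub_zero, sub_eq_zero] at h4
    -- the curve extended to the real line
    let k := velocity hB ((v, y), c)
    let ĉ : ℝ → H := fun t => y + ∫ s in (0 : ℝ)..t, IccExtend zero_le_one k s
    have hĉ : ∀ t : I, ĉ t = c t := fun t => by
      conv_rhs => rw [hcurve]
      rfl
    have hĉd : ∀ t, HasDerivAt ĉ (IccExtend zero_le_one k t) t := fun t =>
      (hasDerivAt_primitive k t).const_add y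
    have hĉc : Continuous ĉ := continuous_iff_continuousAt.2 fun t => (hĉd t).continuousAt
    have hk : Continuous (IccExtend zero_le_one k : ℝ → H) := k.continuous.Icc_extend'
    have hB' : Continuous (fderiv ℝ B) := hB.continuous_fderiv (by simp)
    -- The variation `c'` of the curve in the direction `w` should be `t ↦ t • B (c t) w`.
    -- Integration by parts writes this candidate as an integral, and commutation (exchange of `v`
    -- and `w`) identifies it as a solution of the linearized equation satisfied by `c'`. The
    -- difference `r` thus solves a homogeneous Volterra equation and vanishes; its value at `t = 1`
    -- gives the derivative of the flow.
    have hparts := fun t : I => smul_eq_integral_add (R := fun t => B (ĉ t) w)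
      (R' := fun t => fderiv ℝ B (ĉ t) (IccExtend zero_le_one k t) w)
      (fun t => (((hB.differentiable (by simp) (ĉ t)).hasFDerivAt).comp_hasDerivAt t
        (hĉd t)).clm_apply (hasDerivAt_const t w) |>.congr_deriv (by simp)) (by fun_prop) (t : ℝ)
    let T : C(I, H →L[ℝ] H) :=
      ⟨fun t => (ContinuousLinearMap.apply ℝ H v).comp (fderiv ℝ B (c t)), by fun_prop⟩
    let r : C(I, H) := ⟨fun t => c' t - (t : ℝ) • B (c t) w, by
      have := hB.continuous
      fun_prop⟩
    have hr : r = integrate H (pointwiseApply I H H T r) := by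
      ext t
      have h1 : c' t = _ := congrArg (fun f : C(I, H) => f t) hc'eq
      have h2 := hparts t
      simp only [hĉ] at h2
      change c' t - (t : ℝ) • B (c t) w = _
      rw [h1, h2, integrate_apply, integrate_apply, ← intervalIntegral.integral_sub]
      · refine intervalIntegral.integral_congr fun s hs => ?_
        rw [uIcc_of_le t.2.1] at hs
        have hs' : s ∈ I := ⟨hs.1, hs.2.trans t.2.2⟩
        have h3 := hint (c ⟨s, hs'⟩) (hz.2 (mem_univ _)) v w
        simp only [IccExtend_of_mem _ _ hs', velocityDeriv_apply, pointwiseApply_apply]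
        rw [show ĉ s = c ⟨s, hs'⟩ from hĉ ⟨s, hs'⟩]
        simp only [k, velocity_apply, T, r, ContinuousMap.coe_mk, ContinuousLinearMap.comp_apply,
          ContinuousLinearMap.apply_apply, map_sub, map_smul, h3]
        abel
      · exact (ContinuousMap.continuous _).Icc_extend'.intervalIntegrable _ _
      · have := hB.continuous
        exact (by fun_prop : Continuous fun t => B (ĉ t) w
          + t • fderiv ℝ B (ĉ t) (IccExtend zero_le_one k t) w).intervalIntegrable _ _
    have hr1 := congrArg (fun f : C(I, H) => f 1) (eq_zero_of_eq_integrate T r hr)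
    have hr2 : c' 1 - (1 : ℝ) • B (c 1) w = 0 := hr1
    rw [one_smul, sub_eq_zero] at hr2
    rw [← hr2]
    have := ((ContinuousMap.evalCLM ℝ (1 : I)).hasFDerivAt (x := u (v, y))).comp (v, y) hud
    exact congrArg (fun T : V × H →L[ℝ] H => T (w, 0)) this.fderiv
  · intro y hy
    have := hDt _ (hDu _ hy.1)
    simp only [hvel0, map_zero, add_zero] at this
    simp only [this]
    rfl

end Flow

/-! ### First integrals of commuting vector fields -/

section FirstIntegrals

universe w

/-- A function which is smooth near a point agrees near this point with a smooth function. -/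
theorem exists_contDiff_eqOn {E : Type*} [NormedAddCommGroup E] [NormedSpace ℝ E]
    [FiniteDimensional ℝ E] {Y : Type*} [NormedAddCommGroup Y] [NormedSpace ℝ Y] {f : E → Y}
    {O : Set E} (hO : IsOpen O) {x₀ : E} (hx₀ : x₀ ∈ O) (hf : ContDiffOn ℝ ∞ f O) :
    ∃ (g : E → Y) (U : Set E), ContDiff ℝ ∞ g ∧ IsOpen U ∧ x₀ ∈ U ∧ U ⊆ O ∧ EqOn g f U := by
  obtain ⟨ε, hε, hεO⟩ := Metric.isOpen_iff.1 hO x₀ hx₀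
  let φ : ContDiffBump x₀ := ⟨ε / 4, ε / 2, by linarith, by linarith⟩
  refine ⟨fun x => φ x • f x, Metric.ball x₀ (ε / 4), ?_, Metric.isOpen_ball,
    Metric.mem_ball_self (by linarith), (Metric.ball_subset_ball (by linarith)).trans hεO, ?_⟩
  · rw [contDiff_iff_contDiffAt]
    intro x
    by_cases hx : x ∈ O
    · exact φ.contDiff.contDiffAt.smul (hf.contDiffAt (hO.mem_nhds hx))
    · have hx' : x ∉ tsupport φ := fun h => hx (hεO (by
        rw [φ.tsupport_eq] at h
        exact Metric.closedBall_subset_ball (by simp [φ]; linarith) h))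
      have : (fun x => φ x • f x) =ᶠ[𝓝 x] fun _ => 0 := by
        filter_upwards [notMem_tsupport_iff_eventuallyEq.1 hx'] with y hy
        simp [hy]
      exact contDiffAt_const.congr_of_eventuallyEq this
  · intro x hx
    simp [φ.one_of_mem_closedBall (Metric.ball_subset_closedBall hx)]

theorem fderiv_clm_apply_const {X V Y : Type*} [NormedAddCommGroup X] [NormedSpace ℝ X]
    [NormedAddCommGroup V] [NormedSpace ℝ V] [NormedAddCommGroup Y] [NormedSpace ℝ Y]
    {T : X → V →L[ℝ] Y} {x : X} (hT : DifferentiableAt ℝ T x) (z : X) (w : V) :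
    fderiv ℝ (fun x => T x w) x z = fderiv ℝ T x z w := by
  rw [(hT.hasFDerivAt.clm_apply (hasFDerivAt_const w x)).fderiv]
  simp

variable {V : Type} [NormedAddCommGroup V] [NormedSpace ℝ V] [FiniteDimensional ℝ V]
  {E : Type w} [NormedAddCommGroup E] [NormedSpace ℝ E] [FiniteDimensional ℝ E]

/-- Frobenius' theorem for vector fields `B(·)v` which depend linearly on `v`, are linearly
independent, and commute: there are first integrals `h` whose level sets are tangent to the fields,
and the closed system `dS(B v) = γ(v)` has a solution `S`. -/
theorem exists_first_integrals {O : Set E} (hO : IsOpen O) {x₀ : E} (hx₀ : x₀ ∈ O)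
    {B : E → V →L[ℝ] E} (hB : ContDiffOn ℝ ∞ B O) {γ : E → V →L[ℝ] ℝ} (hγ : ContDiffOn ℝ ∞ γ O)
    (p : E →L[ℝ] V) (hp : ∀ v, p (B x₀ v) = v)
    (hintB : ∀ x ∈ O, ∀ v w, fderiv ℝ B x (B x v) w = fderiv ℝ B x (B x w) v)
    (hintγ : ∀ x ∈ O, ∀ v w, fderiv ℝ γ x (B x v) w = fderiv ℝ γ x (B x w) v) :
    ∃ (U : Set E) (h : E → LinearMap.ker (p : E →ₗ[ℝ] V)) (S : E → ℝ), IsOpen U ∧ x₀ ∈ U ∧ U ⊆ O ∧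
      ContDiffOn ℝ ∞ h U ∧ ContDiffOn ℝ ∞ S U ∧
      (∀ x ∈ U, ∀ v, fderiv ℝ h x (B x v) = 0) ∧ (∀ x ∈ U, ∀ v, fderiv ℝ S x (B x v) = γ x v) ∧
      ∀ x ∈ U, ∀ z, fderiv ℝ h x z = 0 → ∃ v, z = B x v := by
  let C := LinearMap.ker (p : E →ₗ[ℝ] V)
  obtain ⟨Bg, O₁, hBg, hO₁, hx₁, hO₁O, hBgB⟩ := exists_contDiff_eqOn hO hx₀ hB
  obtain ⟨γg, O₂, hγg, hO₂, hx₂, hO₂O, hγgγ⟩ := exists_contDiff_eqOn hO hx₀ hγ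
  let O' := O₁ ∩ O₂
  have hO' : IsOpen O' := hO₁.inter hO₂
  -- The extra real coordinate integrates `γ` along the flow. The lifted fields commute precisely
  -- because of `hintB` and `hintγ` together.
  let A : E × ℝ → V →L[ℝ] E × ℝ := fun q => (Bg q.1).prod (γg q.1)
  have hA : ContDiff ℝ ∞ A := contDiff_clm_apply_iff.2 fun v =>
    ((hBg.comp contDiff_fst).clm_apply contDiff_const).prodMk
      ((hγg.comp contDiff_fst).clm_apply contDiff_const)
  have hAd : ∀ q : E × ℝ, q.1 ∈ O' → ∀ z v, fderiv ℝ A q z v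
      = (fderiv ℝ B q.1 z.1 v, fderiv ℝ γ q.1 z.1 v) := by
    intro q hq z v
    rw [← fderiv_clm_apply_const (hA.differentiable (by simp) q)]
    have h1 : HasFDerivAt (fun q : E × ℝ => Bg q.1 v)
        (((fderiv ℝ Bg q.1).flip v).comp (.fst ℝ E ℝ)) q :=
      ((((hBg.differentiable (by simp) q.1).hasFDerivAt).clm_apply
        (hasFDerivAt_const v q.1)).congr_fderiv (by ext; simp)).comp q hasFDerivAt_fst
    have h2 : HasFDerivAt (fun q : E × ℝ => γg q.1 v)
        (((fderiv ℝ γg q.1).flip v).comp (.fst ℝ E ℝ)) q :=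
      ((((hγg.differentiable (by simp) q.1).hasFDerivAt).clm_apply
        (hasFDerivAt_const v q.1)).congr_fderiv (by ext; simp)).comp q hasFDerivAt_fst
    have h3 : HasFDerivAt (fun q => A q v) _ q := h1.prodMk h2
    rw [h3.fderiv, ← (hBgB.eventuallyEq_of_mem (hO₁.mem_nhds hq.1)).fderiv_eq,
      ← (hγgγ.eventuallyEq_of_mem (hO₂.mem_nhds hq.2)).fderiv_eq]
    simp
  have hintA : ∀ q ∈ O' ×ˢ (univ : Set ℝ), ∀ v w,
      fderiv ℝ A q (A q v) w = fderiv ℝ A q (A q w) v := by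
    rintro q ⟨hq, -⟩ v w
    rw [hAd q hq, hAd q hq]
    have h1 : ∀ v, (A q v).1 = B q.1 v := fun v => by
      change Bg q.1 v = _
      rw [hBgB hq.1]
    rw [h1, h1, hintB _ (hO₁O hq.1), hintγ _ (hO₁O hq.1)]
  obtain ⟨G, U₀, hU₀, hz₀, hG, hGO, hGd, hG0⟩ := exists_commuting_flow hA
    (hO'.prod isOpen_univ) (y₀ := (x₀, (0 : ℝ))) ⟨⟨hx₁, hx₂⟩, mem_univ _⟩ hintA
  -- the flow starting from the slice through `x₀`
  let ι : V × C → V × (E × ℝ) := fun q => (q.1, (x₀ + q.2, 0))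
  have hι : ContDiff ℝ ∞ ι :=
    contDiff_fst.prodMk (((contDiff_const.add
      (C.subtypeL.contDiff.comp contDiff_snd))).prodMk contDiff_const)
  have hιd : ∀ q, HasFDerivAt ι ((ContinuousLinearMap.fst ℝ V C).prod
      (((C.subtypeL).comp (.snd ℝ V C)).prod 0)) q := fun q =>
    hasFDerivAt_fst.prodMk (((C.subtypeL.hasFDerivAt.comp q hasFDerivAt_snd).const_add x₀).prodMk
      (hasFDerivAt_const _ _))
  let W := ι ⁻¹' U₀
  have hW : IsOpen W := hU₀.preimage hι.continuous
  have hW0 : (0 : V × C) ∈ W := by simpa [W, ι] using hz₀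
  have hΓ : ContDiffOn ℝ ∞ (fun q => G (ι q)) W := hG.comp hι.contDiffOn fun q hq => hq
  have hΓd : ∀ q ∈ W, ∀ w, fderiv ℝ (fun q => G (ι q)) q (w, 0)
      = (B (G (ι q)).1 w, γ (G (ι q)).1 w) := by
    intro q hq w
    have h1 : HasFDerivAt (fun q => G (ι q)) _ q :=
      ((hG.contDiffAt (hU₀.mem_nhds hq)).differentiableAt (by simp)).hasFDerivAt.comp q (hιd q)
    have h2 := hGd _ hq w
    have h3 := (hGO _ hq).1
    rw [h1.fderiv, ← hBgB h3.1, ← hγgγ h3.2]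
    exact h2
  have hΓdiff : ∀ q ∈ W, DifferentiableAt ℝ (fun q => G (ι q)) q := fun q hq =>
    (hΓ.contDiffAt (hW.mem_nhds hq)).differentiableAt (by simp)
  let Ψ : V × C → E := fun q => (G (ι q)).1
  have hΨ : ContDiffOn ℝ ∞ Ψ W := contDiff_fst.comp_contDiffOn hΓ
  have hΨd : ∀ q ∈ W, ∀ z, fderiv ℝ Ψ q z = (fderiv ℝ (fun q => G (ι q)) q z).1 := by
    intro q hq z
    have h1 : HasFDerivAt Ψ _ q := hasFDerivAt_fst.comp q (hΓdiff q hq).hasFDerivAt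
    rw [h1.fderiv]
    rfl
  have hΨ0 : Ψ 0 = x₀ := by
    have := hG0 (x₀, 0) hz₀
    simp [Ψ, ι, this]
  -- The expected derivative of `Ψ` at `0`. It is bijective because `p` splits `E` as the range of
  -- `B x₀` plus `ker p`.
  let Λ : V × C →L[ℝ] E := (B x₀).comp (.fst ℝ V C) + C.subtypeL.comp (.snd ℝ V C)
  have hΛ : Function.Bijective Λ := by
    constructor
    · refine (injective_iff_map_eq_zero Λ).2 ?_
      rintro ⟨v, c⟩ h
      have h1 : B x₀ v + (c : E) = 0 := h
      have h2 : p c = 0 := c.2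
      have h3 := congrArg p h1
      rw [map_add, hp, h2, add_zero, map_zero] at h3
      subst h3
      rw [map_zero, zero_add] at h1
      exact Prod.ext rfl (Subtype.ext h1)
    · intro z
      have h1 : z - B x₀ (p z) ∈ C := by simp [C, hp]
      exact ⟨(p z, ⟨_, h1⟩), by simp [Λ]⟩
  let Λe : (V × C) ≃L[ℝ] E :=
    (LinearEquiv.ofBijective (Λ : V × C →ₗ[ℝ] E) hΛ).toContinuousLinearEquiv
  have hΨ' : HasFDerivAt Ψ (Λe : V × C →L[ℝ] E) 0 := by
    have h1 : HasFDerivAt Ψ (fderiv ℝ Ψ 0) 0 :=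
      ((hΨ.contDiffAt (hW.mem_nhds hW0)).differentiableAt (by simp)).hasFDerivAt
    refine h1.congr_fderiv (ContinuousLinearMap.ext fun z => ?_)
    have h2 : fderiv ℝ Ψ 0 (0, z.2) = z.2 := by
      have h3 : HasFDerivAt (fun c : C => Ψ (0, c)) ((fderiv ℝ Ψ 0).comp (.inr ℝ V C)) 0 :=
        HasFDerivAt.comp (g := Ψ) (f := fun c : C => ((0 : V), c)) 0 h1
          (hasFDerivAt_prodMk_right (𝕜 := ℝ) (0 : V) (0 : C))
      have h4 : HasFDerivAt (fun c : C => Ψ (0, c)) C.subtypeL 0 := by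
        refine (C.subtypeL.hasFDerivAt.const_add x₀).congr_of_eventuallyEq ?_
        have : ∀ᶠ c : C in 𝓝 0, ((0 : V), c) ∈ W :=
          (hW.preimage (by fun_prop : Continuous fun c : C => ((0 : V), c))).mem_nhds hW0
        filter_upwards [this] with c hc
        have := hG0 (x₀ + c, 0) hc
        simp [Ψ, ι, this]
      exact congrArg (fun T : C →L[ℝ] E => T z.2) (h3.unique h4)
    have h5 : fderiv ℝ Ψ 0 (z.1, 0) = B x₀ z.1 := by
      rw [hΨd 0 hW0, hΓd 0 hW0]
      change B (Ψ 0) z.1 = _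
      rw [hΨ0]
    have h6 : z = (z.1, 0) + (0, z.2) := by simp
    rw [h6, map_add, h5, h2]
    simp [Λe, Λ]
  obtain ⟨e, he0, heW, he, hes⟩ := exists_smooth_localInverse hW hW0 hΨ hΨ'
  have heΨ : (e : V × C → E) = Ψ := funext he
  have hx₀e : x₀ ∈ e.target := by
    have := e.map_source he0
    rwa [he, hΨ0] at this
  have heO : ∀ x ∈ e.target, Ψ (e.symm x) = x := fun x hx => by rw [← he]; exact e.right_inv hx
  have hL : ∀ x ∈ e.target, HasFDerivAt e.symm (fderiv ℝ e.symm x) x := fun x hx =>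
    ((hes.contDiffAt (e.open_target.mem_nhds hx)).differentiableAt (by simp)).hasFDerivAt
  have hΨL : ∀ x ∈ e.target, HasFDerivAt Ψ (fderiv ℝ Ψ (e.symm x)) (e.symm x) := fun x hx =>
    ((hΨ.contDiffAt (hW.mem_nhds (heW (e.map_target hx)))).differentiableAt (by simp)).hasFDerivAt
  have hright : ∀ x ∈ e.target, ∀ z, fderiv ℝ Ψ (e.symm x) (fderiv ℝ e.symm x z) = z := by
    intro x hx z
    have h1 := (hΨL x hx).comp x (hL x hx)
    have h2 : HasFDerivAt (Ψ ∘ e.symm) (ContinuousLinearMap.id ℝ E) x :=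
      (hasFDerivAt_id x).congr_of_eventuallyEq
        (Filter.eventually_of_mem (e.open_target.mem_nhds hx) heO)
    exact congrArg (fun T : E →L[ℝ] E => T z) (h1.unique h2)
  have hleft : ∀ x ∈ e.target, ∀ z, fderiv ℝ e.symm x (fderiv ℝ Ψ (e.symm x) z) = z := by
    intro x hx z
    have h0 := hL x hx
    nth_rewrite 2 [← heO x hx] at h0
    have h1 := h0.comp (e.symm x) (hΨL x hx)
    have h2 : HasFDerivAt (e.symm ∘ Ψ) (ContinuousLinearMap.id ℝ (V × C)) (e.symm x) :=
      (hasFDerivAt_id _).congr_of_eventuallyEq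
        (Filter.eventually_of_mem (e.open_source.mem_nhds (e.map_target hx))
          fun y hy => by rw [← heΨ]; exact e.left_inv hy)
    exact congrArg (fun T : V × C →L[ℝ] V × C => T z) (h1.unique h2)
  have hΨB : ∀ x ∈ e.target, ∀ w, fderiv ℝ Ψ (e.symm x) (w, 0) = B x w := by
    intro x hx w
    have hq := heW (e.map_target hx)
    rw [hΨd _ hq, hΓd _ hq]
    change B (Ψ (e.symm x)) w = _
    rw [heO x hx]
  have hLB : ∀ x ∈ e.target, ∀ w, fderiv ℝ e.symm x (B x w) = (w, 0) := by
    intro x hx w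
    rw [← hΨB x hx, hleft x hx]
  have hhd : ∀ x ∈ e.target, ∀ z, fderiv ℝ (fun x => (e.symm x).2) x z
      = (fderiv ℝ e.symm x z).2 := by
    intro x hx z
    have h1 : HasFDerivAt (fun x => (e.symm x).2) _ x := hasFDerivAt_snd.comp x (hL x hx)
    rw [h1.fderiv]
    rfl
  -- In the coordinates `(v, c)` the field `B(·)w` is the constant field `(w, 0)`. Hence `c` is
  -- constant along the fields and its differential has no other kernel, while the accumulated
  -- height is the primitive of `γ`.
  refine ⟨e.target, fun x => (e.symm x).2, fun x => (G (ι (e.symm x))).2, e.open_target, hx₀e,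
    ?_, contDiff_snd.comp_contDiffOn hes, ?_, ?_, ?_, ?_⟩
  · intro x hx
    have h1 := (hGO _ (heW (e.map_target hx))).1.1
    have h2 : (G (ι (e.symm x))).1 = x := heO x hx
    rw [h2] at h1
    exact hO₁O h1
  · exact contDiff_snd.comp_contDiffOn (hΓ.comp hes fun x hx => heW (e.map_target hx))
  · intro x hx v
    rw [hhd x hx, hLB x hx]
  · intro x hx v
    have hq := heW (e.map_target hx)
    have h1 : HasFDerivAt (fun x => (G (ι (e.symm x))).2) _ x :=
      hasFDerivAt_snd.comp x ((hΓdiff _ hq).hasFDerivAt.comp x (hL x hx))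
    rw [h1.fderiv]
    change (fderiv ℝ (fun q => G (ι q)) (e.symm x) (fderiv ℝ e.symm x (B x v))).2 = _
    rw [hLB x hx, hΓd _ hq]
    change γ (Ψ (e.symm x)) v = _
    rw [heO x hx]
  · intro x hx z hz
    rw [hhd x hx] at hz
    refine ⟨(fderiv ℝ e.symm x z).1, ?_⟩
    rw [← hΨB x hx, ← hz]
    exact (hright x hx z).symm

/-- The solutions of `df(B v) = κ γ(v) f` separate the tangent vectors from the fields `B(·)v`. -/
theorem exists_separating_solutions {O : Set E} (hO : IsOpen O) {x₀ : E} (hx₀ : x₀ ∈ O)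
    {B : E → V →L[ℝ] E} (hB : ContDiffOn ℝ ∞ B O) {γ : E → V →L[ℝ] ℝ} (hγ : ContDiffOn ℝ ∞ γ O)
    (p : E →L[ℝ] V) (hp : ∀ v, p (B x₀ v) = v)
    (hintB : ∀ x ∈ O, ∀ v w, fderiv ℝ B x (B x v) w = fderiv ℝ B x (B x w) v)
    (hintγ : ∀ x ∈ O, ∀ v w, fderiv ℝ γ x (B x v) w = fderiv ℝ γ x (B x w) v)
    {k : ℂ} (hk : k ≠ 0) :
    ∃ U : Set E, IsOpen U ∧ x₀ ∈ U ∧ U ⊆ O ∧ ∀ (z : E) (c : ℝ),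
      (∀ f : E → ℂ, ContDiffOn ℝ ∞ f U →
        (∀ x ∈ U, ∀ v, fderiv ℝ f x (B x v) = k * γ x v * f x) →
        fderiv ℝ f x₀ z = k * c * f x₀) →
      ∃ v, z = B x₀ v ∧ c = γ x₀ v := by
  obtain ⟨U, h, S, hU, hxU, hUO, hh, hS, hhB, hSB, hker⟩ :=
    exists_first_integrals hO hx₀ hB hγ p hp hintB hintγ
  refine ⟨U, hU, hxU, hUO, fun z c H => ?_⟩
  have hhd : ∀ x ∈ U, HasFDerivAt h (fderiv ℝ h x) x := fun x hx =>
    ((hh.contDiffAt (hU.mem_nhds hx)).differentiableAt (by simp)).hasFDerivAt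
  have hSd : ∀ x ∈ U, HasFDerivAt S (fderiv ℝ S x) x := fun x hx =>
    ((hS.contDiffAt (hU.mem_nhds hx)).differentiableAt (by simp)).hasFDerivAt
  -- Nowhere zero, so the values of its derivative can be divided by it.
  let f₀ : E → ℂ := fun x => Complex.exp (k * (S x : ℂ))
  have hf₀ : ContDiffOn ℝ ∞ f₀ U := by
    refine ContDiff.comp_contDiffOn Complex.contDiff_exp (contDiffOn_const.mul ?_)
    exact Complex.ofRealCLM.contDiff.comp_contDiffOn hS
  have hf₀d : ∀ x ∈ U, HasFDerivAt f₀
      (f₀ x • k • (Complex.ofRealCLM.comp (fderiv ℝ S x))) x := fun x hx =>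
    HasFDerivAt.cexp ((Complex.ofRealCLM.hasFDerivAt.comp x (hSd x hx)).const_mul k)
  have hf₀z : ∀ x ∈ U, ∀ z, fderiv ℝ f₀ x z = k * fderiv ℝ S x z * f₀ x := fun x hx z => by
    rw [(hf₀d x hx).fderiv]
    simp
    ring
  have hne : ∀ x, f₀ x ≠ 0 := fun x => Complex.exp_ne_zero _
  have hc : fderiv ℝ S x₀ z = c := by
    have h1 := H f₀ hf₀ fun x hx v => by rw [hf₀z x hx, hSB x hx]
    rw [hf₀z x₀ hxU] at h1
    have h2 := mul_left_cancel₀ hk (mul_right_cancel₀ (hne x₀) h1)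
    exact_mod_cast h2
  -- Since `h` is constant along the fields, `(Λ ∘ h) f₀` is again a solution. By the product rule,
  -- its equation minus that of `f₀` leaves only `Λ (dh z) f₀ = 0`, and the functionals `Λ` separate
  -- points.
  have hz : fderiv ℝ h x₀ z = 0 := by
    refine SeparatingDual.eq_zero_of_forall_dual_eq_zero (R := ℝ) fun Λ => ?_
    have hΛd : ∀ x ∈ U, HasFDerivAt (fun x => ((Λ (h x) : ℝ) : ℂ))
        (Complex.ofRealCLM.comp (Λ.comp (fderiv ℝ h x))) x := fun x hx =>
      Complex.ofRealCLM.hasFDerivAt.comp x (Λ.hasFDerivAt.comp x (hhd x hx))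
    have hd : ∀ x ∈ U, ∀ z, fderiv ℝ (fun x => ((Λ (h x) : ℝ) : ℂ) * f₀ x) x z
        = Λ (fderiv ℝ h x z) * f₀ x + k * fderiv ℝ S x z * (Λ (h x) * f₀ x) := fun x hx z => by
      have hm : HasFDerivAt (fun x => ((Λ (h x) : ℝ) : ℂ) * f₀ x) _ x :=
        (hΛd x hx).mul (hf₀d x hx)
      rw [hm.fderiv]
      simp
      ring
    have h1 := H (fun x => ((Λ (h x) : ℝ) : ℂ) * f₀ x)
      ((Complex.ofRealCLM.contDiff.comp_contDiffOn (Λ.contDiff.comp_contDiffOn hh)).mul hf₀)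
      fun x hx v => by
        rw [hd x hx, hhB x hx, hSB x hx]
        simp
    rw [hd x₀ hxU, hc] at h1
    have h2 : ((Λ (fderiv ℝ h x₀ z) : ℝ) : ℂ) * f₀ x₀ = 0 := by linear_combination h1
    exact_mod_cast (mul_eq_zero.1 h2).resolve_right (hne x₀)
  obtain ⟨v, rfl⟩ := hker x₀ hxU z hz
  exact ⟨v, rfl, by rw [← hc, hSB x₀ hxU]⟩

end FirstIntegrals

/-! ### Families of linear maps of constant rank -/

section ConstantRank

open Module

variable {X V W : Type*} [NormedAddCommGroup X] [NormedSpace ℝ X]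
  [NormedAddCommGroup V] [NormedSpace ℝ V] [NormedAddCommGroup W] [NormedSpace ℝ W]

/-- The rank of a continuous linear map. -/
def clmRank (T : V →L[ℝ] W) : ℕ := finrank ℝ (LinearMap.range (T : V →ₗ[ℝ] W))

theorem exists_clm_leftInverse {V W : Type*} [NormedAddCommGroup V] [NormedSpace ℝ V]
    [NormedAddCommGroup W] [NormedSpace ℝ W] [FiniteDimensional ℝ W] (T : V →L[ℝ] W)
    (hT : Function.Injective T) : ∃ R : W →L[ℝ] V, ∀ v, R (T v) = v := by
  obtain ⟨R, hR⟩ := LinearMap.exists_leftInverse_of_injective (T : V →ₗ[ℝ] W)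
    (LinearMap.ker_eq_bot.2 hT)
  exact ⟨LinearMap.toContinuousLinearMap R, fun v => LinearMap.congr_fun hR v⟩

theorem injective_of_isUnit_compression {K : Submodule ℝ V} {R : W →L[ℝ] K} {T : V →L[ℝ] W}
    (h : IsUnit (R.comp (T.comp K.subtypeL))) : Function.Injective (T.comp K.subtypeL) := by
  obtain ⟨u, hu⟩ := h
  have h1 : ∀ k, (↑u⁻¹ : K →L[ℝ] K) (R (T.comp K.subtypeL k)) = k := fun k => by
    have := congrArg (fun f : K →L[ℝ] K => f k) u.inv_mul
    rw [hu] at this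
    exact this
  exact Function.LeftInverse.injective (g := fun w => (↑u⁻¹ : K →L[ℝ] K) (R w)) h1

theorem finrank_range_comp_subtypeL {K : Submodule ℝ V} {T : V →L[ℝ] W}
    (h : Function.Injective (T.comp K.subtypeL)) :
    finrank ℝ (LinearMap.range (T.comp K.subtypeL : K →ₗ[ℝ] W)) = finrank ℝ K :=
  LinearMap.finrank_range_of_inj h

theorem range_comp_subtypeL_le {K : Submodule ℝ V} (T : V →L[ℝ] W) :
    LinearMap.range (T.comp K.subtypeL : K →ₗ[ℝ] W) ≤ LinearMap.range (T : V →ₗ[ℝ] W) := by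
  rintro _ ⟨k, rfl⟩
  exact ⟨k, rfl⟩

variable [FiniteDimensional ℝ V] [FiniteDimensional ℝ W]

/-- Near `T₀`, a linear map has a compression `R ∘ T|_K` which is invertible, with
`dim K = rank T₀`. -/
theorem exists_compression (T₀ : V →L[ℝ] W) :
    ∃ (K : Submodule ℝ V) (R : W →L[ℝ] K), finrank ℝ K = clmRank T₀ ∧
      R.comp (T₀.comp K.subtypeL) = 1 := by
  obtain ⟨K, hK⟩ := Submodule.exists_isCompl (LinearMap.ker (T₀ : V →ₗ[ℝ] W))
  have hinj : Function.Injective (T₀.comp K.subtypeL) := by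
    refine (injective_iff_map_eq_zero _).2 fun k hk => ?_
    have h1 : (k : V) ∈ LinearMap.ker (T₀ : V →ₗ[ℝ] W) ⊓ K := ⟨hk, k.2⟩
    rw [hK.inf_eq_bot] at h1
    exact Subtype.ext ((Submodule.mem_bot ℝ).1 h1)
  obtain ⟨R, hR⟩ := exists_clm_leftInverse _ hinj
  refine ⟨K, R, ?_, ContinuousLinearMap.ext hR⟩
  have h1 := Submodule.finrank_add_eq_of_isCompl hK
  have h2 := LinearMap.finrank_range_add_finrank_ker (T₀ : V →ₗ[ℝ] W)
  unfold clmRank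
  omega

theorem isOpen_isUnit_clm {K : Type*} [NormedAddCommGroup K] [NormedSpace ℝ K]
    [CompleteSpace K] : IsOpen {M : K →L[ℝ] K | IsUnit M} :=
  Units.isOpen (R := K →L[ℝ] K)

/-- The points near which a continuous family of linear maps has constant rank are dense. -/
theorem exists_constant_rank {T : X → V →L[ℝ] W} {U : Set X} (hU : IsOpen U) (hne : U.Nonempty)
    (hT : ContinuousOn T U) :
    ∃ x₀ ∈ U, ∃ U' ⊆ U, IsOpen U' ∧ x₀ ∈ U' ∧ ∀ x ∈ U', clmRank (T x) = clmRank (T x₀) := by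
  -- A point of minimal corank, hence of maximal rank on `U`. The rank cannot drop nearby, because
  -- the compression below stays invertible, and by maximality it cannot rise.
  obtain ⟨x₀, hx₀, hmax⟩ := (measure fun x => finrank ℝ W - clmRank (T x)).wf.has_min U hne
  obtain ⟨K, R, hK, hR⟩ := exists_compression (T x₀)
  have hc : ContinuousOn (fun x => R.comp ((T x).comp K.subtypeL)) U :=
    continuousOn_const.clm_comp (hT.clm_comp continuousOn_const)
  refine ⟨x₀, hx₀, _, inter_subset_left, hc.isOpen_inter_preimage hU isOpen_isUnit_clm,
    ⟨hx₀, ?_⟩, fun x hx => ?_⟩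
  · change IsUnit (R.comp ((T x₀).comp K.subtypeL))
    rw [hR]
    exact isUnit_one
  · have h1 := finrank_range_comp_subtypeL (injective_of_isUnit_compression hx.2)
    have h2 := Submodule.finrank_mono (range_comp_subtypeL_le (K := K) (T x))
    have h3 : ¬ (finrank ℝ W - clmRank (T x) < finrank ℝ W - clmRank (T x₀)) := hmax x hx.1
    have h4 : clmRank (T x) ≤ finrank ℝ W := Submodule.finrank_le _
    have h5 : clmRank (T x₀) ≤ finrank ℝ W := Submodule.finrank_le _
    have h6 : clmRank (T x₀) ≤ clmRank (T x) := by
      rw [← hK, ← h1]; exact h2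
    omega

theorem contDiffOn_ringInverse {K : Type*} [NormedAddCommGroup K] [NormedSpace ℝ K]
    [CompleteSpace K] {M : X → K →L[ℝ] K} {U : Set X} (hM : ContDiffOn ℝ ∞ M U)
    (hu : ∀ x ∈ U, IsUnit (M x)) : ContDiffOn ℝ ∞ (fun x => Ring.inverse (M x)) U := by
  intro x hx
  obtain ⟨u, hu⟩ := hu x hx
  have h1 : ContDiffAt ℝ ∞ Ring.inverse (M x) := hu ▸ contDiffAt_ringInverse ℝ u
  exact h1.comp_contDiffWithinAt x (hM x hx)

/-- A smooth family of linear maps of constant rank has locally a smooth generalized inverse. -/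
theorem exists_generalized_inverse {T : X → V →L[ℝ] W} {U : Set X} (hU : IsOpen U) {x₀ : X}
    (hx₀ : x₀ ∈ U) (hT : ContDiffOn ℝ ∞ T U) (hrank : ∀ x ∈ U, clmRank (T x) = clmRank (T x₀)) :
    ∃ U' ⊆ U, IsOpen U' ∧ x₀ ∈ U' ∧ ∃ S : X → W →L[ℝ] V, ContDiffOn ℝ ∞ S U' ∧
      ∀ x ∈ U', ∀ v, T x (S x (T x v)) = T x v := by
  obtain ⟨K, R, hK, hR⟩ := exists_compression (T x₀)
  have hM : ContDiffOn ℝ ∞ (fun x => R.comp ((T x).comp K.subtypeL)) U :=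
    contDiffOn_const.clm_comp (hT.clm_comp contDiffOn_const)
  refine ⟨_, inter_subset_left, hM.continuousOn.isOpen_inter_preimage hU isOpen_isUnit_clm,
    ⟨hx₀, ?_⟩, fun x => K.subtypeL.comp
      ((Ring.inverse (R.comp ((T x).comp K.subtypeL))).comp R), ?_, fun x hx v => ?_⟩
  · change IsUnit (R.comp ((T x₀).comp K.subtypeL))
    rw [hR]
    exact isUnit_one
  · exact contDiffOn_const.clm_comp ((contDiffOn_ringInverse (hM.mono inter_subset_left)
      fun x hx => hx.2).clm_comp contDiffOn_const)
  · have hu : IsUnit (R.comp ((T x).comp K.subtypeL)) := hx.2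
    have h1 := finrank_range_comp_subtypeL (injective_of_isUnit_compression hu)
    -- Equality of dimensions, the only use of constant rank: every `T x v` equals `T x k` for some
    -- `k` in `K`, and the inverse of the compression recovers `k` from it.
    have h2 : LinearMap.range ((T x).comp K.subtypeL : K →ₗ[ℝ] W)
        = LinearMap.range (T x : V →ₗ[ℝ] W) :=
      Submodule.eq_of_le_of_finrank_eq (range_comp_subtypeL_le (T x)) (by
        rw [h1, hK, ← hrank x hx.1]; rfl)
    obtain ⟨k, hk⟩ : T x v ∈ LinearMap.range ((T x).comp K.subtypeL : K →ₗ[ℝ] W) := by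
      rw [h2]; exact ⟨v, rfl⟩
    have hk' : T x (k : V) = T x v := hk
    have h3 := congrArg (fun f : K →L[ℝ] K => f k) (Ring.inverse_mul_cancel _ hu)
    have h4 : Ring.inverse (R.comp ((T x).comp K.subtypeL)) (R (T x (k : V))) = k := h3
    simp only [ContinuousLinearMap.comp_apply]
    rw [← hk', h4]
    rfl

/-- A smooth frame of the image under `Y` of the kernel of a family `T` of constant rank, if `Y` is
injective on the kernel. The frame is normalized by a fixed projection `p`. -/
theorem exists_kernel_frame {Z : Type*} [NormedAddCommGroup Z] [NormedSpace ℝ Z]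
    [FiniteDimensional ℝ Z] {T : X → V →L[ℝ] W} {Y : X → V →L[ℝ] Z} {U : Set X} (hU : IsOpen U)
    {x₀ : X} (hx₀ : x₀ ∈ U) (hT : ContDiffOn ℝ ∞ T U) (hY : ContDiffOn ℝ ∞ Y U)
    {S : X → W →L[ℝ] V} (hS : ContDiffOn ℝ ∞ S U) (hTST : ∀ x ∈ U, ∀ v, T x (S x (T x v)) = T x v)
    (hrank : ∀ x ∈ U, clmRank (T x) = clmRank (T x₀))
    (hinj : ∀ v, T x₀ v = 0 → Y x₀ v = 0 → v = 0) :
    ∃ U' ⊆ U, IsOpen U' ∧ x₀ ∈ U' ∧ ∃ (a : X → LinearMap.ker (T x₀ : V →ₗ[ℝ] W) →L[ℝ] V)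
      (p : Z →L[ℝ] LinearMap.ker (T x₀ : V →ₗ[ℝ] W)), ContDiffOn ℝ ∞ a U' ∧
      (∀ x ∈ U', ∀ v, T x (a x v) = 0) ∧ (∀ x ∈ U', ∀ v, p (Y x (a x v)) = v) ∧
      ∀ x ∈ U', ∀ c, T x c = 0 → ∃ v, c = a x v := by
  let V₀ := LinearMap.ker (T x₀ : V →ₗ[ℝ] W)
  -- By `T S T = T` this is a smooth family of projections onto the kernels of `T x`.
  let Pk : X → V →L[ℝ] V := fun x => .id ℝ V - (S x).comp (T x)
  have hPk : ContDiffOn ℝ ∞ Pk U := contDiffOn_const.sub (hS.clm_comp hT)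
  have hPk0 : ∀ x v, T x v = 0 → Pk x v = v := fun x v hv => by simp [Pk, hv]
  have hTPk : ∀ x ∈ U, ∀ v, T x (Pk x v) = 0 := fun x hx v => by simp [Pk, hTST x hx]
  let b : X → V₀ →L[ℝ] Z := fun x => (Y x).comp ((Pk x).comp V₀.subtypeL)
  have hb : ContDiffOn ℝ ∞ b U := hY.clm_comp (hPk.clm_comp contDiffOn_const)
  have hb0 : ∀ v : V₀, b x₀ v = Y x₀ v := fun v => congrArg (Y x₀) (hPk0 x₀ v v.2)
  have hbinj : Function.Injective (b x₀) := by
    refine (injective_iff_map_eq_zero _).2 fun v hv => Subtype.ext (hinj v v.2 ?_)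
    rw [← hb0, hv]
  -- The projection `p` does not depend on `x`. Dividing by `p ∘ b` makes the images of the frame
  -- under `p` constant, which later forces the brackets of the frame fields to vanish.
  obtain ⟨p, hp⟩ := exists_clm_leftInverse _ hbinj
  have hN : ContDiffOn ℝ ∞ (fun x => p.comp (b x)) U := contDiffOn_const.clm_comp hb
  have hpa : ∀ x, IsUnit (p.comp (b x)) → ∀ v,
      p (Y x (Pk x ((Ring.inverse (p.comp (b x)) v : V₀) : V))) = v := fun x hx v =>
    congrArg (fun f : V₀ →L[ℝ] V₀ => f v) (Ring.mul_inverse_cancel _ hx)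
  refine ⟨_, inter_subset_left, hN.continuousOn.isOpen_inter_preimage hU isOpen_isUnit_clm,
    ⟨hx₀, ?_⟩, fun x => (Pk x).comp (V₀.subtypeL.comp (Ring.inverse (p.comp (b x)))), p,
    ?_, ?_, ?_, ?_⟩
  · change IsUnit (p.comp (b x₀))
    rw [show p.comp (b x₀) = 1 from ContinuousLinearMap.ext hp]
    exact isUnit_one
  · exact (hPk.mono inter_subset_left).clm_comp (contDiffOn_const.clm_comp
      (contDiffOn_ringInverse (hN.mono inter_subset_left) fun x hx => hx.2))
  · exact fun x hx v => hTPk x hx.1 _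
  · exact fun x hx v => hpa x hx.2 v
  · intro x hx c hc
    let A : V₀ →ₗ[ℝ] LinearMap.ker (T x : V →ₗ[ℝ] W) := LinearMap.codRestrict _
      ((Pk x).comp (V₀.subtypeL.comp (Ring.inverse (p.comp (b x)))) : V₀ →ₗ[ℝ] V)
      fun v => hTPk x hx.1 _
    have hA : Function.Injective A := by
      have hl : Function.LeftInverse (fun c : LinearMap.ker (T x : V →ₗ[ℝ] W) =>
          p (Y x (c : V))) A :=
        fun v => hpa x hx.2 v
      exact hl.injective
    have hdim : finrank ℝ V₀ = finrank ℝ (LinearMap.ker (T x : V →ₗ[ℝ] W)) := by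
      have h1 := LinearMap.finrank_range_add_finrank_ker (T x₀ : V →ₗ[ℝ] W)
      have h2 := LinearMap.finrank_range_add_finrank_ker (T x : V →ₗ[ℝ] W)
      have h3 := hrank x hx.1
      unfold clmRank at h3
      change finrank ℝ (LinearMap.ker (T x₀ : V →ₗ[ℝ] W)) = _
      omega
    obtain ⟨v, hv⟩ := (LinearMap.injective_iff_surjective_of_finrank_eq_finrank hdim).1 hA ⟨c, hc⟩
    exact ⟨v, (congrArg Subtype.val hv).symm⟩

end ConstantRank

/-! ### Calculus in a chart -/

section ChartCalculus

variable {E : Type*} [NormedAddCommGroup E] [NormedSpace ℝ E]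
  {M : Type*} [TopologicalSpace M] [ChartedSpace E M] [IsManifold 𝓘(ℝ, E) ∞ M]

instance isManifold_one : IsManifold 𝓘(ℝ, E) 1 M := IsManifold.of_le (n := ∞) (by simp)

variable (E) in
/-- The derivative of the preferred chart at `o`. -/
def chartDeriv (o p : M) : TangentSpace 𝓘(ℝ, E) p →L[ℝ] E :=
  mfderiv 𝓘(ℝ, E) 𝓘(ℝ, E) (extChartAt 𝓘(ℝ, E) o) p

/-- The derivative of the inverse of the preferred chart at `o`. -/
def chartSymmDeriv (o : M) (y : E) :
    E →L[ℝ] TangentSpace 𝓘(ℝ, E) ((extChartAt 𝓘(ℝ, E) o).symm y) :=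
  mfderiv 𝓘(ℝ, E) 𝓘(ℝ, E) (extChartAt 𝓘(ℝ, E) o).symm y

theorem isInvertible_chartDeriv {o p : M} (hp : p ∈ (extChartAt 𝓘(ℝ, E) o).source) :
    (chartDeriv E o p).IsInvertible :=
  isInvertible_mfderiv_extChartAt hp

theorem chartDeriv_inverse_apply {o p : M} (hp : p ∈ (extChartAt 𝓘(ℝ, E) o).source)
    (w : TangentSpace 𝓘(ℝ, E) p) : (chartDeriv E o p).inverse (chartDeriv E o p w) = w :=
  (isInvertible_chartDeriv hp).inverse_apply_eq.2 rfl

theorem chartDeriv_apply_inverse {o p : M} (hp : p ∈ (extChartAt 𝓘(ℝ, E) o).source)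
    (v : E) : chartDeriv E o p ((chartDeriv E o p).inverse v) = v :=
  ((isInvertible_chartDeriv hp).inverse_apply_eq.1 rfl).symm

theorem chartSymmDeriv_eq {o : M} {y : E} (hy : y ∈ (extChartAt 𝓘(ℝ, E) o).target) :
    chartSymmDeriv o y = (chartDeriv E o ((extChartAt 𝓘(ℝ, E) o).symm y)).inverse := by
  have h1 := mfderiv_extChartAt_comp_mfderivWithin_extChartAt_symm (I := 𝓘(ℝ, E)) hy
  have hs := (extChartAt 𝓘(ℝ, E) o).map_target hy
  ext v
  symm
  rw [(isInvertible_chartDeriv hs).inverse_apply_eq]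
  have h2 : mfderivWithin 𝓘(ℝ, E) 𝓘(ℝ, E) (extChartAt 𝓘(ℝ, E) o).symm (range 𝓘(ℝ, E)) y
      = chartSymmDeriv o y := by
    rw [ModelWithCorners.range_eq_univ, mfderivWithin_univ]; rfl
  rw [h2] at h1
  exact (congrArg (fun T : E →L[ℝ] E => T v) h1).symm

theorem chartDeriv_chartSymmDeriv {o : M} {y : E} (hy : y ∈ (extChartAt 𝓘(ℝ, E) o).target) (v : E) :
    chartDeriv E o _ (chartSymmDeriv o y v) = v := by
  rw [chartSymmDeriv_eq hy]
  exact chartDeriv_apply_inverse ((extChartAt 𝓘(ℝ, E) o).map_target hy) v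

theorem chartSymmDeriv_chartDeriv {o : M} {y : E} (hy : y ∈ (extChartAt 𝓘(ℝ, E) o).target)
    (w : TangentSpace 𝓘(ℝ, E) ((extChartAt 𝓘(ℝ, E) o).symm y)) :
    chartSymmDeriv o y (chartDeriv E o _ w) = w := by
  rw [chartSymmDeriv_eq hy]
  exact chartDeriv_inverse_apply ((extChartAt 𝓘(ℝ, E) o).map_target hy) w

/-- The coordinate expression of a vector field in the preferred chart at `o`. -/
def coordVec (o : M) (X : (x : M) → TangentSpace 𝓘(ℝ, E) x) (y : E) : E :=
  chartDeriv E o ((extChartAt 𝓘(ℝ, E) o).symm y) (X ((extChartAt 𝓘(ℝ, E) o).symm y))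

theorem contMDiffOn_chartSymm (o : M) :
    ContMDiffOn 𝓘(ℝ, E) 𝓘(ℝ, E) ∞ (extChartAt 𝓘(ℝ, E) o).symm (extChartAt 𝓘(ℝ, E) o).target :=
  contMDiffOn_extChartAt_symm o

theorem isOpen_chart_target_inter (o : M) {U : Set M} (hU : IsOpen U) :
    IsOpen ((extChartAt 𝓘(ℝ, E) o).target ∩ (extChartAt 𝓘(ℝ, E) o).symm ⁻¹' U) :=
  (contMDiffOn_chartSymm o).continuousOn.isOpen_inter_preimage (isOpen_extChartAt_target o) hU

theorem contDiffOn_comp_chartSymm {Y : Type*} [NormedAddCommGroup Y] [NormedSpace ℝ Y] (o : M)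
    {f : M → Y} {U : Set M} (hf : ContMDiffOn 𝓘(ℝ, E) 𝓘(ℝ, Y) ∞ f U) :
    ContDiffOn ℝ ∞ (f ∘ (extChartAt 𝓘(ℝ, E) o).symm)
      ((extChartAt 𝓘(ℝ, E) o).target ∩ (extChartAt 𝓘(ℝ, E) o).symm ⁻¹' U) :=
  contMDiffOn_iff_contDiffOn.1
    (hf.comp ((contMDiffOn_chartSymm o).mono inter_subset_left) fun _ hx => hx.2)

/-- The trivialization of the tangent bundle at `o` acts on fibres as the derivative of the chart at
`o`, so smoothness of a section is smoothness of its coordinate expression. -/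
theorem smoothVectorOn_iff_chartDeriv (o : M) {X : (x : M) → TangentSpace 𝓘(ℝ, E) x} {U : Set M}
    (hU : IsOpen U) (hUo : U ⊆ (extChartAt 𝓘(ℝ, E) o).source) :
    SmoothVectorOn X U ↔ ContMDiffOn 𝓘(ℝ, E) 𝓘(ℝ, E) ∞ (fun p => chartDeriv E o p (X p)) U := by
  have h := (trivializationAt E (TangentSpace 𝓘(ℝ, E)) o).contMDiffOn_section_iff
    (IB := 𝓘(ℝ, E)) (n := ∞) (s := X) hU (by
      rw [TangentBundle.trivializationAt_baseSet, ← extChartAt_source 𝓘(ℝ, E)]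
      exact hUo)
  refine h.trans (contMDiffOn_congr fun p hp => ?_)
  have hp' : p ∈ (chartAt E o).source := by
    rw [← extChartAt_source 𝓘(ℝ, E)]; exact hUo hp
  have h1 := TangentBundle.continuousLinearMapAt_trivializationAt (I := 𝓘(ℝ, E)) hp'
  have h2 : (trivializationAt E (TangentSpace 𝓘(ℝ, E)) o).continuousLinearMapAt ℝ p (X p)
    = chartDeriv E o p (X p) := congrArg (fun T : E →L[ℝ] E => T (X p)) h1
  rw [← h2]
  symm
  refine Trivialization.continuousLinearMapAt_apply_of_mem ℝ _ ?_ _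
  rwa [TangentBundle.trivializationAt_baseSet]

theorem contDiffOn_coordVec (o : M) {X : (x : M) → TangentSpace 𝓘(ℝ, E) x} {U : Set M}
    (hU : IsOpen U) (hX : SmoothVectorOn X U) :
    ContDiffOn ℝ ∞ (coordVec o X)
      ((extChartAt 𝓘(ℝ, E) o).target ∩ (extChartAt 𝓘(ℝ, E) o).symm ⁻¹' U) := by
  have h1 := (smoothVectorOn_iff_chartDeriv o (hU.inter (isOpen_extChartAt_source o))
    inter_subset_right).1 (ContMDiffOn.mono hX inter_subset_left)
  refine (contDiffOn_comp_chartSymm o h1).mono fun y hy => ⟨hy.1, hy.2, ?_⟩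
  exact (extChartAt 𝓘(ℝ, E) o).map_target hy.1

/-- The vector field with a given coordinate expression in the preferred chart at `o`. -/
def fieldOfCoord (o : M) (Y : E → E) (p : M) : TangentSpace 𝓘(ℝ, E) p :=
  (chartDeriv E o p).inverse (Y (extChartAt 𝓘(ℝ, E) o p))

theorem chartDeriv_fieldOfCoord {o p : M} (hp : p ∈ (extChartAt 𝓘(ℝ, E) o).source) (Y : E → E) :
    chartDeriv E o p (fieldOfCoord o Y p) = Y (extChartAt 𝓘(ℝ, E) o p) :=
  chartDeriv_apply_inverse hp _

theorem fieldOfCoord_chartSymm {o : M} {y : E} (hy : y ∈ (extChartAt 𝓘(ℝ, E) o).target)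
    (Y : E → E) : fieldOfCoord o Y ((extChartAt 𝓘(ℝ, E) o).symm y) = chartSymmDeriv o y (Y y) := by
  rw [fieldOfCoord, chartSymmDeriv_eq hy, (extChartAt 𝓘(ℝ, E) o).right_inv hy]

theorem smoothVectorOn_fieldOfCoord (o : M) {Y : E → E} {O : Set E} (hO : IsOpen O)
    (hY : ContDiffOn ℝ ∞ Y O) :
    SmoothVectorOn (fieldOfCoord o Y)
      ((extChartAt 𝓘(ℝ, E) o).source ∩ extChartAt 𝓘(ℝ, E) o ⁻¹' O) := by
  have hc : ContMDiffOn 𝓘(ℝ, E) 𝓘(ℝ, E) ∞ (extChartAt 𝓘(ℝ, E) o)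
      (extChartAt 𝓘(ℝ, E) o).source := by
    rw [extChartAt_source]; exact contMDiffOn_extChartAt
  refine (smoothVectorOn_iff_chartDeriv o
    (hc.continuousOn.isOpen_inter_preimage (isOpen_extChartAt_source o) hO)
    inter_subset_left).2 ?_
  refine (hY.contMDiffOn.comp (hc.mono inter_subset_left) fun p hp => hp.2).congr fun p hp => ?_
  exact chartDeriv_fieldOfCoord hp.1 Y

/-- A smooth one-form evaluated on a smooth vector field. -/
theorem contMDiffOn_form_apply {ξ : (x : M) → Cotangent E x} {X : (x : M) → TangentSpace 𝓘(ℝ, E) x}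
    {U : Set M} (hξ : SmoothFormOn ξ U) (hX : SmoothVectorOn X U) :
    ContMDiffOn 𝓘(ℝ, E) 𝓘(ℝ, ℝ) ∞ (fun x => ξ x (X x)) U := by
  have h := ContMDiffOn.clm_bundle_apply (F₁ := E) (F₂ := ℝ)
    (E₁ := fun x : M => TangentSpace 𝓘(ℝ, E) x) (E₂ := Bundle.Trivial M ℝ) hξ hX
  intro x hx
  exact contMDiffWithinAt_section.1 (h x hx)

/-- In finite dimension, a map into the dual is smooth once its evaluations at fixed vectors are;
these are the values of the form on the fields that are constant in the chart. -/
theorem contDiffOn_formInChart [FiniteDimensional ℝ E] (o : M) {ξ : (x : M) → Cotangent E x}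
    {U : Set M} (hξ : SmoothFormOn ξ U) :
    ContDiffOn ℝ ∞ (formInChart ξ o)
      ((extChartAt 𝓘(ℝ, E) o).target ∩ (extChartAt 𝓘(ℝ, E) o).symm ⁻¹' U) := by
  refine contDiffOn_clm_apply.2 fun v => ?_
  have h1 : SmoothVectorOn (fieldOfCoord o fun _ => v)
      ((extChartAt 𝓘(ℝ, E) o).source ∩ U) :=
    (smoothVectorOn_fieldOfCoord o isOpen_univ contDiffOn_const).mono
      fun p hp => ⟨hp.1, mem_univ _⟩
  have h2 := contMDiffOn_form_apply (ContMDiffOn.mono hξ inter_subset_right) h1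
  refine ((contDiffOn_comp_chartSymm o h2).mono fun y hy =>
    ⟨hy.1, (extChartAt 𝓘(ℝ, E) o).map_target hy.1, hy.2⟩).congr fun y hy => ?_
  simp only [Function.comp_apply, fieldOfCoord_chartSymm hy.1]
  rfl

omit [IsManifold 𝓘(ℝ, E) ∞ M] in
theorem formInChart_apply (ξ : (x : M) → Cotangent E x) (o : M) (y v : E) :
    formInChart ξ o y v = ξ _ (chartSymmDeriv o y v) := rfl

theorem hasMFDerivAt_chartSymm {o : M} {y : E} (hy : y ∈ (extChartAt 𝓘(ℝ, E) o).target) :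
    HasMFDerivAt 𝓘(ℝ, E) 𝓘(ℝ, E) (extChartAt 𝓘(ℝ, E) o).symm y (chartSymmDeriv o y) :=
  (((contMDiffOn_chartSymm o).contMDiffAt
    ((isOpen_extChartAt_target o).mem_nhds hy)).mdifferentiableAt (by simp)).hasMFDerivAt

theorem hasMFDerivAt_chart {o p : M} (hp : p ∈ (extChartAt 𝓘(ℝ, E) o).source) :
    HasMFDerivAt 𝓘(ℝ, E) 𝓘(ℝ, E) (extChartAt 𝓘(ℝ, E) o) p (chartDeriv E o p) := by
  refine (mdifferentiableAt_extChartAt ?_).hasMFDerivAt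
  rwa [← extChartAt_source 𝓘(ℝ, E)]

/-- The bracket of vector fields given in a chart. -/
theorem mlieBracket_fieldOfCoord [CompleteSpace E] {o p : M}
    (hp : p ∈ (extChartAt 𝓘(ℝ, E) o).source) {Y Z : E → E}
    (hY : ContDiffAt ℝ ∞ Y (extChartAt 𝓘(ℝ, E) o p))
    (hZ : ContDiffAt ℝ ∞ Z (extChartAt 𝓘(ℝ, E) o p)) :
    VectorField.mlieBracket 𝓘(ℝ, E) (fieldOfCoord o Y) (fieldOfCoord o Z) p
      = fieldOfCoord o (VectorField.lieBracket ℝ Y Z) p := by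
  have hf : ContMDiffAt 𝓘(ℝ, E) 𝓘(ℝ, E) ∞ (extChartAt 𝓘(ℝ, E) o) p := by
    refine contMDiffOn_extChartAt.contMDiffAt ((chartAt E o).open_source.mem_nhds ?_)
    rwa [← extChartAt_source 𝓘(ℝ, E)]
  have hn : minSmoothness ℝ 2 ≤ ∞ := by
    rw [minSmoothness_of_isRCLikeNormedField]
    exact ENat.LEInfty.out
  have : IsManifold 𝓘(ℝ, E) (minSmoothness ℝ 2) M := IsManifold.of_le (n := ∞) hn
  have h := VectorField.mpullback_mlieBracket (I := 𝓘(ℝ, E)) (I' := 𝓘(ℝ, E))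
    ((contMDiffAt_vectorSpace_iff_contDiffAt.2 hY).mdifferentiableAt (by simp))
    ((contMDiffAt_vectorSpace_iff_contDiffAt.2 hZ).mdifferentiableAt (by simp)) hf hn
  have h2 : ∀ V W : (x : E) → TangentSpace 𝓘(ℝ, E) x,
      VectorField.mlieBracket 𝓘(ℝ, E) V W = VectorField.lieBracket ℝ V W := fun V W =>
    VectorField.mlieBracketWithin_univ.symm.trans
      (VectorField.mlieBracketWithin_eq_lieBracketWithin.trans VectorField.lieBracketWithin_univ)
  refine h.symm.trans ?_
  exact congrArg (chartDeriv E o p).inverse (congrFun (h2 Y Z) _)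

theorem fderiv_comp_chartSymm {Y : Type*} [NormedAddCommGroup Y] [NormedSpace ℝ Y] {o : M} {y : E}
    (hy : y ∈ (extChartAt 𝓘(ℝ, E) o).target) {f : M → Y}
    (hf : MDifferentiableAt 𝓘(ℝ, E) 𝓘(ℝ, Y) f ((extChartAt 𝓘(ℝ, E) o).symm y)) (v : E) :
    fderiv ℝ (f ∘ (extChartAt 𝓘(ℝ, E) o).symm) y v
      = mfderiv 𝓘(ℝ, E) 𝓘(ℝ, Y) f ((extChartAt 𝓘(ℝ, E) o).symm y) (chartSymmDeriv o y v) := by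
  have h := (hf.hasMFDerivAt.comp y (hasMFDerivAt_chartSymm hy)).mfderiv
  rw [mfderiv_eq_fderiv] at h
  exact congrArg (fun T : E →L[ℝ] Y => T v) h

theorem formInChart_chartDeriv {o p : M} (hp : p ∈ (extChartAt 𝓘(ℝ, E) o).source)
    (ξ : (x : M) → Cotangent E x) (w : TangentSpace 𝓘(ℝ, E) p) :
    formInChart ξ o (extChartAt 𝓘(ℝ, E) o p) (chartDeriv E o p w) = ξ p w := by
  rw [formInChart_apply, chartSymmDeriv_eq ((extChartAt 𝓘(ℝ, E) o).map_source hp)]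
  -- The two base points are equal but not by definition, so the fibres are identified by
  -- substituting a variable point.
  have h : ∀ p', p' = p → ξ p' ((chartDeriv E o p').inverse (chartDeriv E o p w)) = ξ p w := by
    rintro p' rfl
    rw [chartDeriv_inverse_apply hp]
  exact h _ ((extChartAt 𝓘(ℝ, E) o).left_inv hp)

end ChartCalculus

/-! ### Pullback of one-forms to a vector space -/

section PullbackForm

variable {X : Type*} [NormedAddCommGroup X] [NormedSpace ℝ X]
  {F : Type*} [NormedAddCommGroup F] [NormedSpace ℝ F]
  {Q : Type*} [TopologicalSpace Q] [ChartedSpace F Q]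

/-- The pullback of a one-form to a vector space. -/
def pullbackForm (m : X → Q) (σ : (q : Q) → Cotangent F q) (x : X) : X →L[ℝ] ℝ :=
  (σ (m x)).comp (mfderiv 𝓘(ℝ, X) 𝓘(ℝ, F) m x)

theorem pullbackForm_apply (m : X → Q) (σ : (q : Q) → Cotangent F q) (x v : X) :
    pullbackForm m σ x v = σ (m x) (mfderiv 𝓘(ℝ, X) 𝓘(ℝ, F) m x v) := rfl

variable [IsManifold 𝓘(ℝ, F) ∞ Q] {m : X → Q} {σ : (q : Q) → Cotangent F q} {O : Set X}

/-- The expression of a map and of the pullback of a form in the chart around the image of a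
point. -/
theorem pullbackForm_eventuallyEq (hO : IsOpen O) (hm : ContMDiffOn 𝓘(ℝ, X) 𝓘(ℝ, F) ∞ m O)
    {x₀ : X} (hx₀ : x₀ ∈ O) :
    ContDiffAt ℝ ∞ (extChartAt 𝓘(ℝ, F) (m x₀) ∘ m) x₀ ∧
    (∀ v, fderiv ℝ (extChartAt 𝓘(ℝ, F) (m x₀) ∘ m) x₀ v
      = chartDeriv F (m x₀) (m x₀) (mfderiv 𝓘(ℝ, X) 𝓘(ℝ, F) m x₀ v)) ∧
    pullbackForm m σ =ᶠ[𝓝 x₀] fun x =>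
      (formInChart σ (m x₀) ((extChartAt 𝓘(ℝ, F) (m x₀) ∘ m) x)).comp
        (fderiv ℝ (extChartAt 𝓘(ℝ, F) (m x₀) ∘ m) x) := by
  have hd : ∀ x ∈ O, m x ∈ (extChartAt 𝓘(ℝ, F) (m x₀)).source → ∀ v,
      fderiv ℝ (extChartAt 𝓘(ℝ, F) (m x₀) ∘ m) x v
        = chartDeriv F (m x₀) (m x) (mfderiv 𝓘(ℝ, X) 𝓘(ℝ, F) m x v) := by
    intro x hx hxs v
    have h1 : MDifferentiableAt 𝓘(ℝ, X) 𝓘(ℝ, F) m x :=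
      (hm.contMDiffAt (hO.mem_nhds hx)).mdifferentiableAt (by simp)
    have h2 := ((hasMFDerivAt_chart hxs).comp x h1.hasMFDerivAt).mfderiv
    rw [mfderiv_eq_fderiv] at h2
    exact congrArg (fun T : X →L[ℝ] F => T v) h2
  have hms : ∀ᶠ x in 𝓝 x₀, m x ∈ (extChartAt 𝓘(ℝ, F) (m x₀)).source :=
    (hm.contMDiffAt (hO.mem_nhds hx₀)).continuousAt
      ((isOpen_extChartAt_source _).mem_nhds (mem_extChartAt_source _))
  refine ⟨?_, hd x₀ hx₀ (mem_extChartAt_source _), ?_⟩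
  · exact ((contMDiffAt_extChartAt (I := 𝓘(ℝ, F)) (n := ∞)).comp x₀
      (hm.contMDiffAt (hO.mem_nhds hx₀))).contDiffAt
  · filter_upwards [hms, hO.mem_nhds hx₀] with x hx hxO
    ext v
    rw [ContinuousLinearMap.comp_apply, hd x hxO hx, Function.comp_apply, formInChart_chartDeriv hx]
    rfl

variable [FiniteDimensional ℝ F]

theorem contDiffAt_formInChart (hσ : SmoothFormOn σ univ) (q : Q) :
    ContDiffAt ℝ ∞ (formInChart σ q) (extChartAt 𝓘(ℝ, F) q q) := by
  refine (contDiffOn_formInChart q hσ).contDiffAt ?_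
  rw [preimage_univ, inter_univ]
  exact (isOpen_extChartAt_target q).mem_nhds (mem_extChartAt_target q)

theorem contDiffOn_pullbackForm (hO : IsOpen O) (hm : ContMDiffOn 𝓘(ℝ, X) 𝓘(ℝ, F) ∞ m O)
    (hσ : SmoothFormOn σ univ) : ContDiffOn ℝ ∞ (pullbackForm m σ) O := by
  intro x hx
  obtain ⟨h1, -, h3⟩ := pullbackForm_eventuallyEq (σ := σ) hO hm hx
  refine (ContDiffAt.congr_of_eventuallyEq ?_ h3).contDiffWithinAt
  exact ((contDiffAt_formInChart hσ (m x)).comp x h1).clm_comp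
    (h1.fderiv_right (m := ∞) (by simp))

/-- The exterior derivative commutes with pullback. -/
theorem extDeriv_pullbackForm (hO : IsOpen O) (hm : ContMDiffOn 𝓘(ℝ, X) 𝓘(ℝ, F) ∞ m O)
    (hσ : SmoothFormOn σ univ) {x : X} (hx : x ∈ O) (v w : X) :
    fderiv ℝ (pullbackForm m σ) x v w - fderiv ℝ (pullbackForm m σ) x w v
      = extDerivForm σ (m x) (mfderiv 𝓘(ℝ, X) 𝓘(ℝ, F) m x v)
        (mfderiv 𝓘(ℝ, X) 𝓘(ℝ, F) m x w) := by
  obtain ⟨h1, h2, h3⟩ := pullbackForm_eventuallyEq (σ := σ) hO hm hx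
  set ψ := extChartAt 𝓘(ℝ, F) (m x) ∘ m with hψ
  have hf := ((contDiffAt_formInChart hσ (m x)).differentiableAt (by simp)).hasFDerivAt
  have hψ1 := (h1.differentiableAt (by simp)).hasFDerivAt
  have hψ2 := ((h1.fderiv_right (m := ∞) (by simp)).differentiableAt (by simp)).hasFDerivAt
  -- The pulled back form is `formInChart` composed with `dψ`; its derivative contains a second
  -- derivative of `ψ`, which is symmetric and cancels after antisymmetrization.
  have hsymm : IsSymmSndFDerivAt ℝ ψ x :=
    (h1.of_le (n := ∞) (m := 2) ENat.LEInfty.out).isSymmSndFDerivAt (by simp)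
  have hτ := ((HasFDerivAt.comp x hf hψ1).clm_comp hψ2).congr_of_eventuallyEq h3
  have key : ∀ v w, fderiv ℝ (pullbackForm m σ) x v w
      = formInChart σ (m x) (ψ x) (fderiv ℝ (fderiv ℝ ψ) x v w)
        + fderiv ℝ (formInChart σ (m x)) (ψ x) (fderiv ℝ ψ x v) (fderiv ℝ ψ x w) := by
    intro v w
    rw [hτ.fderiv]
    rfl
  rw [key, key, hsymm v w, h2, h2]
  unfold extDerivForm
  simp only [hψ, Function.comp_apply]
  exact add_sub_add_left_eq_sub _ _ _

end PullbackForm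

/-! ### Linear algebra of Dirac structures -/

section Linear

variable {E : Type*} [NormedAddCommGroup E] [NormedSpace ℝ E]
  {M : Type*} [TopologicalSpace M] [ChartedSpace E M]

/-- A maximal isotropic subspace contains the isotropic vectors orthogonal to it. -/
theorem mem_of_forall_pairPlus_eq_zero {x : M} {W : Submodule ℝ (GenTangent E x)}
    (hW : Maximal IsIsotropic W) {v : GenTangent E x} (hv : v.2 v.1 = 0)
    (hvW : ∀ e ∈ W, e.2 v.1 + v.2 e.1 = 0) : v ∈ W := by
  -- Adjoining `v` keeps the subspace isotropic, so maximality leaves nothing to adjoin.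
  have hiso : IsIsotropic (W ⊔ Submodule.span ℝ {v}) := by
    intro e₁ h₁ e₂ h₂
    obtain ⟨w₁, hw₁, _, hz₁, rfl⟩ := Submodule.mem_sup.1 h₁
    obtain ⟨c₁, rfl⟩ := Submodule.mem_span_singleton.1 hz₁
    obtain ⟨w₂, hw₂, _, hz₂, rfl⟩ := Submodule.mem_sup.1 h₂
    obtain ⟨c₂, rfl⟩ := Submodule.mem_span_singleton.1 hz₂
    have h12 := hW.1 w₁ hw₁ w₂ hw₂
    have h1 := hvW w₁ hw₁
    have h2 := hvW w₂ hw₂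
    simp only [pairPlus, Prod.fst_add, Prod.snd_add, Prod.smul_fst, Prod.smul_snd, map_add,
      map_smul, add_apply, smul_apply, smul_eq_mul] at h12 h1 h2 ⊢
    linear_combination h12 + (1 / 2) * c₂ * h1 + (1 / 2) * c₁ * h2 + c₁ * c₂ * hv
  exact hW.2 hiso le_sup_left (Submodule.mem_sup_right (Submodule.mem_span_singleton_self v))

/-- A covector annihilating `W ∩ TM` is the cotangent part of an element of `W`. -/
theorem exists_mem_of_annihilates [FiniteDimensional ℝ E] {x : M}
    {W : Submodule ℝ (GenTangent E x)} (hW : Maximal IsIsotropic W) {ξ : Cotangent E x}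
    (hξ : ∀ Y : TangentSpace 𝓘(ℝ, E) x, (Y, (0 : Cotangent E x)) ∈ W → ξ Y = 0) :
    ∃ Y : TangentSpace 𝓘(ℝ, E) x, (Y, ξ) ∈ W := by
  -- The covector parts of `W` form the annihilator of their common kernel, the dimension being
  -- finite. By maximality, each `Y` in this kernel satisfies `(Y, 0) ∈ W`, so `ξ` annihilates it.
  let R : Submodule ℝ (Module.Dual ℝ E) :=
    W.map ((ContinuousLinearMap.coeLM ℝ (M := E) (N₃ := ℝ)).comp (LinearMap.snd ℝ E (E →L[ℝ] ℝ)))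
  have hR : ((ξ : E →L[ℝ] ℝ).toLinearMap : Module.Dual ℝ E) ∈ R := by
    rw [← Subspace.dualCoannihilator_dualAnnihilator_eq (W := R)]
    refine (Submodule.mem_dualAnnihilator _).2 fun Y hY => ?_
    rw [Submodule.mem_dualCoannihilator] at hY
    refine hξ Y (mem_of_forall_pairPlus_eq_zero hW rfl fun e he => ?_)
    have h : e.2 Y = 0 := hY _ (Submodule.mem_map_of_mem he)
    simpa using h
  obtain ⟨e, he, h⟩ := hR
  refine ⟨e.1, ?_⟩
  have : e.2 = ξ := ContinuousLinearMap.coe_injective h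
  rwa [← this]

end Linear

/-! ### Local sections of a principal circle bundle -/

section Bundle

variable {E F : Type*} [NormedAddCommGroup E] [NormedSpace ℝ E]
  [NormedAddCommGroup F] [NormedSpace ℝ F]
  {P : Type*} [TopologicalSpace P] [ChartedSpace E P]
  {Q : Type*} [TopologicalSpace Q] [ChartedSpace F Q] [MulAction Circle Q]

/-- Local sections, with the angular coordinates that they define. -/
theorem IsPrincipalCircleBundle.exists_section {proj : Q → P}
    (h : IsPrincipalCircleBundle E F proj) (p : P) :
    ∃ U : Set P, IsOpen U ∧ p ∈ U ∧ ∃ (s : P → Q) (ζ : Q → Circle),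
      ContMDiffOn 𝓘(ℝ, E) 𝓘(ℝ, F) ∞ s U ∧ ContMDiffOn 𝓘(ℝ, F) (𝓡 1) ∞ ζ (proj ⁻¹' U) ∧
      (∀ p ∈ U, proj (s p) = p) ∧ (∀ p ∈ U, ζ (s p) = 1) ∧
      ∀ q ∈ proj ⁻¹' U, ζ q • s (proj q) = q := by
  obtain ⟨e, hp, he, hes, hsmul⟩ := h.locally_trivial p
  have ht : ∀ p ∈ e.baseSet, (p, (1 : Circle)) ∈ e.target := fun p hp => by
    rw [e.target_eq]; exact ⟨hp, mem_univ _⟩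
  have hproj : ∀ p ∈ e.baseSet, proj (e.toOpenPartialHomeomorph.symm (p, 1)) = p := fun p hp =>
    e.proj_symm_apply (ht p hp)
  have hone : ∀ p ∈ e.baseSet, (e (e.toOpenPartialHomeomorph.symm (p, 1))).2 = 1 := fun p hp => by
    rw [e.apply_symm_apply (ht p hp)]
  refine ⟨e.baseSet, e.open_baseSet, hp, fun p => e.toOpenPartialHomeomorph.symm (p, 1),
    fun q => (e q).2, ?_, ?_, hproj, hone, fun q hq => ?_⟩
  · exact hes.comp (contMDiff_id.prodMk contMDiff_const).contMDiffOn ht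
  · rw [← e.source_eq]
    exact contMDiff_snd.comp_contMDiffOn he
  · have hq' : q ∈ e.source := e.mem_source.2 hq
    have hs : e.toOpenPartialHomeomorph.symm (proj q, 1) ∈ e.source := by
      rw [e.mem_source, hproj _ hq]; exact hq
    have hz : (e q).2 • e.toOpenPartialHomeomorph.symm (proj q, 1) ∈ e.source := by
      rw [e.mem_source, h.proj_smul, hproj _ hq]; exact hq
    refine e.injOn hz hq' (Prod.ext ?_ ?_)
    · change (e _).1 = (e q).1
      rw [e.coe_fst hz, e.coe_fst hq', h.proj_smul, hproj _ hq]
    · change (e _).2 = (e q).2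
      rw [hsmul _ hs, hone _ hq, mul_one]

theorem IsPrincipalCircleBundle.contMDiff_smul_const {proj : Q → P}
    (h : IsPrincipalCircleBundle E F proj) (z : Circle) :
    ContMDiff 𝓘(ℝ, F) 𝓘(ℝ, F) ∞ fun q : Q => z • q := by
  have := h.smooth_action
  exact this.contMDiff_smul.comp (contMDiff_const.prodMk contMDiff_id)

end Bundle

/-! ### The Dirac-Jacobi structure of a prequantization -/

namespace Prequantization

variable {E : Type*} [NormedAddCommGroup E] [NormedSpace ℝ E]
  {P : Type*} [TopologicalSpace P] [ChartedSpace E P] [IsManifold 𝓘(ℝ, E) ∞ P]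
  {L : DiracStructure E P}
  {F : Type*} [NormedAddCommGroup F] [NormedSpace ℝ F]
  {Q : Type*} [TopologicalSpace Q] [ChartedSpace F Q] [IsManifold 𝓘(ℝ, F) ∞ Q]
  [MulAction Circle Q] (B : Prequantization L F Q)

/-- A smooth local section through a given point. -/
theorem exists_section_through (q : Q) : ∃ U : Set P, IsOpen U ∧ B.proj q ∈ U ∧ ∃ s : P → Q,
    ContMDiffOn 𝓘(ℝ, E) 𝓘(ℝ, F) ∞ s U ∧ (∀ p ∈ U, B.proj (s p) = p) ∧ s (B.proj q) = q := by
  obtain ⟨U, hU, hq, s, ζ, hs, -, hp, -, hz⟩ := B.principal.exists_section (B.proj q)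
  refine ⟨U, hU, hq, fun p => ζ q • s p,
    (B.principal.contMDiff_smul_const (ζ q)).comp_contMDiffOn hs,
    fun p hpU => ?_, hz q hq⟩
  rw [B.principal.proj_smul, hp p hpU]

theorem hasMFDerivAt_proj (q : Q) : HasMFDerivAt 𝓘(ℝ, F) 𝓘(ℝ, E) B.proj q (B.dproj q) :=
  ((B.principal.smooth_proj).mdifferentiable (by simp) q).hasMFDerivAt

theorem dproj_mfderiv_section {U : Set P} (hU : IsOpen U) {s : P → Q}
    (hs : ContMDiffOn 𝓘(ℝ, E) 𝓘(ℝ, F) ∞ s U) (hp : ∀ p ∈ U, B.proj (s p) = p) {p : P} (hpU : p ∈ U)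
    (v : E) : B.dproj (s p) (mfderiv 𝓘(ℝ, E) 𝓘(ℝ, F) s p v) = v := by
  have h1 := ((hs.contMDiffAt (hU.mem_nhds hpU)).mdifferentiableAt (by simp)).hasMFDerivAt
  have h2 := (B.hasMFDerivAt_proj (s p)).comp p h1
  have h3 : B.proj ∘ s =ᶠ[𝓝 p] id := by
    filter_upwards [hU.mem_nhds hpU] with p' hp' using hp p' hp'
  have h4 := (h2.congr_of_eventuallyEq h3.symm).mfderiv
  rw [mfderiv_id] at h4
  exact (congrArg (fun T : E →L[ℝ] E => T v) h4).symm

/-- The derivative of a section through `q` lifts `X`; subtracting the multiple of the generator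
measured by `σ` makes the lift horizontal. -/
theorem exists_isHorizontalLift (q : Q) (X : TangentSpace 𝓘(ℝ, E) (B.proj q)) :
    ∃ Y, B.IsHorizontalLift q X Y := by
  obtain ⟨U, hU, hq, s, hs, hp, hsq⟩ := B.exists_section_through q
  have h := B.dproj_mfderiv_section hU hs hp hq X
  have h' : ∀ q', q' = q → ∀ Y : F, (B.dproj q' : F →L[ℝ] E) Y = X → ∃ Y, B.dproj q Y = X := by
    rintro q' rfl Y hY
    exact ⟨Y, hY⟩
  obtain ⟨Y, hY⟩ := h' _ hsq _ h
  refine ⟨Y - B.σ q Y • generator q, ?_, ?_⟩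
  · simp [B.connection.apply_generator]
  · simp [B.dproj_generator, hY]

/-- The description of `L̄` by its components. -/
theorem mem_lbar {q : Q} {Y : TangentSpace 𝓘(ℝ, F) q} {x : L.fiber (B.proj q)} {φ b : ℝ}
    {η : Cotangent F q} (hY : B.dproj q Y = (x : GenTangent E (B.proj q)).1 - φ • B.A (B.proj q))
    (hσ : B.σ q Y = B.β (B.proj q) x - b)
    (hη : ∀ v, η v = (x : GenTangent E (B.proj q)).2 (B.dproj q v)
      + φ * (B.σ q v - B.α (B.proj q) (B.dproj q v))) : ((Y, φ), (η, b)) ∈ B.Lbar q := by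
  obtain ⟨AH, hA⟩ := B.exists_isHorizontalLift q (B.A (B.proj q))
  have hA' := hA
  obtain ⟨hA1, hA2⟩ := hA'
  have hx : B.IsHorizontalLift q (x : GenTangent E (B.proj q)).1
      (Y + φ • AH - B.σ q Y • generator q) := by
    constructor
    · simp [B.connection.apply_generator, hA1]
    · simp [B.dproj_generator, hA2, hY]
  have h1 : ((Y + φ • AH - B.σ q Y • generator q + B.β (B.proj q) x • generator q, 0),
      ((x : GenTangent E (B.proj q)).2.comp (B.dproj q), 0)) ∈ B.Lbar q :=
    Submodule.mem_sup_left (Submodule.mem_sup_left (Submodule.subset_span ⟨x, _, hx, rfl⟩))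
  have h2 : ((-generator q, 0), (0, 1)) ∈ B.Lbar q :=
    Submodule.mem_sup_left (Submodule.mem_sup_right (Submodule.subset_span rfl))
  have h3 : ((-AH, 1), (B.σ q - (B.α (B.proj q)).comp (B.dproj q), 0)) ∈ B.Lbar q :=
    Submodule.mem_sup_right (Submodule.subset_span ⟨AH, hA, rfl⟩)
  have h4 := (B.Lbar q).add_mem ((B.Lbar q).add_mem h1 ((B.Lbar q).smul_mem b h2))
    ((B.Lbar q).smul_mem φ h3)
  convert h4 using 1
  refine Prod.ext (Prod.ext ?_ ?_) (Prod.ext ?_ ?_)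
  · simp only [Prod.fst_add, Prod.smul_fst, hσ]
    module
  · simp
  · ext v
    simp [hη v]
  · simp

/-- The elements of `L̄ ∩ (TQ × ℝ)`. -/
theorem exists_of_mem_lbar_vector {q : Q} {Y : TangentSpace 𝓘(ℝ, F) q} {c : ℝ}
    (h : ((Y, c), (0, 0)) ∈ B.Lbar q) : c = 0 ∧ ∃ x : L.fiber (B.proj q),
      (x : GenTangent E (B.proj q)) = (B.dproj q Y, 0) ∧ B.σ q Y = B.β (B.proj q) x := by
  obtain rfl := (B.lbar_pairing h).1
  obtain ⟨x, b, h1, h2, h3, h4⟩ := B.exists_of_mem_lbar h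
  refine ⟨rfl, x, Prod.ext ?_ ?_, ?_⟩
  · simpa using h1.symm
  · ext w
    obtain ⟨Y', -, rfl⟩ := B.exists_isHorizontalLift q w
    simpa using (h3 Y').symm
  · have : b = 0 := by simpa using h4.symm
    simpa [this] using h2

end Prequantization

/-! ### Forms vanishing near a point -/

section Vanishing

variable {E : Type*} [NormedAddCommGroup E] [NormedSpace ℝ E]
  {M : Type*} [TopologicalSpace M] [ChartedSpace E M]

theorem differential_eq_zero_of_eventually {f : M → ℝ} {x : M} (hf : ∀ᶠ y in 𝓝 x, f y = 0) :
    differential (E := E) f x = 0 := by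
  have h : f =ᶠ[𝓝 x] fun _ => (0 : ℝ) := hf
  unfold differential
  rw [h.mfderiv_eq, mfderiv_const]
  rfl

variable [IsManifold 𝓘(ℝ, E) ∞ M]

theorem lieDerivForm_eq_zero_of_eventually (X : (x : M) → TangentSpace 𝓘(ℝ, E) x)
    {ξ : (x : M) → Cotangent E x} {x : M} (hξ : ∀ᶠ y in 𝓝 x, ξ y = 0) :
    lieDerivForm X ξ x = 0 := by
  have h1 : formInChart ξ x =ᶠ[𝓝 (extChartAt 𝓘(ℝ, E) x x)] fun _ => 0 := by
    have h := (continuousAt_extChartAt_symm (I := 𝓘(ℝ, E)) x)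
    have h' := h.eventually (p := fun y => ξ y = 0) (by rwa [extChartAt_to_inv])
    filter_upwards [h'] with y hy
    ext v
    rw [formInChart_apply, hy]
    rfl
  have h2 : contractExtDeriv ξ x (X x) = 0 := by
    ext w
    rw [contractExtDeriv_apply]
    unfold extDerivForm
    simp only [h1.fderiv_eq]
    simp
  rw [lieDerivForm, h2, differential_eq_zero_of_eventually, add_zero]
  filter_upwards [hξ] with y hy
  rw [hy]
  rfl

/-- Every term of the covector part is a derivative of forms that vanish near the point. On sections
of `L ∩ TP`, closure under the Courant bracket is therefore involutivity. -/
theorem courantBracket_of_eventually_eq_zero {e₁ e₂ : (x : M) → GenTangent E x} {x : M}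
    (h₁ : ∀ᶠ y in 𝓝 x, (e₁ y).2 = 0) (h₂ : ∀ᶠ y in 𝓝 x, (e₂ y).2 = 0) :
    courantBracket e₁ e₂ x
      = (VectorField.mlieBracket 𝓘(ℝ, E) (fun y => (e₁ y).1) (fun y => (e₂ y).1) x, 0) := by
  rw [courantBracket, lieDerivForm_eq_zero_of_eventually _ h₁,
    lieDerivForm_eq_zero_of_eventually _ h₂, differential_eq_zero_of_eventually]
  · simp
  · filter_upwards [h₁, h₂] with y hy₁ hy₂
    rw [hy₁, hy₂]
    simp

theorem smoothFormOn_zero (U : Set M) : SmoothFormOn (fun x : M => (0 : Cotangent E x)) U :=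
  (contMDiff_zeroSection (IB := 𝓘(ℝ, E)) (n := ∞) ℝ
    (fun x : M => TangentSpace 𝓘(ℝ, E) x →L[ℝ] Bundle.Trivial M ℝ x)).contMDiffOn

end Vanishing

/-! ### Linear combinations of families of functions -/

section Combine

variable {X : Type*} [NormedAddCommGroup X] [NormedSpace ℝ X]
  {Y : Type*} [NormedAddCommGroup Y] [NormedSpace ℝ Y] {ι : Type} [Fintype ι]

/-- The linear combinations of the values at a point of a family of functions. -/
def combine (w : ι → X → Y) (x : X) : (ι → ℝ) →L[ℝ] Y :=
  ∑ i, (ContinuousLinearMap.proj (R := ℝ) (φ := fun _ : ι => ℝ) i).smulRight (w i x)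

theorem combine_apply (w : ι → X → Y) (x : X) (c : ι → ℝ) :
    combine w x c = ∑ i, c i • w i x := by
  simp [combine]

theorem contDiffOn_combine {w : ι → X → Y} {O : Set X} (hw : ∀ i, ContDiffOn ℝ ∞ (w i) O) :
    ContDiffOn ℝ ∞ (combine w) O := by
  refine contDiffOn_clm_apply.2 fun c => ?_
  simp only [combine_apply]
  exact ContDiffOn.sum fun i _ => contDiffOn_const.smul (hw i)

end Combine

/-! ### Local frames of a prequantized Dirac manifold -/

section LocalFrame

variable {E : Type*} [NormedAddCommGroup E] [NormedSpace ℝ E]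
  {P : Type*} [TopologicalSpace P] [ChartedSpace E P] [IsManifold 𝓘(ℝ, E) ∞ P]
  {L : DiracStructure E P}
  {F : Type*} [NormedAddCommGroup F] [NormedSpace ℝ F]
  {Q : Type*} [TopologicalSpace Q] [ChartedSpace F Q] [IsManifold 𝓘(ℝ, F) ∞ Q]
  [MulAction Circle Q] {B : Prequantization L F Q}

/-- A frame of `L` and a section of `Q`, with the corresponding angular coordinate, over an open
subset of the domain of the preferred chart at `o`. -/
structure LocalFrame (B : Prequantization L F Q) (o : P) where
  dom : Set P
  isOpen_dom : IsOpen dom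
  dom_subset : dom ⊆ (extChartAt 𝓘(ℝ, E) o).source
  frame : Fin (Module.finrank ℝ E) → (p : P) → L.fiber p
  smooth_frame : ∀ i, L.SmoothSectionOn (frame i) dom
  bijective : ∀ p ∈ dom, Function.Bijective (Fintype.linearCombination ℝ fun i => frame i p)
  sec : P → Q
  angle : Q → Circle
  smooth_sec : ContMDiffOn 𝓘(ℝ, E) 𝓘(ℝ, F) ∞ sec dom
  smooth_angle : ContMDiffOn 𝓘(ℝ, F) (𝓡 1) ∞ angle (B.proj ⁻¹' dom)
  proj_sec : ∀ p ∈ dom, B.proj (sec p) = p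
  angle_sec : ∀ p ∈ dom, angle (sec p) = 1
  angle_smul : ∀ q ∈ B.proj ⁻¹' dom, angle q • sec (B.proj q) = q

theorem exists_localFrame (B : Prequantization L F Q) (o : P) :
    ∃ R : LocalFrame B o, o ∈ R.dom := by
  classical
  obtain ⟨U, hU, hoU, e, he, hspan⟩ := L.smooth_frame o
  obtain ⟨U', hU', hoU', s, ζ, hs, hζ, h1, h2, h3⟩ := B.principal.exists_section o
  let D := U ∩ U' ∩ (extChartAt 𝓘(ℝ, E) o).source
  have hmem : ∀ p ∈ U, ∀ i, e i p ∈ L.fiber p := fun p hp i => by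
    rw [← (hspan p hp).2]
    exact Submodule.subset_span (mem_range_self i)
  -- The frame takes values in `L` only over `U`. A section must be defined everywhere, so it is set
  -- to `0` wherever it leaves `L`, which does not happen over `U`.
  let f : Fin (Module.finrank ℝ E) → (p : P) → L.fiber p := fun i p =>
    if h : e i p ∈ L.fiber p then ⟨e i p, h⟩ else 0
  have hf : ∀ p ∈ U, ∀ i, (f i p : GenTangent E p) = e i p := fun p hp i => by
    simp only [f, dif_pos (hmem p hp i)]
  refine ⟨⟨D, (hU.inter hU').inter (isOpen_extChartAt_source o), inter_subset_right, f,
    fun i => ⟨?_, ?_⟩, fun p hp => ?_, s, ζ, hs.mono fun p hp => hp.1.2,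
    hζ.mono fun q hq => hq.1.2, fun p hp => h1 p hp.1.2, fun p hp => h2 p hp.1.2,
    fun q hq => h3 q hq.1.2⟩, ⟨hoU, hoU'⟩, mem_extChartAt_source o⟩
  · refine (ContMDiffOn.mono (he i).1 fun p hp => hp.1.1).congr fun p hp => ?_
    simp only [hf p hp.1.1 i]
  · refine (ContMDiffOn.mono (he i).2 fun p hp => hp.1.1).congr fun p hp => ?_
    simp only [hf p hp.1.1 i]
  · have hcoe : ∀ c, ((Fintype.linearCombination ℝ (fun i => f i p) c : L.fiber p) : GenTangent E p)
        = Fintype.linearCombination ℝ (fun i => e i p) c := fun c => by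
      simp only [Fintype.linearCombination_apply, Submodule.coe_sum, Submodule.coe_smul,
        hf p hp.1.1]
    constructor
    · intro c c' h
      have hl := (hspan p hp.1.1).1.fintypeLinearCombination_injective
      exact hl ((hcoe c).symm.trans ((congrArg Subtype.val h).trans (hcoe c')))
    · intro x
      have hx : (x : GenTangent E p) ∈ Submodule.span ℝ (range fun i => e i p) := by
        rw [(hspan p hp.1.1).2]
        exact x.2
      rw [← Fintype.range_linearCombination ℝ] at hx
      obtain ⟨c, hc⟩ := hx
      exact ⟨c, Subtype.ext ((hcoe c).trans hc)⟩

namespace LocalFrame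

variable {o : P} (R : LocalFrame B o)

/-- The domain of the frame, in the preferred chart at `o`. -/
def coordDom : Set E := (extChartAt 𝓘(ℝ, E) o).target ∩ (extChartAt 𝓘(ℝ, E) o).symm ⁻¹' R.dom

theorem isOpen_coordDom : IsOpen R.coordDom := isOpen_chart_target_inter o R.isOpen_dom

/-- The linear combinations of the frame. -/
def comb (p : P) : (Fin (Module.finrank ℝ E) → ℝ) →ₗ[ℝ] L.fiber p :=
  Fintype.linearCombination ℝ fun i => R.frame i p

/-- The vector parts of the linear combinations of the frame, in coordinates. -/
def vecPart : E → (Fin (Module.finrank ℝ E) → ℝ) →L[ℝ] E :=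
  combine fun i => coordVec o fun p => (R.frame i p : GenTangent E p).1

/-- The covector parts of the linear combinations of the frame, in coordinates. -/
def formPart : E → (Fin (Module.finrank ℝ E) → ℝ) →L[ℝ] E →L[ℝ] ℝ :=
  combine fun i => formInChart (fun p => (R.frame i p : GenTangent E p).2) o

/-- The values of `β` on the linear combinations of the frame, in coordinates. -/
def betaPart : E → (Fin (Module.finrank ℝ E) → ℝ) →L[ℝ] ℝ :=
  combine fun i y => B.β ((extChartAt 𝓘(ℝ, E) o).symm y) (R.frame i _)

/-- The local section of `Q`, in coordinates. -/
def coordSec (y : E) : Q := R.sec ((extChartAt 𝓘(ℝ, E) o).symm y)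

/-- The local connection potential. -/
def potential : E → E →L[ℝ] ℝ := pullbackForm R.coordSec B.σ

theorem contDiffOn_vecPart : ContDiffOn ℝ ∞ R.vecPart R.coordDom :=
  contDiffOn_combine fun i => contDiffOn_coordVec o R.isOpen_dom (R.smooth_frame i).1

theorem contDiffOn_formPart [FiniteDimensional ℝ E] : ContDiffOn ℝ ∞ R.formPart R.coordDom :=
  contDiffOn_combine fun i => contDiffOn_formInChart o (R.smooth_frame i).2

theorem contDiffOn_betaPart : ContDiffOn ℝ ∞ R.betaPart R.coordDom :=
  contDiffOn_combine fun i =>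
    contDiffOn_comp_chartSymm o (B.smooth_β R.dom R.isOpen_dom _ (R.smooth_frame i))

theorem contMDiffOn_coordSec : ContMDiffOn 𝓘(ℝ, E) 𝓘(ℝ, F) ∞ R.coordSec R.coordDom :=
  R.smooth_sec.comp ((contMDiffOn_chartSymm o).mono inter_subset_left) fun _ hy => hy.2

theorem contDiffOn_potential [FiniteDimensional ℝ F] :
    ContDiffOn ℝ ∞ R.potential R.coordDom :=
  contDiffOn_pullbackForm R.isOpen_coordDom R.contMDiffOn_coordSec B.connection.smooth

theorem vecPart_apply (y : E) (c : Fin (Module.finrank ℝ E) → ℝ) :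
    R.vecPart y c = chartDeriv E o _ (R.comb ((extChartAt 𝓘(ℝ, E) o).symm y) c :
      GenTangent E ((extChartAt 𝓘(ℝ, E) o).symm y)).1 := by
  simp only [vecPart, combine_apply, comb, Fintype.linearCombination_apply, Submodule.coe_sum,
    Submodule.coe_smul, Prod.fst_sum, Prod.smul_fst, map_sum, map_smul]
  rfl

theorem formPart_apply (y : E) (c : Fin (Module.finrank ℝ E) → ℝ) (v : E) :
    R.formPart y c v
      = (R.comb ((extChartAt 𝓘(ℝ, E) o).symm y) c :
        GenTangent E ((extChartAt 𝓘(ℝ, E) o).symm y)).2 (chartSymmDeriv o y v) := by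
  simp only [formPart, combine_apply, comb, Fintype.linearCombination_apply, Submodule.coe_sum,
    Submodule.coe_smul, Prod.snd_sum, Prod.smul_snd, _root_.sum_apply,
    smul_apply, formInChart_apply]

theorem betaPart_apply (y : E) (c : Fin (Module.finrank ℝ E) → ℝ) :
    R.betaPart y c = B.β _ (R.comb ((extChartAt 𝓘(ℝ, E) o).symm y) c) := by
  simp only [betaPart, combine_apply, comb, Fintype.linearCombination_apply, map_sum, map_smul]

/-- The section of `L` with given components. -/
def lift (c : E → Fin (Module.finrank ℝ E) → ℝ) (p : P) : L.fiber p :=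
  R.comb p (c (extChartAt 𝓘(ℝ, E) o p))

theorem exists_coord {p : P} {O : Set E} (hp : p ∈ (extChartAt 𝓘(ℝ, E) o).source)
    (hpO : extChartAt 𝓘(ℝ, E) o p ∈ O) : ∃ y ∈ O, y ∈ (extChartAt 𝓘(ℝ, E) o).target ∧
      (extChartAt 𝓘(ℝ, E) o).symm y = p :=
  ⟨_, hpO, (extChartAt 𝓘(ℝ, E) o).map_source hp, (extChartAt 𝓘(ℝ, E) o).left_inv hp⟩

theorem lift_fst (c : E → Fin (Module.finrank ℝ E) → ℝ) {p : P}
    (hp : p ∈ (extChartAt 𝓘(ℝ, E) o).source) :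
    (R.lift c p : GenTangent E p).1 = fieldOfCoord o (fun y => R.vecPart y (c y)) p := by
  obtain ⟨y, -, hy, rfl⟩ := exists_coord hp (mem_univ _)
  rw [fieldOfCoord_chartSymm hy, vecPart_apply, chartSymmDeriv_chartDeriv hy, lift,
    (extChartAt 𝓘(ℝ, E) o).right_inv hy]

theorem smoothVectorOn_lift {c : E → Fin (Module.finrank ℝ E) → ℝ} {O : Set E} (hO : IsOpen O)
    (hOR : O ⊆ R.coordDom) (hc : ContDiffOn ℝ ∞ c O) :
    SmoothVectorOn (fun p => (R.lift c p : GenTangent E p).1)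
      ((extChartAt 𝓘(ℝ, E) o).source ∩ extChartAt 𝓘(ℝ, E) o ⁻¹' O) :=
  ContMDiffOn.congr (smoothVectorOn_fieldOfCoord o hO
    ((R.contDiffOn_vecPart.mono hOR).clm_apply hc)) fun p hp => by simp only [R.lift_fst c hp.1]

theorem lift_snd_eq_zero (c : E → Fin (Module.finrank ℝ E) → ℝ) {p : P}
    (hp : p ∈ (extChartAt 𝓘(ℝ, E) o).source)
    (h : R.formPart (extChartAt 𝓘(ℝ, E) o p) (c (extChartAt 𝓘(ℝ, E) o p)) = 0) :
    (R.lift c p : GenTangent E p).2 = 0 := by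
  obtain ⟨y, -, hy, rfl⟩ := exists_coord hp (mem_univ _)
  rw [lift]
  rw [(extChartAt 𝓘(ℝ, E) o).right_inv hy] at h ⊢
  ext w
  have := congrArg (fun T : E →L[ℝ] ℝ => T (chartDeriv E o _ w)) h
  simp only [formPart_apply, chartSymmDeriv_chartDeriv hy] at this
  exact this

/-- An element of `L` is determined by its two parts. On the kernel of the covector part this makes
`vecPart` injective, as `exists_kernel_frame` requires. -/
theorem eq_zero_of_parts {y : E} (hy : y ∈ R.coordDom) {c : Fin (Module.finrank ℝ E) → ℝ}
    (h1 : R.formPart y c = 0) (h2 : R.vecPart y c = 0) : c = 0 := by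
  refine (R.bijective _ hy.2).1 ?_
  change R.comb _ c = R.comb _ 0
  rw [map_zero]
  refine Subtype.ext (Prod.ext ?_ ?_)
  · rw [vecPart_apply] at h2
    have h3 := chartSymmDeriv_chartDeriv hy.1
      (R.comb ((extChartAt 𝓘(ℝ, E) o).symm y) c : GenTangent E ((extChartAt 𝓘(ℝ, E) o).symm y)).1
    rw [h2, map_zero] at h3
    exact h3.symm
  · ext w
    have := congrArg (fun T : E →L[ℝ] ℝ => T (chartDeriv E o _ w)) h1
    simp only [formPart_apply, chartSymmDeriv_chartDeriv hy.1] at this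
    exact this

/-- The components of an element of `L`. -/
theorem exists_comb_eq {y : E} (hy : y ∈ R.coordDom)
    (x : L.fiber ((extChartAt 𝓘(ℝ, E) o).symm y)) : ∃ c, R.comb _ c = x :=
  (R.bijective _ hy.2).2 x

end LocalFrame

end LocalFrame

/-! ### Involutivity of the kernel of a Dirac structure -/

namespace LocalFrame

variable {E : Type*} [NormedAddCommGroup E] [NormedSpace ℝ E]
  {P : Type*} [TopologicalSpace P] [ChartedSpace E P] [IsManifold 𝓘(ℝ, E) ∞ P]
  {L : DiracStructure E P}
  {F : Type*} [NormedAddCommGroup F] [NormedSpace ℝ F]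
  {Q : Type*} [TopologicalSpace Q] [ChartedSpace F Q] [IsManifold 𝓘(ℝ, F) ∞ Q]
  [MulAction Circle Q] {B : Prequantization L F Q} {o : P} (R : LocalFrame B o)

theorem proj_coordSec {y : E} (hy : y ∈ R.coordDom) :
    B.proj (R.coordSec y) = (extChartAt 𝓘(ℝ, E) o).symm y := R.proj_sec _ hy.2

theorem dproj_mfderiv_coordSec {y : E} (hy : y ∈ R.coordDom) (v : E) :
    B.dproj (R.coordSec y) (mfderiv 𝓘(ℝ, E) 𝓘(ℝ, F) R.coordSec y v) = chartSymmDeriv o y v := by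
  have h1 := ((R.contMDiffOn_coordSec.contMDiffAt
    (R.isOpen_coordDom.mem_nhds hy)).mdifferentiableAt (by simp)).hasMFDerivAt
  have h2 := (B.hasMFDerivAt_proj (R.coordSec y)).comp y h1
  have h3 : B.proj ∘ R.coordSec =ᶠ[𝓝 y] (extChartAt 𝓘(ℝ, E) o).symm := by
    filter_upwards [R.isOpen_coordDom.mem_nhds hy] with y' hy' using R.proj_coordSec hy'
  have h4 := (h2.congr_of_eventuallyEq h3.symm).mfderiv
  exact (congrArg (fun T : E →L[ℝ] E => T v) h4).symm

/-- The potential is the pullback of `σ` by the section, `dσ = π^*Ω`, and the section followed by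
`π` is the inverse chart. -/
theorem extDeriv_potential [FiniteDimensional ℝ F] {y : E} (hy : y ∈ R.coordDom) (v w : E) :
    fderiv ℝ R.potential y v w - fderiv ℝ R.potential y w v
      = B.Ω ((extChartAt 𝓘(ℝ, E) o).symm y) (chartSymmDeriv o y v) (chartSymmDeriv o y w) := by
  have h := extDeriv_pullbackForm R.isOpen_coordDom R.contMDiffOn_coordSec B.connection.smooth hy
    v w
  refine h.trans ((B.curvature _ _ _).trans ?_)
  have h1 : ∀ p p' : P, p' = p → ∀ a b : E, (B.Ω p' : E →L[ℝ] E →L[ℝ] ℝ) a b = B.Ω p a b := by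
    rintro p _ rfl a b
    rfl
  refine (h1 _ _ (R.proj_coordSec hy) _ _).trans ?_
  have h2 := R.dproj_mfderiv_coordSec hy
  exact congrArg₂ (fun a b : E => (B.Ω ((extChartAt 𝓘(ℝ, E) o).symm y) : E →L[ℝ] E →L[ℝ] ℝ) a b)
    (h2 v) (h2 w)

variable {K : Type*} [NormedAddCommGroup K] [NormedSpace ℝ K]
  (a : E → K →L[ℝ] Fin (Module.finrank ℝ E) → ℝ)

/-- The vector parts of a family of sections of `L`. -/
def anchor (x : E) : K →L[ℝ] E := (R.vecPart x).comp (a x)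

/-- The difference between the local connection potential and `β` on a family of sections of
`L`. -/
def weight (x : E) : K →L[ℝ] ℝ :=
  (R.potential x).comp (R.anchor a x) - (R.betaPart x).comp (a x)

variable {a} {O : Set E}

theorem contDiffOn_anchor (hOR : O ⊆ R.coordDom) (ha : ContDiffOn ℝ ∞ a O) :
    ContDiffOn ℝ ∞ (R.anchor a) O := (R.contDiffOn_vecPart.mono hOR).clm_comp ha

theorem contDiffOn_weight [FiniteDimensional ℝ F] (hOR : O ⊆ R.coordDom)
    (ha : ContDiffOn ℝ ∞ a O) : ContDiffOn ℝ ∞ (R.weight a) O :=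
  ((R.contDiffOn_potential.mono hOR).clm_comp (R.contDiffOn_anchor hOR ha)).sub
    ((R.contDiffOn_betaPart.mono hOR).clm_comp ha)

theorem smoothSectionOn_lift (hO : IsOpen O) (hOR : O ⊆ R.coordDom) (ha : ContDiffOn ℝ ∞ a O)
    (hker : ∀ x ∈ O, ∀ v, R.formPart x (a x v) = 0) (v : K) :
    L.SmoothSectionOn (R.lift fun y => a y v)
      ((extChartAt 𝓘(ℝ, E) o).source ∩ extChartAt 𝓘(ℝ, E) o ⁻¹' O) := by
  refine ⟨R.smoothVectorOn_lift hO hOR (ha.clm_apply contDiffOn_const),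
    ContMDiffOn.congr (smoothFormOn_zero _) fun p hp => ?_⟩
  simp only [R.lift_snd_eq_zero (fun y => a y v) hp.1 (hker _ hp.2 v)]

theorem isOpen_source_inter (hO : IsOpen O) :
    IsOpen ((extChartAt 𝓘(ℝ, E) o).source ∩ extChartAt 𝓘(ℝ, E) o ⁻¹' O) :=
  (continuousOn_extChartAt o).isOpen_inter_preimage (isOpen_extChartAt_source o) hO

theorem symm_mem_source_inter (hOR : O ⊆ R.coordDom) {x : E} (hx : x ∈ O) :
    (extChartAt 𝓘(ℝ, E) o).symm x
      ∈ (extChartAt 𝓘(ℝ, E) o).source ∩ extChartAt 𝓘(ℝ, E) o ⁻¹' O := by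
  refine ⟨(extChartAt 𝓘(ℝ, E) o).map_target (hOR hx).1, ?_⟩
  rw [mem_preimage, (extChartAt 𝓘(ℝ, E) o).right_inv (hOR hx).1]
  exact hx

theorem lift_fst_symm (c : E → Fin (Module.finrank ℝ E) → ℝ) {x : E} (hx : x ∈ R.coordDom) :
    (R.lift c ((extChartAt 𝓘(ℝ, E) o).symm x) : GenTangent E ((extChartAt 𝓘(ℝ, E) o).symm x)).1
      = chartSymmDeriv o x (R.vecPart x (c x)) := by
  rw [R.lift_fst c ((extChartAt 𝓘(ℝ, E) o).map_target hx.1), fieldOfCoord_chartSymm hx.1]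

variable [FiniteDimensional ℝ E]

/-- The sections of `L ∩ TP` of a local frame with constant coordinates have vanishing bracket. -/
theorem bracket_eq_zero (hO : IsOpen O) (hOR : O ⊆ R.coordDom) (ha : ContDiffOn ℝ ∞ a O)
    (hker : ∀ x ∈ O, ∀ v, R.formPart x (a x v) = 0) (p : E →L[ℝ] K)
    (hp : ∀ x ∈ O, ∀ v, p (R.vecPart x (a x v)) = v)
    (hker' : ∀ x ∈ O, ∀ c, R.formPart x c = 0 → ∃ v, c = a x v) {x : E} (hx : x ∈ O) (v w : K) :
    fderiv ℝ (R.anchor a) x (R.anchor a x v) w = fderiv ℝ (R.anchor a) x (R.anchor a x w) v ∧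
    courantBracket (fun q => (R.lift (fun y => a y v) q : GenTangent E q))
      (fun q => (R.lift (fun y => a y w) q : GenTangent E q)) ((extChartAt 𝓘(ℝ, E) o).symm x)
      = 0 := by
  set D := (extChartAt 𝓘(ℝ, E) o).source ∩ extChartAt 𝓘(ℝ, E) o ⁻¹' O with hD
  have hDo : IsOpen D := isOpen_source_inter hO
  have hxD := R.symm_mem_source_inter hOR hx
  have hs := R.smoothSectionOn_lift hO hOR ha hker
  have hxt := (hOR hx).1
  have hBd : ContDiffAt ℝ ∞ (R.anchor a) x :=
    (R.contDiffOn_anchor hOR ha).contDiffAt (hO.mem_nhds hx)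
  have hBd' := hBd.differentiableAt (by simp)
  have hBv : ∀ v, ContDiffAt ℝ ∞ (fun y => R.anchor a y v) x := fun v =>
    hBd.clm_apply contDiffAt_const
  set ℓ := VectorField.lieBracket ℝ (fun y => R.anchor a y v) (fun y => R.anchor a y w) x with hℓ
  have hform : ∀ v, ∀ᶠ q in 𝓝 ((extChartAt 𝓘(ℝ, E) o).symm x),
      (R.lift (fun y => a y v) q : GenTangent E q).2 = 0 := fun v => by
    filter_upwards [hDo.mem_nhds hxD] with q hq
    exact R.lift_snd_eq_zero (fun y => a y v) hq.1 (hker _ hq.2 v)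
  have hvec : ∀ v, (fun q => (R.lift (fun y => a y v) q : GenTangent E q).1)
      =ᶠ[𝓝 ((extChartAt 𝓘(ℝ, E) o).symm x)] fieldOfCoord o (fun y => R.anchor a y v) := fun v => by
    filter_upwards [hDo.mem_nhds hxD] with q hq
    exact R.lift_fst (fun y => a y v) hq.1
  have hbr : courantBracket (fun q => (R.lift (fun y => a y v) q : GenTangent E q))
      (fun q => (R.lift (fun y => a y w) q : GenTangent E q)) ((extChartAt 𝓘(ℝ, E) o).symm x)
      = (chartSymmDeriv o x ℓ, 0) := by
    rw [courantBracket_of_eventually_eq_zero (hform v) (hform w),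
      (hvec v).mlieBracket_vectorField_eq (hvec w), mlieBracket_fieldOfCoord hxD.1,
      fieldOfCoord_chartSymm hxt]
    · rw [(extChartAt 𝓘(ℝ, E) o).right_inv hxt]; exact hBv v
    · rw [(extChartAt 𝓘(ℝ, E) o).right_inv hxt]; exact hBv w
  -- The bracket `ℓ` is again a vector of `L ∩ TP`, hence equals `anchor u` for some `u`, and `p
  -- (anchor u) = u`. But `p` is constant on the frame fields, so it kills their bracket; therefore
  -- `u = 0`.
  have hmem := L.courant_mem D hDo _ _ (hs v) (hs w) _ hxD
  rw [hbr] at hmem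
  obtain ⟨c, hc⟩ := R.exists_comb_eq (hOR hx) ⟨_, hmem⟩
  have hc1 : R.vecPart x c = ℓ := by
    rw [vecPart_apply, hc]
    exact chartDeriv_chartSymmDeriv hxt ℓ
  have hc2 : R.formPart x c = 0 := by
    ext z
    rw [formPart_apply, hc]
    rfl
  obtain ⟨u, rfl⟩ := hker' x hx c hc2
  have hconst : ∀ v z, p (fderiv ℝ (R.anchor a) x z v) = 0 := by
    intro v z
    have h1 : (fun y => p (R.anchor a y v)) =ᶠ[𝓝 x] fun _ => v := by
      filter_upwards [hO.mem_nhds hx] with y hy using hp y hy v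
    have h2 : HasFDerivAt (fun y => p (R.anchor a y v))
        (p.comp (fderiv ℝ (fun y => R.anchor a y v) x)) x :=
      p.hasFDerivAt.comp x ((hBv v).differentiableAt (by simp)).hasFDerivAt
    have h3 := h2.fderiv
    rw [h1.fderiv_eq, fderiv_const_apply] at h3
    rw [← fderiv_clm_apply_const hBd' z v]
    exact (congrArg (fun T : E →L[ℝ] K => T z) h3).symm
  have hℓ' : ℓ = fderiv ℝ (R.anchor a) x (R.anchor a x v) w
      - fderiv ℝ (R.anchor a) x (R.anchor a x w) v := by
    rw [hℓ, VectorField.lieBracket, fderiv_clm_apply_const hBd', fderiv_clm_apply_const hBd']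
  have hu : u = 0 := by
    rw [← hp x hx u, hc1, hℓ', map_sub, hconst, hconst, sub_zero]
  have h0 : ℓ = 0 := by rw [← hc1, hu, map_zero, map_zero]
  refine ⟨sub_eq_zero.1 (hℓ'.symm.trans h0), ?_⟩
  rw [hbr, h0, map_zero]
  rfl

/-- Differentiating the weight produces three kinds of terms: derivatives of the potential, whose
antisymmetrization is `Ω`; derivatives of the frame fields, which cancel by commutation; and
derivatives of `β` on the frame. For sections with zero covector part and zero bracket, the
prequantization condition equates `Ω` with the antisymmetrized derivatives of `β`. -/
theorem weight_closed [FiniteDimensional ℝ F] (hO : IsOpen O) (hOR : O ⊆ R.coordDom)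
    (ha : ContDiffOn ℝ ∞ a O)
    (hker : ∀ x ∈ O, ∀ v, R.formPart x (a x v) = 0) (p : E →L[ℝ] K)
    (hp : ∀ x ∈ O, ∀ v, p (R.vecPart x (a x v)) = v)
    (hker' : ∀ x ∈ O, ∀ c, R.formPart x c = 0 → ∃ v, c = a x v) {x : E} (hx : x ∈ O) (v w : K) :
    fderiv ℝ (R.weight a) x (R.anchor a x v) w = fderiv ℝ (R.weight a) x (R.anchor a x w) v := by
  obtain ⟨hB, hbr⟩ := R.bracket_eq_zero hO hOR ha hker p hp hker' hx v w
  have hDo : IsOpen ((extChartAt 𝓘(ℝ, E) o).source ∩ extChartAt 𝓘(ℝ, E) o ⁻¹' O) :=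
    isOpen_source_inter hO
  have hxD := R.symm_mem_source_inter hOR hx
  have hs := R.smoothSectionOn_lift hO hOR ha hker
  have hxt := (hOR hx).1
  have hτd : DifferentiableAt ℝ R.potential x :=
    (R.contDiffOn_potential.contDiffAt (R.isOpen_coordDom.mem_nhds (hOR hx))).differentiableAt
      (by simp)
  have hBd : DifferentiableAt ℝ (R.anchor a) x :=
    ((R.contDiffOn_anchor hOR ha).contDiffAt (hO.mem_nhds hx)).differentiableAt (by simp)
  have had : DifferentiableAt ℝ a x := (ha.contDiffAt (hO.mem_nhds hx)).differentiableAt (by simp)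
  have hbd : DifferentiableAt ℝ R.betaPart x :=
    (R.contDiffOn_betaPart.contDiffAt (R.isOpen_coordDom.mem_nhds (hOR hx))).differentiableAt
      (by simp)
  have hγd : DifferentiableAt ℝ (R.weight a) x :=
    ((R.contDiffOn_weight hOR ha).contDiffAt (hO.mem_nhds hx)).differentiableAt (by simp)
  have hβ : ∀ w z, fderiv ℝ (fun y => R.betaPart y (a y w)) x z
      = differential (fun q => B.β q (R.lift (fun y => a y w) q)) ((extChartAt 𝓘(ℝ, E) o).symm x)
        (chartSymmDeriv o x z) := by
    intro w z
    have h1 : (fun y => R.betaPart y (a y w)) =ᶠ[𝓝 x]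
        (fun q => B.β q (R.lift (fun y => a y w) q)) ∘ (extChartAt 𝓘(ℝ, E) o).symm := by
      filter_upwards [(isOpen_extChartAt_target (I := 𝓘(ℝ, E)) o).mem_nhds hxt] with y hy
      rw [betaPart_apply, Function.comp_apply, lift, (extChartAt 𝓘(ℝ, E) o).right_inv hy]
    rw [h1.fderiv_eq]
    exact fderiv_comp_chartSymm hxt (((B.smooth_β _ hDo _ (hs w)).contMDiffAt
      (hDo.mem_nhds hxD)).mdifferentiableAt (by simp)) z
  have key : ∀ w z, fderiv ℝ (R.weight a) x z w = fderiv ℝ R.potential x z (R.anchor a x w)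
      + R.potential x (fderiv ℝ (R.anchor a) x z w)
      - differential (fun q => B.β q (R.lift (fun y => a y w) q))
        ((extChartAt 𝓘(ℝ, E) o).symm x) (chartSymmDeriv o x z) := by
    intro w z
    have hBw : DifferentiableAt ℝ (fun y => R.anchor a y w) x :=
      hBd.clm_apply (differentiableAt_const w)
    have haw : DifferentiableAt ℝ (fun y => a y w) x := had.clm_apply (differentiableAt_const w)
    rw [← fderiv_clm_apply_const hγd, ← hβ]
    have h1 : (fun y => R.weight a y w)
        = (fun y => R.potential y (R.anchor a y w)) - fun y => R.betaPart y (a y w) := rfl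
    rw [h1, fderiv_sub (hτd.clm_apply hBw) (hbd.clm_apply haw), fderiv_clm_apply hτd hBw,
      ← fderiv_clm_apply_const hBd]
    simp [add_comm]
  have hbr0 : L.bracket hDo (hs v) (hs w) hxD = 0 := Subtype.ext hbr
  have hpre := B.prequantization_condition _ hDo _ _ (hs v) (hs w) _ hxD
  have hform : ∀ v, (R.lift (fun y => a y v) ((extChartAt 𝓘(ℝ, E) o).symm x) :
      GenTangent E ((extChartAt 𝓘(ℝ, E) o).symm x)).2 = 0 := fun v =>
    R.lift_snd_eq_zero (fun y => a y v) hxD.1 (hker _ hxD.2 v)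
  rw [DiracStructure.dL, hbr0, map_zero, sub_zero, pairMinus, hform, hform,
    R.lift_fst_symm _ (hOR hx), R.lift_fst_symm _ (hOR hx)] at hpre
  have hΩ := R.extDeriv_potential (hOR hx) (R.anchor a x v) (R.anchor a x w)
  have hpre' : B.Ω ((extChartAt 𝓘(ℝ, E) o).symm x) (chartSymmDeriv o x (R.anchor a x v))
      (chartSymmDeriv o x (R.anchor a x w)) = 0 + (differential
        (fun q => B.β q (R.lift (fun y => a y w) q)) ((extChartAt 𝓘(ℝ, E) o).symm x)
          (chartSymmDeriv o x (R.anchor a x v)) - differential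
        (fun q => B.β q (R.lift (fun y => a y v) q)) ((extChartAt 𝓘(ℝ, E) o).symm x)
          (chartSymmDeriv o x (R.anchor a x w))) := by
    exact hpre.trans (congrArg (· + _)
      ((congrArg (1 / 2 * ·) (sub_self (0 : ℝ))).trans (mul_zero _)))
  rw [key, key, hB]
  linear_combination hΩ + hpre'

end LocalFrame

/-! ### The differential of an angular coordinate -/

section Angle

variable {F : Type*} [NormedAddCommGroup F] [NormedSpace ℝ F]
  {Q : Type*} [TopologicalSpace Q] [ChartedSpace F Q]

theorem contMDiffOn_coe_circle {ζ : Q → Circle} {U : Set Q}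
    (hζ : ContMDiffOn 𝓘(ℝ, F) (𝓡 1) ∞ ζ U) :
    ContMDiffOn 𝓘(ℝ, F) 𝓘(ℝ, ℂ) ∞ (fun q => (ζ q : ℂ)) U :=
  have : Fact (Module.finrank ℝ ℂ = 1 + 1) := ⟨Complex.finrank_real_complex⟩
  (contMDiff_coe_sphere (n := 1) (E := ℂ)).comp_contMDiffOn hζ

/-- A circle-valued function has a differentiable logarithm near each point. -/
theorem exists_local_angle {ζ : Q → Circle} {q : Q}
    (hζ : MDifferentiableAt 𝓘(ℝ, F) 𝓘(ℝ, ℂ) (fun q => (ζ q : ℂ)) q) :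
    ∃ θ : Q → ℝ, MDifferentiableAt 𝓘(ℝ, F) 𝓘(ℝ, ℝ) θ q ∧ θ q = 0 ∧
      ∀ᶠ q' in 𝓝 q, ζ q' = Circle.exp (2 * Real.pi * θ q') * ζ q := by
  have h1 : (ζ q : ℂ) / (ζ q : ℂ) = 1 := div_self (Circle.coe_ne_zero _)
  -- Dividing by the value at `q` moves the argument of the principal logarithm to `1`, inside the
  -- slit plane, so `g` is differentiable at `ζ q` whatever that value is.
  let g : ℂ → ℝ := fun z => (Complex.log (z / ζ q)).im / (2 * Real.pi)
  have hg : DifferentiableAt ℝ g (ζ q) := by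
    have h2 : DifferentiableAt ℂ (fun z : ℂ => Complex.log (z / ζ q)) (ζ q) := by
      refine DifferentiableAt.clog (differentiableAt_id.div_const _) ?_
      simp only [h1]
      exact Complex.one_mem_slitPlane
    have h3 : DifferentiableAt ℝ (fun z : ℂ => (Complex.log (z / ζ q)).im) (ζ q) :=
      Complex.imCLM.differentiableAt.comp _ (h2.restrictScalars ℝ)
    simpa only [g, div_eq_mul_inv] using h3.mul_const (2 * Real.pi)⁻¹
  refine ⟨fun q' => g (ζ q'), hg.mdifferentiableAt.comp q hζ, by simp [g], ?_⟩
  filter_upwards with q'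
  refine Circle.ext ?_
  have hpi : (2 * Real.pi : ℝ) ≠ 0 := by positivity
  rw [Circle.coe_mul, Circle.coe_exp]
  simp only [g]
  rw [mul_div_cancel₀ _ hpi]
  have hne : (ζ q' : ℂ) / ζ q ≠ 0 := div_ne_zero (Circle.coe_ne_zero _) (Circle.coe_ne_zero _)
  have h3 : (Complex.log ((ζ q' : ℂ) / ζ q)).re = 0 := by
    rw [Complex.log_re, norm_div, Circle.norm_coe, Circle.norm_coe, div_one, Real.log_one]
  have h4 : ((Complex.log ((ζ q' : ℂ) / ζ q)).im : ℂ) * Complex.I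
      = Complex.log ((ζ q' : ℂ) / ζ q) := by
    apply Complex.ext <;> simp [h3]
  rw [h4, Complex.exp_log hne, div_mul_cancel₀ _ (Circle.coe_ne_zero _)]

variable [IsManifold 𝓘(ℝ, F) ∞ Q] [MulAction Circle Q]

/-- The differential of the action. -/
theorem mfderiv_exp_smul (hact : ContMDiffSMul (𝓡 1) 𝓘(ℝ, F) ∞ Circle Q) (q : Q) {θ : Q → ℝ}
    {g : Q → Q} (hθ : MDifferentiableAt 𝓘(ℝ, F) 𝓘(ℝ, ℝ) θ q)
    (hg : MDifferentiableAt 𝓘(ℝ, F) 𝓘(ℝ, F) g q) (hθq : θ q = 0) (hgq : g q = q)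
    {T S : F →L[ℝ] F}
    (hT : T = mfderiv 𝓘(ℝ, F) 𝓘(ℝ, F) (fun q' => Circle.exp (2 * Real.pi * θ q') • g q') q)
    (hS : S = mfderiv 𝓘(ℝ, F) 𝓘(ℝ, F) g q) {e : F} (he : e = generator q) (v : F) :
    T v = differential (E := F) θ q v • e + S v := by
  subst hT hS
  let f : ℝ × Q → Q := fun x => Circle.exp (2 * Real.pi * x.1) • x.2
  have hf : ContMDiff (𝓘(ℝ, ℝ).prod 𝓘(ℝ, F)) 𝓘(ℝ, F) ∞ f := by
    have h1 : ContMDiff (𝓘(ℝ, ℝ).prod 𝓘(ℝ, F)) 𝓘(ℝ, ℝ) ∞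
        (fun x : ℝ × Q => 2 * Real.pi * x.1) := by
      have : ContMDiff 𝓘(ℝ, ℝ) 𝓘(ℝ, ℝ) ∞ (fun t : ℝ => 2 * Real.pi * t) :=
        (contDiff_const.mul contDiff_id).contMDiff
      exact this.comp contMDiff_fst
    exact hact.contMDiff_smul.comp ((contMDiff_circleExp.comp h1).prodMk contMDiff_snd)
  have hfd : ∀ x, MDifferentiableAt (𝓘(ℝ, ℝ).prod 𝓘(ℝ, F)) 𝓘(ℝ, F) f x :=
    hf.mdifferentiable (by simp)
  have hc := mfderiv_comp q (hfd (θ q, g q)) (hθ.prodMk hg)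
  have hc' := congrArg (fun T : F →L[ℝ] F => T v) hc
  refine hc'.trans ?_
  have hp := mfderiv_prod_eq_add_apply (v := (mfderiv 𝓘(ℝ, F) (𝓘(ℝ, ℝ).prod 𝓘(ℝ, F))
    (fun q' => (θ q', g q')) q v : ℝ × F)) (hfd (θ q, g q))
  refine Eq.trans hp ?_
  have hpr := mfderiv_prodMk hθ hg
  have hpr' := congrArg (fun T : F →L[ℝ] ℝ × F => T v) hpr
  have e1 : (mfderiv 𝓘(ℝ, F) (𝓘(ℝ, ℝ).prod 𝓘(ℝ, F))
    (fun q' => (θ q', g q')) q v : ℝ × F) = (differential θ q v,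
      (mfderiv 𝓘(ℝ, F) 𝓘(ℝ, F) g q v : F)) := hpr'
  -- The partial derivatives of the action at `(0, q)` are the generator and the identity. The base
  -- points are kept variable because `θ q = 0` and `g q = q` are not definitional equalities.
  have e2 : ∀ (t₀ : ℝ) (q₀ : Q) (t : ℝ), t₀ = 0 → q₀ = q →
      (mfderiv 𝓘(ℝ, ℝ) 𝓘(ℝ, F) (fun z => f (z, q₀)) t₀ : ℝ →L[ℝ] F) t = t • e := by
    rw [he]
    rintro t₀ q₀ t rfl rfl
    have hlin : ∀ T : ℝ →L[ℝ] F, T t = t • T 1 := fun T => by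
      rw [← map_smul, smul_eq_mul, mul_one]
    exact hlin _
  have e3 : ∀ (t₀ : ℝ) (q₀ : Q) (w : F), t₀ = 0 →
      (mfderiv 𝓘(ℝ, F) 𝓘(ℝ, F) (fun z => f (t₀, z)) q₀ : F →L[ℝ] F) w = w := by
    rintro t₀ q₀ w rfl
    have : (fun z => f (0, z)) = id := by
      funext z
      simp [f]
    rw [this, mfderiv_id]
    rfl
  have h1 := e2 (θ q) (g q) (differential θ q v) hθq hgq
  have h2 := e3 (θ q) (g q) (mfderiv 𝓘(ℝ, F) 𝓘(ℝ, F) g q v : F) hθq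
  refine Eq.trans ?_ (congrArg₂ (fun a b : F => a + b) h1 h2)
  exact congrArg (fun x : ℝ × F =>
    (mfderiv 𝓘(ℝ, ℝ) 𝓘(ℝ, F) (fun z => f (z, g q)) (θ q) : ℝ →L[ℝ] F) x.1
      + (mfderiv 𝓘(ℝ, F) 𝓘(ℝ, F) (fun z => f (θ q, z)) (g q) : F →L[ℝ] F) x.2) e1

end Angle

/-! ### Functions of weight `n` on `Q` and their derivatives -/

namespace LocalFrame

variable {E : Type*} [NormedAddCommGroup E] [NormedSpace ℝ E]
  {P : Type*} [TopologicalSpace P] [ChartedSpace E P] [IsManifold 𝓘(ℝ, E) ∞ P]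
  {L : DiracStructure E P}
  {F : Type*} [NormedAddCommGroup F] [NormedSpace ℝ F]
  {Q : Type*} [TopologicalSpace Q] [ChartedSpace F Q] [IsManifold 𝓘(ℝ, F) ∞ Q]
  [MulAction Circle Q] {B : Prequantization L F Q} {o : P} (R : LocalFrame B o)

theorem isOpen_preimage_dom : IsOpen (B.proj ⁻¹' R.dom) :=
  R.isOpen_dom.preimage B.principal.smooth_proj.continuous

theorem potential_chartDeriv {p : P} (hp : p ∈ R.dom) (w : TangentSpace 𝓘(ℝ, E) p) :
    R.potential (extChartAt 𝓘(ℝ, E) o p) (chartDeriv E o p w)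
      = B.σ (R.sec p) (mfderiv 𝓘(ℝ, E) 𝓘(ℝ, F) R.sec p w) := by
  obtain ⟨y, -, hy, rfl⟩ := exists_coord (R.dom_subset hp) (mem_univ _)
  rw [(extChartAt 𝓘(ℝ, E) o).right_inv hy, potential, pullbackForm_apply]
  have h1 := ((R.smooth_sec.contMDiffAt (R.isOpen_dom.mem_nhds hp)).mdifferentiableAt
    (by simp)).hasMFDerivAt
  have h2 := (h1.comp y (hasMFDerivAt_chartSymm hy)).mfderiv
  have h3 := congrArg (fun T : E →L[ℝ] F => T (chartDeriv E o _ w)) h2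
  refine (congrArg (B.σ (R.coordSec y) : F →L[ℝ] ℝ) h3).trans ?_
  exact congrArg (fun z : E => (B.σ (R.coordSec y) : F →L[ℝ] ℝ)
    ((mfderiv 𝓘(ℝ, E) 𝓘(ℝ, F) R.sec ((extChartAt 𝓘(ℝ, E) o).symm y) : E →L[ℝ] F) z))
    (chartSymmDeriv_chartDeriv hy w)

/-- The connection form, in terms of the angular coordinate and the potential. -/
theorem exists_angle {q : Q} (hq : B.proj q ∈ R.dom) :
    ∃ θ : Q → ℝ, MDifferentiableAt 𝓘(ℝ, F) 𝓘(ℝ, ℝ) θ q ∧ θ q = 0 ∧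
      (∀ᶠ q' in 𝓝 q, R.angle q' = Circle.exp (2 * Real.pi * θ q') * R.angle q) ∧
      (∀ v, differential θ q v = B.σ q v
        - R.potential (extChartAt 𝓘(ℝ, E) o (B.proj q)) (chartDeriv E o _ (B.dproj q v))) ∧
      ∀ v, B.dproj q v = 0 → v = differential θ q v • generator q := by
  have hnhds := R.isOpen_preimage_dom.mem_nhds hq
  obtain ⟨θ, hθ, hθq, hev⟩ := exists_local_angle (((contMDiffOn_coe_circle
    R.smooth_angle).contMDiffAt hnhds).mdifferentiableAt (by simp))
  -- Near `q` every point is `exp(2πiθ) • g`, so `v = dθ(v) E + dg(v)`. Applying `σ`, which is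
  -- invariant under the rotation in `g`, gives `σ = dθ + π^*τ`; on vertical vectors `dg` vanishes.
  let g : Q → Q := fun q' => R.angle q • R.sec (B.proj q')
  have hgq : g q = q := R.angle_smul q hq
  have hsd : HasMFDerivAt 𝓘(ℝ, E) 𝓘(ℝ, F) R.sec (B.proj q)
      (mfderiv 𝓘(ℝ, E) 𝓘(ℝ, F) R.sec (B.proj q)) :=
    ((R.smooth_sec.contMDiffAt (R.isOpen_dom.mem_nhds hq)).mdifferentiableAt
      (by simp)).hasMFDerivAt
  have hsm := ((B.principal.contMDiff_smul_const (R.angle q)).mdifferentiable (by simp)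
    (R.sec (B.proj q))).hasMFDerivAt
  have hgd := hsm.comp q (hsd.comp q (B.hasMFDerivAt_proj q))
  have hid : (fun q' => Circle.exp (2 * Real.pi * θ q') • g q') =ᶠ[𝓝 q] id := by
    filter_upwards [hev, hnhds] with q' h1 h2
    rw [id]
    conv_rhs => rw [← R.angle_smul q' h2, h1, mul_smul]
  have h := mfderiv_exp_smul B.principal.smooth_action q hθ hgd.mdifferentiableAt hθq hgq rfl
    rfl rfl
  have h0 : ∀ v, (mfderiv 𝓘(ℝ, F) 𝓘(ℝ, F) (fun q' => Circle.exp (2 * Real.pi * θ q') • g q') q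
      : F →L[ℝ] F) v = v := fun v => by
    rw [hid.mfderiv_eq, mfderiv_id]
    rfl
  refine ⟨θ, hθ, hθq, hev, fun v => ?_, fun v hv => ?_⟩
  rotate_left
  · have h1 := hgd.mfderiv
    have h2 := congrArg (fun T : F →L[ℝ] F => T v) h1
    have h3 : (mfderiv 𝓘(ℝ, E) 𝓘(ℝ, F) R.sec (B.proj q) : E →L[ℝ] F) (B.dproj q v) = 0 := by
      rw [hv]
      exact map_zero (mfderiv 𝓘(ℝ, E) 𝓘(ℝ, F) R.sec (B.proj q) : E →L[ℝ] F)
    have h4 := h2.trans ((congrArg (mfderiv 𝓘(ℝ, F) 𝓘(ℝ, F) (fun q' : Q => R.angle q • q')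
      (R.sec (B.proj q)) : F →L[ℝ] F) h3).trans (map_zero (mfderiv 𝓘(ℝ, F) 𝓘(ℝ, F)
        (fun q' : Q => R.angle q • q') (R.sec (B.proj q)) : F →L[ℝ] F)))
    refine ((h0 v).symm.trans (h v)).trans ?_
    have h5 : ∀ x y : F, y = 0 → x + y = x := by
      rintro x _ rfl
      exact add_zero x
    exact h5 _ _ h4
  have h' := congrArg (B.σ q : F →L[ℝ] ℝ) ((h0 v).symm.trans (h v))
  have hgen : (B.σ q : F →L[ℝ] ℝ) (generator q) = 1 := B.connection.apply_generator q
  have hlin : ∀ (T : F →L[ℝ] ℝ) (c : ℝ) (x y : F), T (c • x + y) = c * T x + T y :=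
    fun T c x y => by
    rw [map_add, map_smul, smul_eq_mul]
  replace h' := h'.trans ((hlin _ _ _ _).trans (congrArg (fun c : ℝ => differential θ q v * c
    + (B.σ q : F →L[ℝ] ℝ) (mfderiv 𝓘(ℝ, F) 𝓘(ℝ, F) g q v)) hgen))
  rw [mul_one] at h'
  have hinv : (B.σ q : F →L[ℝ] ℝ) (mfderiv 𝓘(ℝ, F) 𝓘(ℝ, F) g q v)
      = B.σ (R.sec (B.proj q)) (mfderiv 𝓘(ℝ, E) 𝓘(ℝ, F) R.sec (B.proj q) (B.dproj q v)) := by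
    have h1 := B.connection.invariant (R.angle q) (R.sec (B.proj q))
      (mfderiv 𝓘(ℝ, E) 𝓘(ℝ, F) R.sec (B.proj q) (B.dproj q v))
    have h2 : ∀ q', q' = q → ∀ w : F, (B.σ q' : F →L[ℝ] ℝ) w = (B.σ q : F →L[ℝ] ℝ) w := by
      rintro q' rfl w
      rfl
    refine Eq.trans ?_ h1
    refine Eq.trans ?_ (h2 _ hgq _).symm
    exact congrArg (fun T : F →L[ℝ] F => (B.σ q : F →L[ℝ] ℝ) (T v)) hgd.mfderiv
  rw [R.potential_chartDeriv hq, ← hinv]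
  exact eq_sub_of_add_eq h'.symm

/-- The function on `Q` of weight `n` with a given coordinate expression. -/
def equivariantLift (n : ℤ) (f : E → ℂ) (q : Q) : ℂ :=
  (R.angle q : ℂ) ^ n * f (extChartAt 𝓘(ℝ, E) o (B.proj q))

theorem contMDiffOn_equivariantLift (n : ℤ) {f : E → ℂ} {O : Set E} (hf : ContDiffOn ℝ ∞ f O)
    {U : Set P} (hU : U ⊆ R.dom) (hUO : ∀ p ∈ U, extChartAt 𝓘(ℝ, E) o p ∈ O) :
    ContMDiffOn 𝓘(ℝ, F) 𝓘(ℝ, ℂ) ∞ (R.equivariantLift n f) (B.proj ⁻¹' U) := by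
  have h1 : ContMDiffOn 𝓘(ℝ, F) 𝓘(ℝ, ℂ) ∞ (fun q => ((R.angle q : ℂ)) ^ n)
      (B.proj ⁻¹' U) := by
    have hz : ∀ z : ℂ, z ≠ 0 → ContDiffAt ℝ ∞ (fun z : ℂ => z ^ n) z := by
      intro z hz
      cases n with
      | ofNat k => simpa using contDiffAt_id.pow k
      | negSucc k =>
        simp only [zpow_negSucc]
        exact (contDiffAt_id.pow (k + 1)).inv (pow_ne_zero _ hz)
    intro q hq
    exact (hz _ (Circle.coe_ne_zero _)).contMDiffAt.comp_contMDiffWithinAt q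
      (((contMDiffOn_coe_circle R.smooth_angle).mono fun q hq => hU hq) q hq)
  have h2 : ContMDiffOn 𝓘(ℝ, E) 𝓘(ℝ, E) ∞ (extChartAt 𝓘(ℝ, E) o) U := by
    refine (contMDiffOn_extChartAt (I := 𝓘(ℝ, E))).mono fun p hp => ?_
    rw [← extChartAt_source 𝓘(ℝ, E)]
    exact R.dom_subset (hU hp)
  have h3 : ContMDiffOn 𝓘(ℝ, F) 𝓘(ℝ, ℂ) ∞
      (fun q => f (extChartAt 𝓘(ℝ, E) o (B.proj q))) (B.proj ⁻¹' U) :=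
    hf.contMDiffOn.comp (h2.comp B.principal.smooth_proj.contMDiffOn fun q hq => hq)
      fun q hq => hUO _ hq
  exact (contDiff_mul (𝕜 := ℝ) (𝔸 := ℂ)).contMDiff.comp_contMDiffOn (h1.prodMk_space h3)

/-- Near `q` the angular factor is a constant times `exp(2πinθ)`, and `dθ = σ - π^*τ` by
`exists_angle`; the rest is the product rule. It translates annihilation by a vector of `Q` into a
linear first order equation for `f` on the base. -/
theorem derivAlong_equivariantLift (n : ℤ) {f : E → ℂ} {q : Q} (hq : B.proj q ∈ R.dom)
    (hf : DifferentiableAt ℝ f (extChartAt 𝓘(ℝ, E) o (B.proj q))) (v : TangentSpace 𝓘(ℝ, F) q) :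
    derivAlong (R.equivariantLift n f) q v = (R.angle q : ℂ) ^ n *
      (2 * Real.pi * Complex.I * n * ((B.σ q v
        - R.potential (extChartAt 𝓘(ℝ, E) o (B.proj q)) (chartDeriv E o _ (B.dproj q v)) : ℝ) : ℂ)
          * f (extChartAt 𝓘(ℝ, E) o (B.proj q))
        + fderiv ℝ f (extChartAt 𝓘(ℝ, E) o (B.proj q)) (chartDeriv E o _ (B.dproj q v))) := by
  obtain ⟨θ, hθ, hθq, hev, hdθ, -⟩ := R.exists_angle hq
  rw [← hdθ]
  let u : ℝ → ℂ := fun t => (R.angle q : ℂ) ^ n * Complex.exp (2 * Real.pi * Complex.I * n * t)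
  have h1 : R.equivariantLift n f =ᶠ[𝓝 q]
      (u ∘ θ) * (f ∘ (extChartAt 𝓘(ℝ, E) o ∘ B.proj)) := by
    filter_upwards [hev] with q' h
    rw [equivariantLift, h, Circle.coe_mul, Circle.coe_exp, mul_zpow, ← Complex.exp_int_mul]
    simp only [Pi.mul_apply, Function.comp_apply, u]
    push_cast
    rw [show (n : ℂ) * (2 * Real.pi * θ q' * Complex.I) = 2 * Real.pi * Complex.I * n * θ q' by
      ring]
    ring
  have hu : HasDerivAt u ((R.angle q : ℂ) ^ n * (2 * Real.pi * Complex.I * n)) (θ q) := by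
    have h4 : HasDerivAt (fun t : ℝ => 2 * Real.pi * Complex.I * n * (t : ℂ))
        (2 * Real.pi * Complex.I * n) (θ q) := by
      simpa using (Complex.ofRealCLM.hasDerivAt (x := θ q)).const_mul (2 * Real.pi * Complex.I * n)
    have h5 := h4.cexp.const_mul ((R.angle q : ℂ) ^ n)
    rwa [hθq, Complex.ofReal_zero, mul_zero, Complex.exp_zero, one_mul, ← hθq] at h5
  have hk := (hasMFDerivAt_chart (R.dom_subset hq)).comp q (B.hasMFDerivAt_proj q)
  have h8 := ((hu.hasFDerivAt.hasMFDerivAt.comp q hθ.hasMFDerivAt).mul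
    (hf.hasFDerivAt.hasMFDerivAt.comp q hk)).congr_of_eventuallyEq h1
  have h9 := congrArg (fun T : F →L[ℝ] ℂ => T v) h8.mfderiv
  refine h9.trans ?_
  change u (θ q) * fderiv ℝ f (extChartAt 𝓘(ℝ, E) o (B.proj q))
      (chartDeriv E o _ (B.dproj q v)) + f (extChartAt 𝓘(ℝ, E) o (B.proj q)) *
        (differential θ q v •
          ((R.angle q : ℂ) ^ n * (2 * Real.pi * Complex.I * n))) = _
  have huq : u (θ q) = (R.angle q : ℂ) ^ n := by simp [u, hθq]
  rw [huq, Complex.real_smul]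
  ring

theorem isEigenOn_equivariantLift (n : ℤ) {f : E → ℂ} {U : Set P} (hU : U ⊆ R.dom)
    (hf : ∀ p ∈ U, DifferentiableAt ℝ f (extChartAt 𝓘(ℝ, E) o p)) :
    Prequantization.IsEigenOn (F := F) n (B.proj ⁻¹' U) (R.equivariantLift n f) := by
  intro q hq
  rw [R.derivAlong_equivariantLift n (hU hq) (hf _ hq), B.dproj_generator, map_zero, map_zero,
    map_zero, B.connection.apply_generator, equivariantLift]
  push_cast
  ring

end LocalFrame

/-! ### Criteria for smoothness in charts -/

section ChartCriteria

variable {E : Type*} [NormedAddCommGroup E] [NormedSpace ℝ E]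
  {M : Type*} [TopologicalSpace M] [ChartedSpace E M] [IsManifold 𝓘(ℝ, E) ∞ M]
  {Y : Type*} [NormedAddCommGroup Y] [NormedSpace ℝ Y]

/-- A function is smooth if its expressions in the preferred charts are. -/
theorem contMDiffOn_of_comp_chartSymm {f : M → Y} {V : Set M} (hV : IsOpen V)
    (hf : ∀ o ∈ V, ContDiffOn ℝ ∞ (f ∘ (extChartAt 𝓘(ℝ, E) o).symm)
      ((extChartAt 𝓘(ℝ, E) o).target ∩ (extChartAt 𝓘(ℝ, E) o).symm ⁻¹' V)) :
    ContMDiffOn 𝓘(ℝ, E) 𝓘(ℝ, Y) ∞ f V := by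
  intro o ho
  have h1 : ContDiffAt ℝ ∞ (f ∘ (extChartAt 𝓘(ℝ, E) o).symm) (extChartAt 𝓘(ℝ, E) o o) := by
    refine (hf o ho).contDiffAt ((isOpen_chart_target_inter o hV).mem_nhds
      ⟨mem_extChartAt_target o, ?_⟩)
    rwa [mem_preimage, extChartAt_to_inv]
  have h2 := h1.contMDiffAt.comp o (contMDiffAt_extChartAt (I := 𝓘(ℝ, E)) (n := ∞) (x := o))
  refine (h2.congr_of_eventuallyEq ?_).contMDiffWithinAt
  filter_upwards [extChartAt_source_mem_nhds (I := 𝓘(ℝ, E)) o] with p hp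
  simp only [Function.comp_apply, (extChartAt 𝓘(ℝ, E) o).left_inv hp]

theorem contMDiffOn_clm_of_apply {Z : Type*} [NormedAddCommGroup Z] [NormedSpace ℝ Z]
    [FiniteDimensional ℝ Z] {T : M → Z →L[ℝ] Y} {V : Set M} (hV : IsOpen V)
    (hT : ∀ z, ContMDiffOn 𝓘(ℝ, E) 𝓘(ℝ, Y) ∞ (fun p => T p z) V) :
    ContMDiffOn 𝓘(ℝ, E) 𝓘(ℝ, Z →L[ℝ] Y) ∞ T V :=
  contMDiffOn_of_comp_chartSymm hV fun o _ =>
    contDiffOn_clm_apply.2 fun z => contDiffOn_comp_chartSymm o (hT z)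

theorem contMDiffOn_differential_apply {r : M → ℝ} {X : (x : M) → TangentSpace 𝓘(ℝ, E) x}
    {V : Set M} (hV : IsOpen V) (hr : ContMDiffOn 𝓘(ℝ, E) 𝓘(ℝ, ℝ) ∞ r V)
    (hX : SmoothVectorOn X V) :
    ContMDiffOn 𝓘(ℝ, E) 𝓘(ℝ, ℝ) ∞ (fun p => differential r p (X p)) V := by
  refine contMDiffOn_of_comp_chartSymm hV fun o ho => ?_
  have h1 := contDiffOn_comp_chartSymm o hr
  have h2 := contDiffOn_coordVec o hV hX
  refine ((h1.fderiv_of_isOpen (isOpen_chart_target_inter o hV) (m := ∞) (by simp)).clm_apply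
    h2).congr fun y hy => ?_
  have h3 := fderiv_comp_chartSymm hy.1 ((hr.contMDiffAt (hV.mem_nhds hy.2)).mdifferentiableAt
    (by simp)) (coordVec o X y)
  refine Eq.trans ?_ h3.symm
  exact congrArg (fun w : E => (differential r ((extChartAt 𝓘(ℝ, E) o).symm y) : E →L[ℝ] ℝ) w)
    (chartSymmDeriv_chartDeriv hy.1 (X ((extChartAt 𝓘(ℝ, E) o).symm y))).symm

/-- A vector field is smooth if its components with respect to a smooth coframe are. -/
theorem smoothVectorOn_of_coframe {Z : Type*} [NormedAddCommGroup Z] [NormedSpace ℝ Z]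
    [CompleteSpace E] {N : (p : M) → TangentSpace 𝓘(ℝ, E) p →L[ℝ] Z} {V : Set M} (hV : IsOpen V)
    (hN : ∀ o ∈ V, ContDiffOn ℝ ∞ (fun y => (N ((extChartAt 𝓘(ℝ, E) o).symm y) : E →L[ℝ] Z).comp
      (chartSymmDeriv o y : E →L[ℝ] E))
      ((extChartAt 𝓘(ℝ, E) o).target ∩ (extChartAt 𝓘(ℝ, E) o).symm ⁻¹' V))
    (hinv : ∀ p ∈ V, (N p).IsInvertible) {w : M → Z} (hw : ContMDiffOn 𝓘(ℝ, E) 𝓘(ℝ, Z) ∞ w V) :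
    SmoothVectorOn (fun p => (N p).inverse (w p)) V := by
  intro o ho
  have hV' : IsOpen (V ∩ (extChartAt 𝓘(ℝ, E) o).source) := hV.inter (isOpen_extChartAt_source o)
  refine ContMDiffWithinAt.mono_of_mem_nhdsWithin ((smoothVectorOn_iff_chartDeriv o hV'
    inter_subset_right).2 ?_ o ⟨ho, mem_extChartAt_source o⟩)
    (mem_nhdsWithin_of_mem_nhds (hV'.mem_nhds ⟨ho, mem_extChartAt_source o⟩))
  have hsm := hN o ho
  set T : E → E →L[ℝ] Z := fun y => (N ((extChartAt 𝓘(ℝ, E) o).symm y) : E →L[ℝ] Z).comp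
      (chartSymmDeriv o y : E →L[ℝ] E) with hT
  have hTinv : ∀ y ∈ (extChartAt 𝓘(ℝ, E) o).target ∩ (extChartAt 𝓘(ℝ, E) o).symm ⁻¹' V,
      (T y).IsInvertible := by
    intro y hy
    have h1 : (chartSymmDeriv o y : E →L[ℝ] E).IsInvertible := by
      rw [chartSymmDeriv_eq hy.1]
      exact (isInvertible_chartDeriv ((extChartAt 𝓘(ℝ, E) o).map_target hy.1)).inverse
    exact (hinv _ hy.2).comp h1
  -- Inversion of continuous linear maps is smooth at invertible ones, so the dual frame inherits
  -- smoothness from the coframe.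
  have hinvsm : ContDiffOn ℝ ∞ (fun y => (T y).inverse)
      ((extChartAt 𝓘(ℝ, E) o).target ∩ (extChartAt 𝓘(ℝ, E) o).symm ⁻¹' V) := by
    intro y hy
    obtain ⟨e, he⟩ := hTinv y hy
    have h2 := contDiffAt_map_inverse (n := ∞) e
    rw [he] at h2
    exact h2.comp_contDiffWithinAt y (hsm y hy)
  have hc : ContMDiffOn 𝓘(ℝ, E) 𝓘(ℝ, E) ∞ (extChartAt 𝓘(ℝ, E) o)
      (V ∩ (extChartAt 𝓘(ℝ, E) o).source) := by
    refine (contMDiffOn_extChartAt (I := 𝓘(ℝ, E))).mono ?_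
    rw [← extChartAt_source 𝓘(ℝ, E)]
    exact inter_subset_right
  have hmaps : ∀ p ∈ V ∩ (extChartAt 𝓘(ℝ, E) o).source, extChartAt 𝓘(ℝ, E) o p ∈
      (extChartAt 𝓘(ℝ, E) o).target ∩ (extChartAt 𝓘(ℝ, E) o).symm ⁻¹' V := fun p hp =>
    ⟨(extChartAt 𝓘(ℝ, E) o).map_source hp.2, by
      rw [mem_preimage, (extChartAt 𝓘(ℝ, E) o).left_inv hp.2]; exact hp.1⟩
  refine ((hinvsm.contMDiffOn.comp hc hmaps).clm_apply (hw.mono inter_subset_left)).congr ?_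
  intro p hp
  symm
  rw [Function.comp_apply, (hTinv _ (hmaps p hp)).inverse_apply_eq]
  obtain ⟨y, -, hy, rfl⟩ := LocalFrame.exists_coord hp.2 (mem_univ _)
  rw [(extChartAt 𝓘(ℝ, E) o).right_inv hy]
  have h3 := chartSymmDeriv_chartDeriv hy ((N ((extChartAt 𝓘(ℝ, E) o).symm y)).inverse
    (w ((extChartAt 𝓘(ℝ, E) o).symm y)))
  have h4 : (N ((extChartAt 𝓘(ℝ, E) o).symm y)) ((N ((extChartAt 𝓘(ℝ, E) o).symm y)).inverse
    (w ((extChartAt 𝓘(ℝ, E) o).symm y))) = w ((extChartAt 𝓘(ℝ, E) o).symm y) :=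
    ((hinv _ hp.1).inverse_apply_eq.1 rfl).symm
  exact (h4.symm.trans (congrArg (N ((extChartAt 𝓘(ℝ, E) o).symm y) : E →L[ℝ] Z) h3.symm))

end ChartCriteria

/-! ### Coframe on `Q` given by base coordinates and connection form -/

namespace LocalFrame

variable {E : Type*} [NormedAddCommGroup E] [NormedSpace ℝ E]
  {P : Type*} [TopologicalSpace P] [ChartedSpace E P] [IsManifold 𝓘(ℝ, E) ∞ P]
  {L : DiracStructure E P}
  {F : Type*} [NormedAddCommGroup F] [NormedSpace ℝ F]
  {Q : Type*} [TopologicalSpace Q] [ChartedSpace F Q] [IsManifold 𝓘(ℝ, F) ∞ Q]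
  [MulAction Circle Q] {B : Prequantization L F Q} {o : P} (R : LocalFrame B o)

theorem vecPart_chart {p : P} (hp : p ∈ (extChartAt 𝓘(ℝ, E) o).source)
    (c : Fin (Module.finrank ℝ E) → ℝ) :
    R.vecPart (extChartAt 𝓘(ℝ, E) o p) c = chartDeriv E o p (R.comb p c : GenTangent E p).1 := by
  obtain ⟨y, -, hy, rfl⟩ := exists_coord hp (mem_univ _)
  rw [(extChartAt 𝓘(ℝ, E) o).right_inv hy, vecPart_apply]

theorem formPart_chart {p : P} (hp : p ∈ (extChartAt 𝓘(ℝ, E) o).source)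
    (c : Fin (Module.finrank ℝ E) → ℝ) (v : TangentSpace 𝓘(ℝ, E) p) :
    R.formPart (extChartAt 𝓘(ℝ, E) o p) c (chartDeriv E o p v)
      = (R.comb p c : GenTangent E p).2 v := by
  obtain ⟨y, -, hy, rfl⟩ := exists_coord hp (mem_univ _)
  rw [(extChartAt 𝓘(ℝ, E) o).right_inv hy, formPart_apply, chartSymmDeriv_chartDeriv hy]

theorem betaPart_chart {p : P} (hp : p ∈ (extChartAt 𝓘(ℝ, E) o).source)
    (c : Fin (Module.finrank ℝ E) → ℝ) :
    R.betaPart (extChartAt 𝓘(ℝ, E) o p) c = B.β p (R.comb p c) := by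
  obtain ⟨y, -, hy, rfl⟩ := exists_coord hp (mem_univ _)
  rw [(extChartAt 𝓘(ℝ, E) o).right_inv hy, betaPart_apply]

theorem coordVec_chart {p : P} (hp : p ∈ (extChartAt 𝓘(ℝ, E) o).source)
    (X : (x : P) → TangentSpace 𝓘(ℝ, E) x) :
    coordVec o X (extChartAt 𝓘(ℝ, E) o p) = chartDeriv E o p (X p) := by
  obtain ⟨y, -, hy, rfl⟩ := exists_coord hp (mem_univ _)
  rw [(extChartAt 𝓘(ℝ, E) o).right_inv hy, coordVec]

/-- The coframe on `Q` consisting of the coordinates on the base and of the connection form. -/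
def coframe (_ : LocalFrame B o) (q : Q) : TangentSpace 𝓘(ℝ, F) q →L[ℝ] E × ℝ :=
  ((chartDeriv E o (B.proj q)).comp (B.dproj q)).prod (B.σ q)

theorem coframe_apply (q : Q) (v : TangentSpace 𝓘(ℝ, F) q) :
    R.coframe q v = (chartDeriv E o (B.proj q) (B.dproj q v), B.σ q v) := rfl

theorem coframe_generator (q : Q) : R.coframe q (generator q) = (0, 1) := by
  rw [coframe_apply, B.dproj_generator, map_zero, B.connection.apply_generator]

/-- A vector killed by `dπ` is a multiple of the generator, on which `σ` is `1`; this gives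
injectivity. Horizontal lifts together with the generator give surjectivity. -/
theorem isInvertible_coframe [FiniteDimensional ℝ F] {q : Q} (hq : B.proj q ∈ R.dom) :
    (R.coframe q).IsInvertible := by
  have hinj : Function.Injective (R.coframe q) := by
    rw [injective_iff_map_eq_zero]
    intro v hv
    obtain ⟨h1, h2⟩ := Prod.ext_iff.1 hv
    have h3 : B.dproj q v = 0 := by
      rw [← chartDeriv_inverse_apply (R.dom_subset hq) (B.dproj q v)]
      exact (congrArg _ h1).trans (map_zero _)
    obtain ⟨θ, -, -, -, h4, h5⟩ := R.exists_angle hq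
    have h6 : B.σ q v = 0 := h2
    rw [h5 v h3, h4 v, h6, h3, map_zero, map_zero, sub_zero, zero_smul]
  have hsurj : Function.Surjective (R.coframe q) := by
    rintro ⟨w, c⟩
    obtain ⟨Y, hY1, hY2⟩ := B.exists_isHorizontalLift q ((chartDeriv E o (B.proj q)).inverse w)
    refine ⟨Y + c • generator q, ?_⟩
    rw [map_add, map_smul, coframe_generator, coframe_apply, hY1, hY2,
      chartDeriv_apply_inverse (R.dom_subset hq)]
    simp
  let T : F →L[ℝ] E × ℝ := R.coframe q
  exact ⟨(LinearEquiv.ofBijective (T : F →ₗ[ℝ] E × ℝ)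
    ⟨hinj, hsurj⟩).toContinuousLinearEquiv, rfl⟩

/-- The tangent vector on `Q` with given components. -/
def vector (q : Q) : E × ℝ →L[ℝ] TangentSpace 𝓘(ℝ, F) q := (R.coframe q).inverse

section

variable [FiniteDimensional ℝ F] {q : Q}

theorem coframe_vector (hq : B.proj q ∈ R.dom) (w : E × ℝ) : R.coframe q (R.vector q w) = w :=
  ((R.isInvertible_coframe hq).inverse_apply_eq.1 rfl).symm

theorem vector_coframe (hq : B.proj q ∈ R.dom) (v : TangentSpace 𝓘(ℝ, F) q) :
    R.vector q (R.coframe q v) = v :=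
  (R.isInvertible_coframe hq).inverse_apply_eq.2 rfl

theorem chartDeriv_dproj_vector (hq : B.proj q ∈ R.dom) (w : E × ℝ) :
    chartDeriv E o (B.proj q) (B.dproj q (R.vector q w)) = w.1 :=
  congrArg Prod.fst (R.coframe_vector hq w)

theorem sigma_vector (hq : B.proj q ∈ R.dom) (w : E × ℝ) : B.σ q (R.vector q w) = w.2 :=
  congrArg Prod.snd (R.coframe_vector hq w)

theorem dproj_vector (hq : B.proj q ∈ R.dom) {w : E × ℝ} {v : TangentSpace 𝓘(ℝ, E) (B.proj q)}
    (h : w.1 = chartDeriv E o (B.proj q) v) : B.dproj q (R.vector q w) = v := by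
  rw [← chartDeriv_inverse_apply (R.dom_subset hq) (B.dproj q (R.vector q w)),
    R.chartDeriv_dproj_vector hq, h, chartDeriv_inverse_apply (R.dom_subset hq)]

theorem vector_generator (hq : B.proj q ∈ R.dom) : R.vector q (0, 1) = generator q := by
  rw [← R.coframe_generator q, R.vector_coframe hq]

/-- The decomposition of a tangent vector into horizontal and vertical parts. -/
theorem vector_horizontal (hq : B.proj q ∈ R.dom) (v : TangentSpace 𝓘(ℝ, F) q) :
    R.vector q (chartDeriv E o (B.proj q) (B.dproj q v), 0) = v - B.σ q v • generator q := by
  rw [← R.vector_coframe hq (v - B.σ q v • generator q), map_sub, map_smul, R.coframe_generator,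
    coframe_apply]
  simp

end

theorem smoothVectorOn_vector [FiniteDimensional ℝ F] {V : Set Q} (hV : IsOpen V)
    (hVR : V ⊆ B.proj ⁻¹' R.dom) {w : Q → E × ℝ} (hw : ContMDiffOn 𝓘(ℝ, F) 𝓘(ℝ, E × ℝ) ∞ w V) :
    SmoothVectorOn (fun q => R.vector q (w q)) V := by
  refine smoothVectorOn_of_coframe hV (fun q₀ hq₀ => ?_)
    (fun q hq => R.isInvertible_coframe (hVR hq)) hw
  have hk : ContMDiffOn 𝓘(ℝ, F) 𝓘(ℝ, E) ∞ (extChartAt 𝓘(ℝ, E) o ∘ B.proj) V := by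
    have h2 : ContMDiffOn 𝓘(ℝ, E) 𝓘(ℝ, E) ∞ (extChartAt 𝓘(ℝ, E) o) R.dom := by
      refine (contMDiffOn_extChartAt (I := 𝓘(ℝ, E))).mono fun p hp => ?_
      rw [← extChartAt_source 𝓘(ℝ, E)]
      exact R.dom_subset hp
    exact h2.comp B.principal.smooth_proj.contMDiffOn hVR
  have h1 := (contDiffOn_comp_chartSymm q₀ hk).fderiv_of_isOpen
    (isOpen_chart_target_inter q₀ hV) (m := ∞) (by simp)
  have h2 := (contDiffOn_formInChart q₀ B.connection.smooth).mono
    (t := (extChartAt 𝓘(ℝ, F) q₀).target ∩ (extChartAt 𝓘(ℝ, F) q₀).symm ⁻¹' V)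
    fun y hy => ⟨hy.1, mem_univ _⟩
  refine contDiffOn_clm_apply.2 fun v => ?_
  refine ((h1.clm_apply (contDiffOn_const (c := v))).prodMk
    (h2.clm_apply (contDiffOn_const (c := v)))).congr fun y hy => ?_
  refine Prod.ext ?_ rfl
  have h3 := fderiv_comp_chartSymm hy.1 ((hk.contMDiffAt (hV.mem_nhds hy.2)).mdifferentiableAt
    (by simp)) v
  refine Eq.trans ?_ h3.symm
  have h4 := ((hasMFDerivAt_chart (R.dom_subset (hVR hy.2))).comp _
    (B.hasMFDerivAt_proj ((extChartAt 𝓘(ℝ, F) q₀).symm y))).mfderiv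
  exact (congrArg (fun T : F →L[ℝ] E => T (chartSymmDeriv q₀ y v)) h4).symm

end LocalFrame

/-! ### Admissibility of functions annihilated by `L̄ ∩ TQ` -/

namespace LocalFrame

variable {E : Type*} [NormedAddCommGroup E] [NormedSpace ℝ E] [FiniteDimensional ℝ E]
  {P : Type*} [TopologicalSpace P] [ChartedSpace E P] [IsManifold 𝓘(ℝ, E) ∞ P]
  {L : DiracStructure E P}
  {F : Type*} [NormedAddCommGroup F] [NormedSpace ℝ F] [FiniteDimensional ℝ F]
  {Q : Type*} [TopologicalSpace Q] [ChartedSpace F Q] [IsManifold 𝓘(ℝ, F) ∞ Q]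
  [MulAction Circle Q] {B : Prequantization L F Q} {o : P} (R : LocalFrame B o)

omit [FiniteDimensional ℝ E] [FiniteDimensional ℝ F] in
theorem contMDiffOn_comp_chart_proj {Y : Type*} [NormedAddCommGroup Y] [NormedSpace ℝ Y]
    {V : Set Q} (hV : V ⊆ B.proj ⁻¹' R.dom) {O : Set E}
    (hVO : ∀ q ∈ V, extChartAt 𝓘(ℝ, E) o (B.proj q) ∈ O) {f : E → Y} (hf : ContDiffOn ℝ ∞ f O) :
    ContMDiffOn 𝓘(ℝ, F) 𝓘(ℝ, Y) ∞ (fun q => f (extChartAt 𝓘(ℝ, E) o (B.proj q))) V := by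
  have h : ContMDiffOn 𝓘(ℝ, E) 𝓘(ℝ, E) ∞ (extChartAt 𝓘(ℝ, E) o) R.dom := by
    refine (contMDiffOn_extChartAt (I := 𝓘(ℝ, E))).mono fun p hp => ?_
    rw [← extChartAt_source 𝓘(ℝ, E)]
    exact R.dom_subset hp
  exact hf.contMDiffOn.comp (h.comp B.principal.smooth_proj.contMDiffOn hV) hVO

/-- The descent to the base, in coordinates, of the form `dr - (E·r) (σ - π^*α)`. -/
def descent (r : Q → ℝ) (q : Q) : E →L[ℝ] ℝ :=
  ((differential r q : Cotangent F q).comp (R.vector q)).comp (ContinuousLinearMap.inl ℝ E ℝ)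
    + differential r q (generator (F := F) q) • formInChart B.α o (extChartAt 𝓘(ℝ, E) o (B.proj q))

theorem descent_apply (r : Q → ℝ) (q : Q) (w : E) :
    R.descent r q w = differential r q (R.vector q (w, 0))
      + differential r q (generator (F := F) q)
        * formInChart B.α o (extChartAt 𝓘(ℝ, E) o (B.proj q)) w :=
  rfl

theorem descent_chartDeriv (r : Q → ℝ) {q : Q} (hq : B.proj q ∈ R.dom)
    (v : TangentSpace 𝓘(ℝ, F) q) :
    R.descent r q (chartDeriv E o (B.proj q) (B.dproj q v)) = differential r q v
      - differential r q (generator (F := F) q) * (B.σ q v - B.α (B.proj q) (B.dproj q v)) := by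
  rw [descent_apply, R.vector_horizontal hq, formInChart_chartDeriv (R.dom_subset hq), map_sub,
    map_smul, smul_eq_mul]
  ring

/-- The descended form of a basic function is the cotangent part of an element of `L`. -/
theorem exists_formPart_eq_descent {r : Q → ℝ} {q : Q} (hq : B.proj q ∈ R.dom)
    (hr : ∀ Y, ((Y, 0), (0, 0)) ∈ B.Lbar q → differential r q Y = 0) :
    ∃ c, R.formPart (extChartAt 𝓘(ℝ, E) o (B.proj q)) c = R.descent r q := by
  have hs := R.dom_subset hq
  -- It suffices that the descended form kills each `Z` in `L ∩ TP`. The vector `Z^H + β(Z ⊕ 0) E`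
  -- lies in `L̄ ∩ TQ`, hence is killed by `dr`, and since `β(Z ⊕ 0) = α(Z)` the correction by `σ -
  -- π^*α` vanishes on it.
  obtain ⟨Y, hY⟩ := exists_mem_of_annihilates (L.maximal_isotropic (B.proj q))
    (ξ := (R.descent r q).comp (chartDeriv E o (B.proj q))) (fun Z hZ => by
      let x : L.fiber (B.proj q) := ⟨_, hZ⟩
      let Y := R.vector q (chartDeriv E o (B.proj q) Z, B.β (B.proj q) x)
      have hYZ : B.dproj q Y = Z := R.dproj_vector hq rfl
      have hYσ : B.σ q Y = B.β (B.proj q) x := R.sigma_vector hq _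
      have hY : ((Y, 0), (0, 0)) ∈ B.Lbar q :=
        B.mem_lbar (x := x) (by rw [hYZ, zero_smul, sub_zero]) (by rw [hYσ, sub_zero])
          (fun v => by simp [x])
      have hβ := B.β_eq (B.proj q) x
      simp only [pairPlus, x, zero_apply] at hβ
      rw [ContinuousLinearMap.comp_apply, ← hYZ, R.descent_chartDeriv r hq, hr Y hY, hYσ, hβ, hYZ]
      ring)
  obtain ⟨c, hc⟩ := (R.bijective _ hq).2 ⟨_, hY⟩
  refine ⟨c, ?_⟩
  ext w
  have h := R.formPart_chart hs c ((chartDeriv E o (B.proj q)).inverse w)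
  rw [chartDeriv_apply_inverse hs] at h
  rw [h, comb, hc]
  exact congrArg (R.descent r q) (chartDeriv_apply_inverse hs w)

/-- Where the form parts of the elements of `L` have a smooth generalized inverse, smooth functions
annihilated by `L̄ ∩ TQ` are admissible. -/
theorem isAdmissibleOn {O : Set E} (hOR : O ⊆ R.coordDom)
    {S : E → (E →L[ℝ] ℝ) →L[ℝ] Fin (Module.finrank ℝ E) → ℝ} (hS : ContDiffOn ℝ ∞ S O)
    (hTS : ∀ x ∈ O, ∀ c, R.formPart x (S x (R.formPart x c)) = R.formPart x c)
    {U : Set P} (hU : IsOpen U) (hUR : U ⊆ R.dom) (hUO : ∀ p ∈ U, extChartAt 𝓘(ℝ, E) o p ∈ O)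
    {r : Q → ℝ} (hrs : ContMDiffOn 𝓘(ℝ, F) 𝓘(ℝ, ℝ) ∞ r (B.proj ⁻¹' U))
    (hr : ∀ q ∈ B.proj ⁻¹' U, ∀ Y, ((Y, 0), (0, 0)) ∈ B.Lbar q → differential r q Y = 0) :
    B.IsAdmissibleOn (B.proj ⁻¹' U) r := by
  have hV : IsOpen (B.proj ⁻¹' U) := hU.preimage B.principal.smooth_proj.continuous
  have hVR : B.proj ⁻¹' U ⊆ B.proj ⁻¹' R.dom := preimage_mono hUR
  have hcO := fun q (hq : q ∈ B.proj ⁻¹' U) => hUO _ hq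
  have hgen : SmoothVectorOn (fun q => (generator q : TangentSpace 𝓘(ℝ, F) q))
      (B.proj ⁻¹' U) := by
    refine ContMDiffOn.congr (R.smoothVectorOn_vector hV hVR
      (contMDiffOn_const (c := ((0, 1) : E × ℝ)))) fun q hq => ?_
    simp only [R.vector_generator (hVR hq)]
  have hc := contMDiffOn_differential_apply hV hrs hgen
  have hα : ContDiffOn ℝ ∞ (formInChart B.α o) O :=
    (contDiffOn_formInChart o B.smooth_α).mono fun y hy => ⟨(hOR hy).1, mem_univ _⟩
  have hA : ContDiffOn ℝ ∞ (coordVec o B.A) O :=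
    (contDiffOn_coordVec o isOpen_univ B.smooth_A).mono fun y hy => ⟨(hOR hy).1, mem_univ _⟩
  have hξ : ContMDiffOn 𝓘(ℝ, F) 𝓘(ℝ, E →L[ℝ] ℝ) ∞ (R.descent r) (B.proj ⁻¹' U) := by
    refine contMDiffOn_clm_of_apply hV fun w => ?_
    simp only [descent_apply]
    refine (contMDiffOn_differential_apply hV hrs (R.smoothVectorOn_vector hV hVR
      (contMDiffOn_const (c := ((w, 0) : E × ℝ))))).add ?_
    exact contDiff_mul.contMDiff.comp_contMDiffOn (hc.prodMk_space
      (R.contMDiffOn_comp_chart_proj hVR hcO (hα.clm_apply contDiffOn_const)))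
  -- The components of an element of `L` with the prescribed covector part exist pointwise; the
  -- generalized inverse selects them smoothly.
  let a : Q → Fin (Module.finrank ℝ E) → ℝ := fun q =>
    S (extChartAt 𝓘(ℝ, E) o (B.proj q)) (R.descent r q)
  have ha : ContMDiffOn 𝓘(ℝ, F) 𝓘(ℝ, Fin (Module.finrank ℝ E) → ℝ) ∞ a (B.proj ⁻¹' U) :=
    (R.contMDiffOn_comp_chart_proj hVR hcO hS).clm_apply hξ
  have hform : ∀ q ∈ B.proj ⁻¹' U,
      R.formPart (extChartAt 𝓘(ℝ, E) o (B.proj q)) (a q) = R.descent r q := by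
    intro q hq
    obtain ⟨c, hc⟩ := R.exists_formPart_eq_descent (hUR hq) (hr q hq)
    simp only [a, ← hc]
    exact hTS _ (hUO _ hq) c
  -- This choice of the function `φ` is forced: the cotangent component of an element of `L̄` takes
  -- the value `φ` on the generator.
  let c : Q → ℝ := fun q => differential r q (generator (F := F) q)
  have hw1 : ContMDiffOn 𝓘(ℝ, F) 𝓘(ℝ, E) ∞ (fun q =>
      R.vecPart (extChartAt 𝓘(ℝ, E) o (B.proj q)) (a q)
        - c q • coordVec o B.A (extChartAt 𝓘(ℝ, E) o (B.proj q))) (B.proj ⁻¹' U) :=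
    ((R.contMDiffOn_comp_chart_proj hVR hcO (R.contDiffOn_vecPart.mono hOR)).clm_apply ha).sub
      (hc.smul (R.contMDiffOn_comp_chart_proj hVR hcO hA))
  have hw2 : ContMDiffOn 𝓘(ℝ, F) 𝓘(ℝ, ℝ) ∞ (fun q =>
      R.betaPart (extChartAt 𝓘(ℝ, E) o (B.proj q)) (a q) - r q) (B.proj ⁻¹' U) :=
    ((R.contMDiffOn_comp_chart_proj hVR hcO (R.contDiffOn_betaPart.mono hOR)).clm_apply ha).sub hrs
  refine ⟨hrs, _, R.smoothVectorOn_vector hV hVR (hw1.prodMk_space hw2), c, hc, fun q hq => ?_⟩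
  have hs := R.dom_subset (hUR hq)
  refine B.mem_lbar (x := R.comb (B.proj q) (a q)) ?_ ?_ fun v => ?_
  · refine R.dproj_vector (hUR hq) ?_
    rw [map_sub, map_smul, R.vecPart_chart hs, coordVec_chart hs]
  · rw [R.sigma_vector (hUR hq), R.betaPart_chart hs]
  · have h1 := R.descent_chartDeriv r (hUR hq) v
    rw [← hform q hq, R.formPart_chart hs] at h1
    rw [h1]
    ring

end LocalFrame

/-! ### Separation of tangent vectors at regular points -/

section Final

variable {E : Type*} [NormedAddCommGroup E] [NormedSpace ℝ E] [FiniteDimensional ℝ E]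
  {P : Type*} [TopologicalSpace P] [ChartedSpace E P] [IsManifold 𝓘(ℝ, E) ∞ P]
  {L : DiracStructure E P}
  {F : Type*} [NormedAddCommGroup F] [NormedSpace ℝ F] [FiniteDimensional ℝ F]
  {Q : Type*} [TopologicalSpace Q] [ChartedSpace F Q] [IsManifold 𝓘(ℝ, F) ∞ Q]
  [MulAction Circle Q]

namespace LocalFrame

variable {B : Prequantization L F Q} {o : P} (R : LocalFrame B o)

/-- The lift of a solution of the equations of covariant constancy along `L ∩ TP` is annihilated by
`L̄ ∩ TQ`. -/
theorem derivAlong_equivariantLift_eq_zero {K : Type*} [NormedAddCommGroup K] [NormedSpace ℝ K]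
    {a : E → K →L[ℝ] Fin (Module.finrank ℝ E) → ℝ} (n : ℤ) {f : E → ℂ} {q : Q}
    (hq : B.proj q ∈ R.dom)
    (hker : ∀ c, R.formPart (extChartAt 𝓘(ℝ, E) o (B.proj q)) c = 0 →
      ∃ v, c = a (extChartAt 𝓘(ℝ, E) o (B.proj q)) v)
    (hf : DifferentiableAt ℝ f (extChartAt 𝓘(ℝ, E) o (B.proj q)))
    (hfa : ∀ v, fderiv ℝ f (extChartAt 𝓘(ℝ, E) o (B.proj q))
        (R.anchor a (extChartAt 𝓘(ℝ, E) o (B.proj q)) v)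
      = 2 * Real.pi * Complex.I * n * R.weight a (extChartAt 𝓘(ℝ, E) o (B.proj q)) v
        * f (extChartAt 𝓘(ℝ, E) o (B.proj q)))
    {Y : TangentSpace 𝓘(ℝ, F) q} {c : ℝ} (hY : ((Y, c), (0, 0)) ∈ B.Lbar q) :
    derivAlong (R.equivariantLift n f) q Y = 0 := by
  obtain ⟨-, x, hx, hσ⟩ := B.exists_of_mem_lbar_vector hY
  have hs := R.dom_subset hq
  obtain ⟨d, hd⟩ := (R.bijective _ hq).2 x
  have hd' : R.comb (B.proj q) d = x := hd
  have hd0 : R.formPart (extChartAt 𝓘(ℝ, E) o (B.proj q)) d = 0 := by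
    ext w
    rw [← chartDeriv_apply_inverse hs w, R.formPart_chart hs, hd', hx]
    rfl
  obtain ⟨v, rfl⟩ := hker d hd0
  have h1 : R.anchor a (extChartAt 𝓘(ℝ, E) o (B.proj q)) v
      = chartDeriv E o (B.proj q) (B.dproj q Y) := by
    refine (R.vecPart_chart hs (a (extChartAt 𝓘(ℝ, E) o (B.proj q)) v)).trans ?_
    rw [hd', hx]
  have h2 : R.weight a (extChartAt 𝓘(ℝ, E) o (B.proj q)) v
      = R.potential (extChartAt 𝓘(ℝ, E) o (B.proj q))
        (chartDeriv E o (B.proj q) (B.dproj q Y)) - B.σ q Y := by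
    rw [hσ, ← hd', ← R.betaPart_chart hs, ← h1]
    rfl
  rw [R.derivAlong_equivariantLift n hq hf, ← h1, hfa v, h2, h1]
  push_cast
  ring

/-- Near a point where the rank of `L ∩ TP` is locally constant, the functions that are both basic
and admissible detect the elements of `L̄ ∩ TQ`. -/
theorem exists_of_forall_derivAlong_eq_zero {n : ℤ} (hn : n ≠ 0) {O : Set E} (hO : IsOpen O)
    (hOR : O ⊆ R.coordDom) {q : Q} (hq : B.proj q ∈ R.dom)
    (hqO : extChartAt 𝓘(ℝ, E) o (B.proj q) ∈ O)
    (hrank : ∀ x ∈ O, clmRank (R.formPart x)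
      = clmRank (R.formPart (extChartAt 𝓘(ℝ, E) o (B.proj q))))
    {W : TangentSpace 𝓘(ℝ, F) q}
    (hW : ∀ U : Opens P, B.proj q ∈ U → ∀ φ ∈ B.Hadm n U, φ ∈ B.Hbas n U → derivAlong φ q W = 0) :
    ∃ x : L.fiber (B.proj q), (x : GenTangent E (B.proj q)) = (B.dproj q W, 0) ∧
      B.σ q W = B.β (B.proj q) x := by
  set x₀ := extChartAt 𝓘(ℝ, E) o (B.proj q) with hx₀
  have hs := R.dom_subset hq
  have hT := R.contDiffOn_formPart
  obtain ⟨O₁, hO₁O, hO₁, hx₁, S, hS, hTS⟩ :=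
    exists_generalized_inverse hO hqO (hT.mono hOR) hrank
  obtain ⟨O₂, hO₂O, hO₂, hx₂, a, p, ha, hTa, hpa, hker⟩ := exists_kernel_frame hO₁ hx₁
    (hT.mono (hO₁O.trans hOR)) (R.contDiffOn_vecPart.mono (hO₁O.trans hOR)) hS hTS
    (fun x hx => hrank x (hO₁O hx)) (fun v h1 h2 => R.eq_zero_of_parts (hOR hqO) h1 h2)
  have hO₂R : O₂ ⊆ R.coordDom := (hO₂O.trans hO₁O).trans hOR
  have hk : (2 * Real.pi * Complex.I * n : ℂ) ≠ 0 :=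
    mul_ne_zero Complex.two_pi_I_ne_zero (Int.cast_ne_zero.2 hn)
  obtain ⟨O₃, hO₃, hx₃, hO₃O, hsep⟩ := exists_separating_solutions hO₂ hx₂
    (R.contDiffOn_anchor hO₂R ha) (R.contDiffOn_weight hO₂R ha) p (fun v => hpa x₀ hx₂ v)
    (fun x hx v w => (R.bracket_eq_zero hO₂ hO₂R ha hTa p hpa hker hx v w).1)
    (fun x hx v w => R.weight_closed hO₂ hO₂R ha hTa p hpa hker hx v w) hk
  let U : Opens P := ⟨(extChartAt 𝓘(ℝ, E) o).source ∩ extChartAt 𝓘(ℝ, E) o ⁻¹' O₃,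
    isOpen_source_inter hO₃⟩
  have hUO : ∀ p ∈ (U : Set P), extChartAt 𝓘(ℝ, E) o p ∈ O₃ := fun p hp => hp.2
  have hUR : (U : Set P) ⊆ R.dom := by
    intro p hp
    have := (hO₂R (hO₃O hp.2)).2
    rwa [mem_preimage, (extChartAt 𝓘(ℝ, E) o).left_inv hp.1] at this
  have hqU : B.proj q ∈ U := ⟨hs, hx₃⟩
  -- With `w` the image of `W` in the chart, vanishing of the derivative of the lift of `f` along
  -- `W` reads `df(w) = k (τ(w) - σ(W)) f`, which fixes the constant given to `hsep`. The resulting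
  -- `v` satisfies `τ(w) - σ(W) = τ(w) - β(a v)`, that is, `σ(W) = β(a v)`.
  obtain ⟨v, hv1, hv2⟩ := hsep (chartDeriv E o (B.proj q) (B.dproj q W))
    (R.potential x₀ (chartDeriv E o (B.proj q) (B.dproj q W)) - B.σ q W) (fun f hf hfB => by
      have hfd : ∀ y ∈ O₃, DifferentiableAt ℝ f y := fun y hy =>
        (hf.contDiffAt (hO₃.mem_nhds hy)).differentiableAt (by simp)
      have hsm := R.contMDiffOn_equivariantLift n hf hUR hUO
      have hEig := R.isEigenOn_equivariantLift n hUR fun p hp => hfd _ (hUO p hp)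
      have hzero : ∀ q' ∈ B.proj ⁻¹' (U : Set P), ∀ Y c, ((Y, c), (0, 0)) ∈ B.Lbar q' →
          derivAlong (R.equivariantLift n f) q' Y = 0 := fun q' hq' Y c hY =>
        R.derivAlong_equivariantLift_eq_zero n (hUR hq') (hker _ (hO₃O (hUO _ hq')))
          (hfd _ (hUO _ hq')) (hfB _ (hUO _ hq')) hY
      have hadm : ∀ T : ℂ →L[ℝ] ℝ, B.IsAdmissibleOn (B.proj ⁻¹' (U : Set P))
          (fun q' => T (R.equivariantLift n f q')) := by
        intro T
        refine R.isAdmissibleOn (hO₃O.trans hO₂R) (hS.mono (hO₃O.trans hO₂O))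
          (fun x hx => hTS x (hO₂O (hO₃O hx))) U.isOpen hUR hUO
          (T.contDiff.contMDiff.comp_contMDiffOn hsm) fun q' hq' Y hY => ?_
        have hd : MDifferentiableAt 𝓘(ℝ, F) 𝓘(ℝ, ℂ) (R.equivariantLift n f) q' :=
          (hsm.contMDiffAt ((U.isOpen.preimage
            B.principal.smooth_proj.continuous).mem_nhds hq')).mdifferentiableAt (by simp)
        have h1 := mfderiv_comp q' (T.mdifferentiableAt (x := R.equivariantLift n f q')) hd
        rw [T.mfderiv_eq] at h1
        refine (congrArg (fun S : F →L[ℝ] ℝ => S Y) h1).trans ?_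
        exact (congrArg T (hzero q' hq' Y 0 hY)).trans (map_zero T)
      have h := hW U hqU (R.equivariantLift n f)
        ⟨hsm, hadm Complex.reCLM, hadm Complex.imCLM, hEig⟩
        ⟨⟨hsm, fun q' hq' Y c hY => by
          obtain ⟨rfl, -⟩ := B.exists_of_mem_lbar_vector hY
          rw [hzero q' hq' Y 0 hY]
          simp⟩, hEig⟩
      rw [R.derivAlong_equivariantLift n hq (hfd _ hx₃)] at h
      have h2 := (mul_eq_zero.1 h).resolve_left (zpow_ne_zero _ (Circle.coe_ne_zero _))
      push_cast at h2 ⊢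
      linear_combination h2)
  have hd0 := hTa x₀ hx₂ v
  refine ⟨R.comb (B.proj q) (a x₀ v), Prod.ext ?_ ?_, ?_⟩
  · rw [← chartDeriv_inverse_apply hs (B.dproj q W), hv1]
    have h1 : R.anchor a x₀ v = _ := R.vecPart_chart hs (a x₀ v)
    rw [h1, chartDeriv_inverse_apply hs]
  · ext w
    have h1 := R.formPart_chart hs (a x₀ v) w
    rw [hd0] at h1
    exact h1.symm
  · rw [← R.betaPart_chart hs, hv1] at *
    have h1 : R.weight a x₀ v = R.potential x₀ (R.anchor a x₀ v) - R.betaPart x₀ (a x₀ v) := rfl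
    rw [h1] at hv2
    linarith

end LocalFrame

/-! ### From the regular points to all points -/

namespace Prequantization

variable (B : Prequantization L F Q)

/-- The components of a hamiltonian vector field of the pullback of a function. -/
theorem exists_of_isHamiltonianOn {g : P → ℝ} (hg : ContMDiff 𝓘(ℝ, E) 𝓘(ℝ, ℝ) ∞ g)
    {X : (q : Q) → TangentSpace 𝓘(ℝ, F) q}
    (hX : B.IsHamiltonianOn univ (fun q => g (B.proj q)) X) (q : Q) :
    ∃ x : L.fiber (B.proj q),
      (x : GenTangent E (B.proj q)) = (B.dproj q (X q), differential g (B.proj q)) ∧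
      B.σ q (X q) = B.β (B.proj q) x - g (B.proj q) := by
  obtain ⟨-, φ, -, h⟩ := hX
  obtain ⟨x, b, h1, h2, h3, rfl⟩ := B.exists_of_mem_lbar (h q (mem_univ q))
  have hd : ∀ v, differential (fun q => g (B.proj q)) q v
      = differential g (B.proj q) (B.dproj q v) := by
    intro v
    have h4 := mfderiv_comp q (hg.mdifferentiable (by simp) (B.proj q))
      (B.principal.smooth_proj.mdifferentiable (by simp) q)
    exact congrArg (fun T : F →L[ℝ] ℝ => T v) h4
  simp only [hd] at h3
  -- The pullback of `g` is constant along the fibres, so evaluating on the generator kills the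
  -- contribution of the line through `(-A^H, 1)`.
  have hφ : φ q = 0 := by
    have := h3 (generator q)
    simpa [B.dproj_generator, B.connection.apply_generator] using this.symm
  refine ⟨x, Prod.ext ?_ ?_, h2⟩
  · simpa [hφ] using h1.symm
  · ext w
    obtain ⟨Y, -, rfl⟩ := B.exists_isHorizontalLift q w
    simpa [hφ] using (h3 Y).symm

theorem beta_sub {p : P} (x y : L.fiber p) : B.β p (x - y) = B.β p x - B.β p y :=
  eq_sub_of_add_eq ((map_add (B.β p) (x - y) y).symm.trans
    (congrArg (B.β p) (sub_add_cancel x y)))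

/-- Hamiltonian vector fields which act in the same way on the functions that are both basic and
admissible are equivalent. -/
theorem sub_mem_lbar_of_forall_derivAlong {n : ℤ} (hn : n ≠ 0)
    {X X' : (q : Q) → TangentSpace 𝓘(ℝ, F) q} {g g' : P → ℝ}
    (hg : ContMDiff 𝓘(ℝ, E) 𝓘(ℝ, ℝ) ∞ g) (hg' : ContMDiff 𝓘(ℝ, E) 𝓘(ℝ, ℝ) ∞ g')
    (hX : B.IsHamiltonianOn univ (fun q => g (B.proj q)) X)
    (hX' : B.IsHamiltonianOn univ (fun q => g' (B.proj q)) X')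
    (H : ∀ U : Opens P, ∀ φ ∈ B.Hadm n U, φ ∈ B.Hbas n U → ∀ q ∈ B.proj ⁻¹' (U : Set P),
      derivAlong φ q (X q) = derivAlong φ q (X' q)) (q : Q) :
    ((X q - X' q, 0), (0, 0)) ∈ B.Lbar q := by
  let D : (p : P) → Cotangent E p := fun p => differential g p - differential g' p
  have hdiff : ∀ q, ∃ x : L.fiber (B.proj q),
      (x : GenTangent E (B.proj q)) = (B.dproj q (X q - X' q), D (B.proj q)) ∧
      B.σ q (X q - X' q) = B.β (B.proj q) x - (g (B.proj q) - g' (B.proj q)) := by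
    intro q
    obtain ⟨x, h1, h2⟩ := B.exists_of_isHamiltonianOn hg hX q
    obtain ⟨x', h1', h2'⟩ := B.exists_of_isHamiltonianOn hg' hX' q
    refine ⟨x - x', ?_, ?_⟩
    · rw [Submodule.coe_sub, h1, h1', map_sub]
      rfl
    · rw [map_sub, B.beta_sub, h2, h2']
      ring
  have hβ : ∀ q (x : L.fiber (B.proj q)), (x : GenTangent E (B.proj q)) = (0, D (B.proj q)) →
      B.β (B.proj q) x = D (B.proj q) (B.A (B.proj q)) := by
    intro q x hx
    rw [B.β_eq, hx, pairPlus]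
    simp
  obtain ⟨R, hoR⟩ := exists_localFrame B (B.proj q)
  have hDX : ∀ {Y : (p : P) → TangentSpace 𝓘(ℝ, E) p}, SmoothVectorOn Y R.dom →
      ContinuousOn (fun p => D p (Y p)) R.dom := fun hY =>
    ((contMDiffOn_differential_apply R.isOpen_dom hg.contMDiffOn hY).continuousOn).sub
      (contMDiffOn_differential_apply R.isOpen_dom hg'.contMDiffOn hY).continuousOn
  -- Every nonempty open subset of the frame domain contains a regular point. There `W` is in `L̄ ∩
  -- TQ`, and subtracting that element of `L` from the one of `hdiff` leaves `0 ⊕ D`, on which `β`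
  -- equals `g - g'`.
  have hreg : ∀ G : Set P, IsOpen G → G ⊆ R.dom → G.Nonempty → ∃ q₀ : Q, B.proj q₀ ∈ G ∧
      (∃ x : L.fiber (B.proj q₀), (x : GenTangent E (B.proj q₀)) = (0, D (B.proj q₀)) ∧
        B.β (B.proj q₀) x = g (B.proj q₀) - g' (B.proj q₀)) := by
    intro G hG hGR ⟨p, hp⟩
    have hsub : (extChartAt 𝓘(ℝ, E) (B.proj q)).target ∩
        (extChartAt 𝓘(ℝ, E) (B.proj q)).symm ⁻¹' G ⊆ R.coordDom := fun y hy => ⟨hy.1, hGR hy.2⟩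
    obtain ⟨x₀, hx₀, O, hO, hOo, hxO, hrank⟩ := exists_constant_rank
      (isOpen_chart_target_inter (B.proj q) hG)
      ⟨extChartAt 𝓘(ℝ, E) (B.proj q) p, (extChartAt 𝓘(ℝ, E) (B.proj q)).map_source
        (R.dom_subset (hGR hp)), by
          rwa [mem_preimage, (extChartAt 𝓘(ℝ, E) (B.proj q)).left_inv (R.dom_subset (hGR hp))]⟩
      (R.contDiffOn_formPart.continuousOn.mono hsub)
    have hproj : B.proj (R.coordSec x₀) = (extChartAt 𝓘(ℝ, E) (B.proj q)).symm x₀ :=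
      R.proj_coordSec (hsub hx₀)
    have hcoord : extChartAt 𝓘(ℝ, E) (B.proj q) (B.proj (R.coordSec x₀)) = x₀ := by
      rw [hproj, (extChartAt 𝓘(ℝ, E) (B.proj q)).right_inv hx₀.1]
    have hmem : B.proj (R.coordSec x₀) ∈ G := by
      rw [hproj]
      exact hx₀.2
    refine ⟨R.coordSec x₀, hmem, ?_⟩
    obtain ⟨x, h1, h2⟩ := hdiff (R.coordSec x₀)
    obtain ⟨z, h3, h4⟩ := R.exists_of_forall_derivAlong_eq_zero hn hOo (hO.trans hsub)
      (q := R.coordSec x₀) (hGR hmem) (by rw [hcoord]; exact hxO) (by rw [hcoord]; exact hrank)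
      (W := X (R.coordSec x₀) - X' (R.coordSec x₀)) fun U hU φ hφ hφ' => by
        rw [derivAlong_sub, sub_eq_zero]
        exact H U φ hφ hφ' _ hU
    refine ⟨x - z, ?_, ?_⟩
    · rw [Submodule.coe_sub, h1, h3]
      simp
    · rw [B.beta_sub]
      linarith
  -- Density argument: if `f` were nonzero at the given point, it would be nonzero on an open set,
  -- which contains one of the points of `hreg`.
  have hclosed : ∀ {f : P → ℝ}, ContinuousOn f R.dom →
      (∀ q₀, B.proj q₀ ∈ R.dom →
        (∃ x : L.fiber (B.proj q₀), (x : GenTangent E (B.proj q₀)) = (0, D (B.proj q₀)) ∧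
          B.β (B.proj q₀) x = g (B.proj q₀) - g' (B.proj q₀)) → f (B.proj q₀) = 0) →
      f (B.proj q) = 0 := by
    intro f hf hf0
    by_contra hne
    obtain ⟨q₀, hq₀, hx⟩ := hreg (R.dom ∩ f ⁻¹' {0}ᶜ)
      (hf.isOpen_inter_preimage R.isOpen_dom isOpen_compl_singleton) inter_subset_left
      ⟨B.proj q, hoR, hne⟩
    exact hq₀.2 (hf0 q₀ hq₀.1 hx)
  have hframe : ∀ i, D (B.proj q) (R.frame i (B.proj q) : GenTangent E (B.proj q)).1 = 0 := by
    intro i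
    refine hclosed (hDX (R.smooth_frame i).1) fun q₀ hq₀ ⟨x, hx, _⟩ => ?_
    have h := (L.maximal_isotropic (B.proj q₀)).1 x x.2 (R.frame i (B.proj q₀)) (Subtype.mem _)
    rw [hx, pairPlus] at h
    simpa using h
  have hAq : D (B.proj q) (B.A (B.proj q)) - (g (B.proj q) - g' (B.proj q)) = 0 := by
    refine hclosed (f := fun p => D p (B.A p) - (g p - g' p))
      ((hDX (ContMDiffOn.mono B.smooth_A (subset_univ _))).sub
        ((hg.continuous.sub hg'.continuous).continuousOn)) fun q₀ hq₀ ⟨x, hx, hx'⟩ => ?_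
    rw [← hx', hβ q₀ x hx, sub_self]
  -- Membership in `L` is not visibly a closed condition, but by maximal isotropy it reduces to the
  -- vanishing of `D` on the vector parts of the frame, which has just been extended by continuity.
  have hmem : ((0, D (B.proj q)) : GenTangent E (B.proj q)) ∈ L.fiber (B.proj q) := by
    refine mem_of_forall_pairPlus_eq_zero (L.maximal_isotropic (B.proj q)) (map_zero _)
      fun e he => ?_
    obtain ⟨c, hc⟩ := (R.bijective _ hoR).2 ⟨e, he⟩
    have hc' : e = ∑ i, c i • (R.frame i (B.proj q) : GenTangent E (B.proj q)) := by
      have := congrArg Subtype.val hc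
      rw [Fintype.linearCombination_apply] at this
      simpa [Submodule.coe_sum] using this.symm
    rw [map_zero, zero_add, hc', Prod.fst_sum, map_sum]
    exact Finset.sum_eq_zero fun i _ => by rw [Prod.smul_fst, map_smul, hframe i, smul_zero]
  obtain ⟨x, h1, h2⟩ := hdiff q
  -- Removing `0 ⊕ D` cancels the covector part. The value of `β` drops by `D(A) = g - g'`, which
  -- absorbs the term left over in `σ(W)`.
  refine B.mem_lbar (x := x - ⟨_, hmem⟩) ?_ ?_ fun v => ?_
  · rw [Submodule.coe_sub, h1]
    simp
  · rw [B.beta_sub, h2, hβ q ⟨_, hmem⟩ rfl]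
    linarith
  · rw [Submodule.coe_sub, h1]
    simp

end Prequantization

end Final

end DiracPrequant

end

theorem proposition5p2
    {E : Type*} [NormedAddCommGroup E] [NormedSpace ℝ E] [FiniteDimensional ℝ E]
    {P : Type*} [TopologicalSpace P] [T2Space P] [SecondCountableTopology P]
    [ChartedSpace E P] [IsManifold 𝓘(ℝ, E) ∞ P]
    (L : DiracPrequant.DiracStructure E P)
    {F : Type*} [NormedAddCommGroup F] [NormedSpace ℝ F] [FiniteDimensional ℝ F]
    {Q : Type*} [TopologicalSpace Q] [T2Space Q] [SecondCountableTopology Q]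
    [ChartedSpace F Q] [IsManifold 𝓘(ℝ, F) ∞ Q] [MulAction Circle Q]
    (B : DiracPrequant.Prequantization L F Q) (n : ℤ) (hn : n ≠ 0) :
    Function.Injective (B.admOperator n) ∧ Function.Injective (B.basOperator n) := by
  -- Equality of operators on either sheaf yields equality on the sections common to both, which is
  -- all that is required.
  have key : ∀ X X' : B.HamiltonianField, (∀ U : TopologicalSpace.Opens P, ∀ φ ∈ B.Hadm n U,
      φ ∈ B.Hbas n U → ∀ q ∈ B.proj ⁻¹' (U : Set P), DiracPrequant.derivAlong φ q (X.1 q)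
        = DiracPrequant.derivAlong φ q (X'.1 q)) → B.hamiltonianSetoid.r X X' := by
    rintro ⟨X, g, ⟨hg, _⟩, hX⟩ ⟨X', g', ⟨hg', _⟩, hX'⟩ H
    exact B.sub_mem_lbar_of_forall_derivAlong hn hg hg' hX hX' H
  refine ⟨fun c c' => Quotient.inductionOn₂ c c' fun X X' h => ?_,
    fun c c' => Quotient.inductionOn₂ c c' fun X X' h => ?_⟩
  · refine Quotient.sound (key X X' fun U φ hφ _ q hq => ?_)
    exact neg_injective (congrFun (congrFun (congrFun h U) ⟨φ, hφ⟩) ⟨q, hq⟩)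
  · refine Quotient.sound (key X X' fun U φ _ hφ q hq => ?_)
    exact neg_injective (congrFun (congrFun (congrFun h U) ⟨φ, hφ⟩) ⟨q, hq⟩)
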